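/- Let $\mathfrak g\subset\mathfrak{gl}_N(\mathbb C)$ be one of $\mathfrak{so}_{2n+1}$ ($N=2n+1$, $n\ge 2$), $\mathfrak{sp}_{2n}$ ($N=2n$, $n\ge 2$), $\mathfrak{so}_{2n}$ ($N=2n$, $n\ge 4$), realized as the Lie algebra of the group preserving an antidiagonal (symmetric, resp. alternating) nondegenerate form, so that the diagonal matrices of $\mathfrak g$ form a Cartan subalgebra $\mathfrak h$ and the upper triangular matrices of $\mathfrak g$ form a Borel subalgebra. Let $\varepsilon_i\in\mathfrak h^*$ ($1\le i\le n$) be the $i$-th diagonal coefficient and identify $\beta\in\mathbb Z^n$ with the weight $\sum_i\beta_i\varepsilon_i$. For a finite-dimensional $\mathfrak g$-module $M$ with weights in $\mathbb Z^n$ write $\operatorname{char}(M)=\sum_{\beta\in\mathbb Z^n}\dim(M_\beta)\,e^\beta\in\mathbb Z[\mathbb Z^n]$. Let $P^+$ be the set of dominant weights in $\mathbb Z^n$, that is, $P^+=\{\lambda:\lambda_1\ge\dots\ge\lambda_n\ge 0\}$ for $\mathfrak{so}_{2n+1}$ and $\mathfrak{sp}_{2n}$, and $P^+=\{\lambda:\lambda_1\ge\dots\ge\lambda_{n-1}\ge|\lambda_n|\}$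 for $\mathfrak{so}_{2n}$. For $\lambda\in P^+$ let $V^{\mathfrak g}(\lambda)$ be the irreducible $\mathfrak g$-module of highest weight $\lambda$ and $s^{\mathfrak g}_\lambda=\operatorname{char}(V^{\mathfrak g}(\lambda))$. For a partition $\nu$ with at most $N$ parts let $V^{\mathfrak{gl}_N}(\nu)$ be the irreducible $\mathfrak{gl}_N$-module of highest weight $\nu$, and let $b^{\mathfrak g}_{\nu,\lambda}=\dim\operatorname{Hom}_{\mathfrak g}(V^{\mathfrak g}(\lambda),V^{\mathfrak{gl}_N}(\nu))$ be the multiplicity of $V^{\mathfrak g}(\lambda)$ in the restriction of $V^{\mathfrak{gl}_N}(\nu)$ to $\mathfrak g$. Let $\mathcal P_N^{(1,1)}(2k)$ (resp. $\mathcal P_N^{(2)}(2k)$) be the set of partitions of $2k$ with at most $N$ parts all of whose columns (resp. rows) have even length. Let $S^k(\mathfrak g)$ be the $k$-th symmetric power of the adjoint module. Then for every integer $k\ge 0$, $$\operatorname{char}(S^k(\mathfrak{so}_N))=\sum_{\lambda\in P^+}\ \sum_{\nu\in\mathcal P_N^{(1,1)}(2k)}b^{\mathfrak{so}_N}_{\nu,\lambda}\,s^{\mathfrak{so}_N}_\lambda\qquad(N=2n+1,\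 n\ge2,\ \text{or}\ N=2n,\ n\ge 4),$$ $$\operatorname{char}(S^k(\mathfrak{sp}_{2n}))=\sum_{\lambda\in P^+}\ \sum_{\nu\in\mathcal P_{2n}^{(2)}(2k)}b^{\mathfrak{sp}_{2n}}_{\nu,\lambda}\,s^{\mathfrak{sp}_{2n}}_\lambda\qquad(n\ge 2),$$ where in each sum only finitely many terms are nonzero. -/

import Mathlib

attribute [local instance 100] LieRing.ofAssociativeRing

open scoped BigOperators

noncomputable section

namespace ClassicalBranching

/-! ## The symmetric algebra and the symmetric powers of a Lie module -/

section SymmetricPowers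

variable {R : Type} [CommRing R] {M : Type} [AddCommGroup M] [Module R M]

/-- The algebra homomorphism `S(M) → S(M)[ε]` sending `m` to `m + ε f(m)`. -/
def symDualHom (f : M →ₗ[R] M) :
    SymmetricAlgebra R M →ₐ[R] DualNumber (SymmetricAlgebra R M) :=
  SymmetricAlgebra.lift
    ((TrivSqZeroExt.inlAlgHom R (SymmetricAlgebra R M) (SymmetricAlgebra R M)).toLinearMap ∘ₗ
        SymmetricAlgebra.ι R M +
      (TrivSqZeroExt.inrHom (SymmetricAlgebra R M) (SymmetricAlgebra R M)).restrictScalars R ∘ₗ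
        SymmetricAlgebra.ι R M ∘ₗ f)

theorem symDualHom_fst (f : M →ₗ[R] M) (a : SymmetricAlgebra R M) :
    (symDualHom f a).fst = a := by
  have h : (TrivSqZeroExt.fstHom R (SymmetricAlgebra R M) (SymmetricAlgebra R M)).comp
      (symDualHom f) = AlgHom.id R _ := by
    apply SymmetricAlgebra.algHom_ext
    ext m
    simp [symDualHom]
  exact congrArg (fun g => g a) h

/-- The derivation of `S(M)` that extends the linear endomorphism `f` of `M`. -/
def symDerivation (f : M →ₗ[R] M) :
    Derivation R (SymmetricAlgebra R M) (SymmetricAlgebra R M) :=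
  Derivation.mk'
    ((TrivSqZeroExt.sndHom (SymmetricAlgebra R M) (SymmetricAlgebra R M)).restrictScalars R ∘ₗ
      (symDualHom f).toLinearMap)
    (by
      intro a b
      simp [symDualHom_fst, mul_comm])

theorem symDerivation_ι (f : M →ₗ[R] M) (m : M) :
    symDerivation f (SymmetricAlgebra.ι R M m) = SymmetricAlgebra.ι R M (f m) := by
  simp [symDerivation, symDualHom]

theorem derivation_sym_ext {D E : Derivation R (SymmetricAlgebra R M) (SymmetricAlgebra R M)}
    (h : ∀ m, D (SymmetricAlgebra.ι R M m) = E (SymmetricAlgebra.ι R M m)) : D = E := by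
  ext a
  induction a using SymmetricAlgebra.induction with
  | algebraMap r => simp
  | ι x => exact h x
  | mul a b ha hb => simp [ha, hb]
  | add a b ha hb => simp [ha, hb]

variable {L : Type} [LieRing L] [LieAlgebra R L] [LieRingModule L M] [LieModule R L M]

variable (R M L) in
/-- The action of a Lie algebra on `S(M)` by derivations, extending its action on `M`. -/
def symAction : L →ₗ⁅R⁆ Derivation R (SymmetricAlgebra R M) (SymmetricAlgebra R M) where
  toFun x := symDerivation (LieModule.toEnd R L M x)
  map_add' x y := derivation_sym_ext fun m => by simp [symDerivation_ι]
  map_smul' c x := derivation_sym_ext fun m => by simp [symDerivation_ι]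
  map_lie' {x y} := derivation_sym_ext fun m => by
    simp [symDerivation_ι, Derivation.commutator_apply]

instance : LieRingModule L (SymmetricAlgebra R M) :=
  LieRingModule.compLieHom (SymmetricAlgebra R M) (symAction R M L)

theorem lie_sym (x : L) (a : SymmetricAlgebra R M) : ⁅x, a⁆ = symAction R M L x a := rfl

theorem lie_sym_ι (x : L) (m : M) :
    ⁅x, SymmetricAlgebra.ι R M m⁆ = SymmetricAlgebra.ι R M ⁅x, m⁆ := by
  rw [lie_sym]
  exact symDerivation_ι _ m

instance : LieModule R L (SymmetricAlgebra R M) where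
  smul_lie c x a := by simp [lie_sym]
  lie_smul c x a := by simp [lie_sym]

variable (R M L) in
/-- The `k`-th symmetric power `S^k(M)`: the homogeneous component of degree `k` of `S(M)`,
spanned by the products of `k` elements of `M`. -/
def symPower (k : ℕ) : LieSubmodule R L (SymmetricAlgebra R M) where
  __ := (LinearMap.range (SymmetricAlgebra.ι R M)) ^ k
  lie_mem := by
    intro x a ha
    refine Submodule.pow_induction_on_left' (LinearMap.range (SymmetricAlgebra.ι R M))
      (C := fun i a _ => ⁅x, a⁆ ∈ (LinearMap.range (SymmetricAlgebra.ι R M)) ^ i)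
      ?_ ?_ ?_ ha
    · intro r
      simp [lie_sym]
    · intro a b i _ _ ha hb
      rw [lie_add]
      exact add_mem ha hb
    · rintro _ ⟨m, rfl⟩ i a ha hxa
      have h : ⁅x, SymmetricAlgebra.ι R M m * a⁆ =
          SymmetricAlgebra.ι R M m * ⁅x, a⁆ + SymmetricAlgebra.ι R M ⁅x, m⁆ * a := by
        rw [← lie_sym_ι, lie_sym, lie_sym, lie_sym, Derivation.leibniz, smul_eq_mul, smul_eq_mul,
          mul_comm a]
      rw [h, Nat.succ_eq_add_one, pow_succ']
      exact add_mem (Submodule.mul_mem_mul ⟨m, rfl⟩ hxa) (Submodule.mul_mem_mul ⟨_, rfl⟩ ha)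

end SymmetricPowers

/-! ## Weights, formal characters and irreducible highest weight modules

Throughout, `ρ : L → 𝔤𝔩_N` is a Lie algebra homomorphism; it will be the inclusion of a classical
Lie algebra `L ⊆ 𝔤𝔩_N` whose Cartan subalgebra consists of the diagonal matrices in `L` and whose
Borel subalgebra consists of the upper triangular matrices in `L`. -/

section Weights

/-- The value of the weight `β = β₁ε₁ + ⋯ + βₙεₙ` at a (diagonal) matrix `X`, where `εᵢ` is the
`i`-th diagonal coefficient. -/
def weightEval {n N : ℕ} (β : Fin n → ℤ) (X : Matrix (Fin N) (Fin N) ℂ) : ℂ :=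
  ∑ j : Fin N, if h : (j : ℕ) < n then (β ⟨j, h⟩ : ℂ) * X j j else 0

variable {N : ℕ} {L : Type} [LieRing L] [LieAlgebra ℂ L]
  (ρ : L →ₗ⁅ℂ⁆ Matrix (Fin N) (Fin N) ℂ)

/-- The weight space of weight `β` of an `L`-module `M`. -/
def weightSpace (M : Type) [AddCommGroup M] [Module ℂ M] [LieRingModule L M] [LieModule ℂ L M]
    {n : ℕ} (β : Fin n → ℤ) : Submodule ℂ M :=
  ⨅ (x : L) (_ : (ρ x).IsDiag),
    Module.End.eigenspace (LieModule.toEnd ℂ L M x) (weightEval β (ρ x))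

/-- The character `∑_β (dim M_β) e^β ∈ ℤ[ℤⁿ]` of an `L`-module `M` (with finitely many weights). -/
def formalChar (n : ℕ) (M : Type) [AddCommGroup M] [Module ℂ M] [LieRingModule L M]
    [LieModule ℂ L M] : AddMonoidAlgebra ℤ (Fin n → ℤ) :=
  ∑ᶠ β : Fin n → ℤ,
    AddMonoidAlgebra.single β (Module.finrank ℂ (weightSpace ρ M β) : ℤ)

/-- The left ideal of the universal enveloping algebra generated by the strictly upper triangular
elements of `L` and by `x - λ(x)`, for `x` in `L` diagonal. The quotient by it is the Verma module
of highest weight `λ`. -/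
def vermaIdeal {n : ℕ} (lam : Fin n → ℤ) : Submodule (UniversalEnvelopingAlgebra ℂ L)
    (UniversalEnvelopingAlgebra ℂ L) :=
  Submodule.span (UniversalEnvelopingAlgebra ℂ L)
    ({u | ∃ x : L, (∀ i j, j ≤ i → ρ x i j = 0) ∧ u = UniversalEnvelopingAlgebra.ι ℂ x} ∪
      {u | ∃ x : L, (ρ x).IsDiag ∧ u = UniversalEnvelopingAlgebra.ι ℂ x -
        algebraMap ℂ (UniversalEnvelopingAlgebra ℂ L) (weightEval lam (ρ x))})

/-- The sum of all the proper left ideals containing `vermaIdeal ρ λ`. It corresponds to the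
largest proper submodule of the Verma module of highest weight `λ`. -/
def maxIdeal {n : ℕ} (lam : Fin n → ℤ) : Submodule (UniversalEnvelopingAlgebra ℂ L)
    (UniversalEnvelopingAlgebra ℂ L) :=
  sSup {I | vermaIdeal ρ lam ≤ I ∧ I ≠ ⊤}

/-- The irreducible `L`-module of highest weight `λ`: the quotient of the Verma module of highest
weight `λ` by its largest proper submodule. -/
def Irrep {n : ℕ} (lam : Fin n → ℤ) : Type :=
  UniversalEnvelopingAlgebra ℂ L ⧸ maxIdeal ρ lam

variable {n : ℕ} (lam : Fin n → ℤ)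

instance : AddCommGroup (Irrep ρ lam) :=
  inferInstanceAs (AddCommGroup (UniversalEnvelopingAlgebra ℂ L ⧸ maxIdeal ρ lam))

instance : Module (UniversalEnvelopingAlgebra ℂ L) (Irrep ρ lam) :=
  inferInstanceAs (Module (UniversalEnvelopingAlgebra ℂ L)
    (UniversalEnvelopingAlgebra ℂ L ⧸ maxIdeal ρ lam))

instance : Module ℂ (Irrep ρ lam) :=
  inferInstanceAs (Module ℂ (UniversalEnvelopingAlgebra ℂ L ⧸ maxIdeal ρ lam))

instance : IsScalarTower ℂ (UniversalEnvelopingAlgebra ℂ L) (Irrep ρ lam) :=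
  inferInstanceAs (IsScalarTower ℂ (UniversalEnvelopingAlgebra ℂ L)
    (UniversalEnvelopingAlgebra ℂ L ⧸ maxIdeal ρ lam))

instance : LieRingModule L (Irrep ρ lam) where
  bracket x v := UniversalEnvelopingAlgebra.ι ℂ x • v
  add_lie x y v := by
    rw [map_add, add_smul]
  lie_add x v w := smul_add (UniversalEnvelopingAlgebra.ι ℂ x) v w
  leibniz_lie x y v := by
    change UniversalEnvelopingAlgebra.ι ℂ x • UniversalEnvelopingAlgebra.ι ℂ y • v =
      UniversalEnvelopingAlgebra.ι ℂ ⁅x, y⁆ • v +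
        UniversalEnvelopingAlgebra.ι ℂ y • UniversalEnvelopingAlgebra.ι ℂ x • v
    rw [LieHom.map_lie, LieRing.of_associative_ring_bracket, sub_smul, mul_smul, mul_smul,
      sub_add_cancel]

instance : LieModule ℂ L (Irrep ρ lam) where
  smul_lie c x v := by
    change UniversalEnvelopingAlgebra.ι ℂ (c • x) • v =
      c • UniversalEnvelopingAlgebra.ι ℂ x • v
    rw [map_smul, smul_assoc]
  lie_smul c x v := by
    change UniversalEnvelopingAlgebra.ι ℂ x • c • v =
      c • UniversalEnvelopingAlgebra.ι ℂ x • v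
    rw [← algebraMap_smul (UniversalEnvelopingAlgebra ℂ L) c v,
      ← algebraMap_smul (UniversalEnvelopingAlgebra ℂ L) c (_ • v), ← mul_smul, ← mul_smul,
      Algebra.commutes]

end Weights

/-! ## The classical Lie algebras and the branching coefficients -/

/-- The Lie algebra `𝔤𝔩_N`. -/
abbrev gl (N : ℕ) : Type := Matrix (Fin N) (Fin N) ℂ

/-- `𝔰𝔬_N`, the Lie algebra of the group preserving the symmetric bilinear form whose matrix has
`1` on the antidiagonal and `0` elsewhere. -/
def so (N : ℕ) : LieSubalgebra ℂ (gl N) :=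
  skewAdjointMatricesLieSubalgebra (Matrix.of fun i j : Fin N => if j = i.rev then (1 : ℂ) else 0)

/-- `𝔰𝔭_{2n}`, the Lie algebra of the group preserving the alternating bilinear form whose matrix
is zero off the antidiagonal, with antidiagonal `1, …, 1, -1, …, -1` from top to bottom. -/
def sp (n : ℕ) : LieSubalgebra ℂ (gl (2 * n)) :=
  skewAdjointMatricesLieSubalgebra (Matrix.of fun i j : Fin (2 * n) =>
    if j = i.rev then (if i < j then (1 : ℂ) else -1) else 0)

/-- The irreducible polynomial `𝔤𝔩_N`-module `V^{𝔤𝔩_N}(ν)` of highest weight the partition `ν`. -/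
abbrev glIrrep (N : ℕ) (ν : Fin N → ℕ) : Type :=
  Irrep (LieHom.id : gl N →ₗ⁅ℂ⁆ gl N) (fun i => (ν i : ℤ))

/-- The branching coefficient `b_{ν,λ}^𝔤`: the multiplicity of the irreducible `𝔤`-module
`V^𝔤(λ)` in the restriction of `V^{𝔤𝔩_N}(ν)` to `𝔤`, i.e. the dimension of the space of
`𝔤`-homomorphisms from the former to the latter. -/
def branching {n N : ℕ} (𝔤 : LieSubalgebra ℂ (gl N)) (ν : Fin N → ℕ) (lam : Fin n → ℤ) : ℕ :=
  Module.finrank ℂ (Irrep 𝔤.incl lam →ₗ⁅ℂ, 𝔤⁆ glIrrep N ν)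

/-- The Weyl character `s_λ^𝔤 ∈ ℤ[ℤⁿ]` of `V^𝔤(λ)`. -/
def weylChar {n N : ℕ} (𝔤 : LieSubalgebra ℂ (gl N)) (lam : Fin n → ℤ) :
    AddMonoidAlgebra ℤ (Fin n → ℤ) :=
  formalChar 𝔤.incl n (Irrep 𝔤.incl lam)

/-- The character of the `k`-th symmetric power `S^k(𝔤)` of the adjoint representation. -/
def symPowerChar {N : ℕ} (n : ℕ) (𝔤 : LieSubalgebra ℂ (gl N)) (k : ℕ) :
    AddMonoidAlgebra ℤ (Fin n → ℤ) :=
  formalChar 𝔤.incl n (symPower ℂ 𝔤 𝔤 k)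

/-! ## Partitions and dominant weights -/

/-- The partitions with at most `n` nonzero parts, seen as weights. These are the highest weights
of the irreducible representations of `SO_{2n+1}` and of `Sp_{2n}`. -/
def partitionWeights (n : ℕ) : Set (Fin n → ℤ) :=
  {lam | Antitone lam ∧ ∀ i, 0 ≤ lam i}

/-- The weights `λ₁ ≥ ⋯ ≥ λ_{n-1} ≥ |λₙ|`. These are the highest weights of the irreducible
representations of `SO_{2n}`. -/
def dominantWeightsD (n : ℕ) : Set (Fin n → ℤ) :=
  {lam | ∀ i j, i < j → |lam j| ≤ lam i}

/-- The partitions of `m` with at most `N` parts. -/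
def partitions (N m : ℕ) : Finset (Fin N → ℕ) :=
  open Classical in (Finset.piAntidiag Finset.univ m).filter Antitone

/-- The partitions of `m` with at most `N` parts, all of whose rows have even length. -/
def evenRows (N m : ℕ) : Finset (Fin N → ℕ) :=
  open Classical in (partitions N m).filter fun ν => ∀ i, Even (ν i)

/-- The partitions of `m` with at most `N` parts, all of whose columns have even length. -/
def evenColumns (N m : ℕ) : Finset (Fin N → ℕ) :=
  open Classical in (partitions N m).filter fun ν =>
    ∀ j : ℕ, Even (Finset.univ.filter fun i => j < ν i).card

end ClassicalBranching

end

/-!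
Multiplication by the matrix of the form identifies the adjoint representation of `𝔰𝔬_N` with the
exterior square, and that of `𝔰𝔭_{2n}` with the symmetric square, of the vector representation
(`adjointEquiv`). Both squares are restrictions of representations of `𝔤𝔩_N`, realized as the
matrices `A` with `Aᵀ = s A`, where `s = -1` for `𝔰𝔬_N` and `s = 1` for `𝔰𝔭_{2n}` (`FormSpace N s`).
The theorem is therefore the restriction to `𝔤` of the classical decomposition over `𝔤𝔩_N`: the
`k`-th symmetric power of `FormSpace N s` is multiplicity free, and its highest weights are the
partitions of `2 k` with even columns for `s = -1`, with even rows for `s = 1`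
(`finrank_hwSpace_symPower`).

*Existence over `𝔤𝔩_N`.* The leading principal minors of a symmetric matrix, and the leading
principal Pfaffians of an alternating one, are highest weight vectors. The symmetric algebra is a
domain, so that the products of these give all the weights in question
(`exists_hwVector_of_mem_evenPartitions`).

*Uniqueness over `𝔤𝔩_N`.* The Borel subgroup has a dense orbit on the forms, which passes through
the forms supported on the diagonal (`s = 1`), or on the places `(1, 2), (3, 4), …` and their
mirror images (`s = -1`). Infinitesimally: if each monomial of a highest weight vector involves a
variable outside these places, then the strictly upper triangular matrices produce from its terms
of least order terms that cannot cancel, so that it vanishes (`eq_zero_of_derivations`,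
`eq_zero_of_hasOrder`). A nonzero highest weight vector thus contains a monomial in the variables at
the special places. Such a monomial is determined by its weight, whence the multiplicity one
(`exists_injective_hwSpace_sym`), and its weight has even rows, or even columns
(`exists_evenPartition`).

*Semisimplicity.* For the Fischer form on polynomials, the adjoint of the action of a matrix is
the action of its conjugate transpose (`isUnitarizable_sym`). The classical Lie algebras are stable
under the conjugate transpose, so that the symmetric powers and all their submodules are completely
reducible over `𝔤𝔩_N` and over `𝔤`. An additive invariant, such as the character or the
multiplicity of a weight after restriction, is then the sum of its values on the irreducible
highest weight modules, each counted with the dimension of the space of highest weight vectors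
(`TriangularData.additive_eq_finsum`). Applied to multiplicities over `𝔤`, this expresses those of
the symmetric powers by branching coefficients (`finrank_hwSpace_eq_sum_branching`); applied to
characters over `𝔤`, it gives the theorem (`symPowerChar_classical`).

*The range of the sum.* The highest weights that occur over `𝔤` are dominant, because
`‖e* v‖² = λ([e, e*]) ‖v‖²` for a highest weight vector `v` of weight `λ` and a root vector `e`
(`IsUnitarizable.re_weightEval_nonneg`). Conversely, `branching` and `weylChar` are defined by a
quotient of the Verma module, which has the highest weight `λ` only if the Verma module does not
vanish. For every dominant `λ` this is shown by exhibiting a highest weight vector of weight `λ`,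
a product of minors of a generic matrix (`hasHighestWeight_of_mem_partitionWeights`,
`hasHighestWeight_of_mem_dominantWeightsD`).

Weights and highest weight modules are handled for any Lie algebra of matrices with
`TriangularData`. It contains a diagonal element `h` that grades the Lie algebra by the diagonals
`j - i = d`; the eigenspaces of `h` replace the order on the weights.
-/

noncomputable section

namespace ClassicalBranching

/-! ### Highest weight modules -/

section HighestWeight

variable {N n : ℕ} {L : Type} [LieRing L] [LieAlgebra ℂ L]

/-- A triangular structure on a Lie algebra `L` of matrices, the image of `ρ`: `L` is stable under
extraction of the diagonals `j - i = d`, it contains the matrix `diag(N - 1, N - 3, …, 1 - N)`,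
whose adjoint action has eigenvalue `2 d` on the diagonal `j - i = d`, and it contains a diagonal
matrix at which distinct integral weights take distinct values. -/
structure TriangularData (ρ : L →ₗ⁅ℂ⁆ Matrix (Fin N) (Fin N) ℂ) (n : ℕ) where
  injective : Function.Injective ρ
  exists_diagPart : ∀ (x : L) (d : ℤ), ∃ y : L,
    ρ y = Matrix.of fun i j : Fin N => if (j : ℤ) - i = d then ρ x i j else 0
  /-- The element whose adjoint action grades `L` by the diagonals. -/
  h : L
  map_h : ρ h = Matrix.diagonal fun i : Fin N => (N : ℂ) - 1 - 2 * (i : ℕ)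
  /-- A diagonal element that separates the integral weights. -/
  t : L
  isDiag_t : (ρ t).IsDiag
  weightEval_t_injective : Function.Injective fun β : Fin n → ℤ => weightEval β (ρ t)

variable {ρ : L →ₗ⁅ℂ⁆ Matrix (Fin N) (Fin N) ℂ}
variable {M : Type} [AddCommGroup M] [Module ℂ M] [LieRingModule L M] [LieModule ℂ L M]

theorem mem_weightSpace {β : Fin n → ℤ} {v : M} :
    v ∈ weightSpace ρ M β ↔ ∀ x : L, (ρ x).IsDiag → ⁅x, v⁆ = weightEval β (ρ x) • v := by
  simp [weightSpace]

variable (ρ M) in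
/-- The space of highest weight vectors of weight `β`: the vectors of weight `β` that are killed
by the strictly upper triangular elements of `L`. -/
def hwSpace (β : Fin n → ℤ) : Submodule ℂ M where
  carrier := {v | v ∈ weightSpace ρ M β ∧
    ∀ x : L, (∀ i j, j ≤ i → ρ x i j = 0) → ⁅x, v⁆ = 0}
  add_mem' := fun ha hb => ⟨add_mem ha.1 hb.1, fun x hx => by
    rw [lie_add, ha.2 x hx, hb.2 x hx, add_zero]⟩
  zero_mem' := ⟨zero_mem _, fun x _ => lie_zero x⟩
  smul_mem' := fun c a ha => ⟨Submodule.smul_mem _ c ha.1, fun x hx => by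
    rw [lie_smul, ha.2 x hx, smul_zero]⟩

theorem mem_hwSpace {β : Fin n → ℤ} {v : M} : v ∈ hwSpace ρ M β ↔ v ∈ weightSpace ρ M β ∧
    ∀ x : L, (∀ i j, j ≤ i → ρ x i j = 0) → ⁅x, v⁆ = 0 := Iff.rfl

namespace TriangularData

variable (T : TriangularData ρ n)
include T

theorem isDiag_h : (ρ T.h).IsDiag := by
  rw [T.map_h]; exact Matrix.isDiag_diagonal _

/-- The adjoint action of `h` has eigenvalue `2 d` on the diagonal `j - i = d`. -/
theorem lie_h_of_diag {y : L} {d : ℤ} (hy : ∀ i j : Fin N, (j : ℤ) - i ≠ d → ρ y i j = 0) :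
    ⁅T.h, y⁆ = (2 * d : ℂ) • y := by
  apply T.injective
  rw [LieHom.map_lie, map_smul, T.map_h, LieRing.of_associative_ring_bracket]
  ext i j
  rw [Matrix.sub_apply, Matrix.diagonal_mul, Matrix.mul_diagonal, Matrix.smul_apply, smul_eq_mul]
  by_cases hij : (j : ℤ) - i = d
  · rw [← hij]; push_cast; ring
  · simp [hy i j hij]

theorem lie_h_lie_of_diag {y : L} {d : ℤ} (hy : ∀ i j : Fin N, (j : ℤ) - i ≠ d → ρ y i j = 0)
    {c : ℂ} {v : M} (hv : ⁅T.h, v⁆ = c • v) : ⁅T.h, ⁅y, v⁆⁆ = (c + 2 * d) • ⁅y, v⁆ := by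
  rw [leibniz_lie, T.lie_h_of_diag hy, hv, smul_lie, lie_smul, add_smul, add_comm]

/-- An element is the sum of its parts on the diagonals `j - i = d`, which belong to `L`. -/
theorem exists_sum_diagPart (x : L) : ∃ p : ℤ → L,
    (∀ d, ρ (p d) = Matrix.of fun i j : Fin N => if (j : ℤ) - i = d then ρ x i j else 0) ∧
    x = ∑ d ∈ Finset.Ioo (-(N : ℤ)) N, p d := by
  choose p hp using T.exists_diagPart x
  refine ⟨p, hp, T.injective ?_⟩
  rw [map_sum]
  ext i j
  rw [Matrix.sum_apply]
  simp only [hp, Matrix.of_apply]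
  rw [Finset.sum_ite_eq, if_pos]
  rw [Finset.mem_Ioo]
  have := i.2
  have := j.2
  constructor <;> omega

/-- Every element is the sum of a strictly lower triangular one and an upper triangular one. -/
theorem exists_lower_add_upper (x : L) : ∃ a b : L, (∀ i j, i ≤ j → ρ a i j = 0) ∧
    (∀ i j, j < i → ρ b i j = 0) ∧ x = a + b := by
  obtain ⟨p, hp, hx⟩ := T.exists_sum_diagPart x
  refine ⟨∑ d ∈ (Finset.Ioo (-(N : ℤ)) N).filter (· < 0), p d,
    ∑ d ∈ (Finset.Ioo (-(N : ℤ)) N).filter (¬ · < 0), p d, ?_, ?_, ?_⟩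
  · intro i j hij
    rw [map_sum, Matrix.sum_apply]
    refine Finset.sum_eq_zero fun d hd => ?_
    rw [hp, Matrix.of_apply, if_neg]
    have := (Finset.mem_filter.mp hd).2
    have : (i : ℕ) ≤ j := hij
    omega
  · intro i j hij
    rw [map_sum, Matrix.sum_apply]
    refine Finset.sum_eq_zero fun d hd => ?_
    rw [hp, Matrix.of_apply, if_neg]
    have := (Finset.mem_filter.mp hd).2
    have : (j : ℕ) < i := hij
    omega
  · rw [Finset.sum_filter_add_sum_filter_not]
    exact hx

/-- Every upper triangular element is the sum of a diagonal one and a strictly upper triangular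
one. -/
theorem exists_diag_add_strictUpper {x : L} (hx : ∀ i j, j < i → ρ x i j = 0) : ∃ a b : L,
    (ρ a).IsDiag ∧ (∀ i j, j ≤ i → ρ b i j = 0) ∧ x = a + b := by
  obtain ⟨a, ha⟩ := T.exists_diagPart x 0
  refine ⟨a, x - a, ?_, ?_, by abel⟩
  · intro i j hij
    rw [ha, Matrix.of_apply, if_neg]
    intro h
    exact hij (Fin.ext (by omega))
  · intro i j hij
    rw [map_sub, Matrix.sub_apply, ha, Matrix.of_apply]
    rcases hij.lt_or_eq with h | h
    · rw [hx i j h]; simp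
    · subst h; simp

variable (M) in
/-- The sum of the eigenspaces of `h` with eigenvalue in `c - 2, c - 4, c - 6, …`. -/
def low (c : ℂ) : Submodule ℂ M :=
  ⨆ μ ∈ {μ : ℂ | ∃ d : ℕ, μ = c - 2 * (d + 1)},
    Module.End.eigenspace (LieModule.toEnd ℂ L M T.h) μ

theorem lie_mem_low_of_eigen {y : L} (hy : ∀ i j, i ≤ j → ρ y i j = 0) {c μ : ℂ}
    (hμ : ∃ d : ℕ, μ = c - 2 * d) {v : M} (hv : ⁅T.h, v⁆ = μ • v) : ⁅y, v⁆ ∈ T.low M c := by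
  obtain ⟨p, hp, hx⟩ := T.exists_sum_diagPart y
  obtain ⟨d, rfl⟩ := hμ
  rw [hx, sum_lie]
  refine Submodule.sum_mem _ fun e _ => ?_
  by_cases he : e < 0
  · have h1 : ∀ i j : Fin N, (j : ℤ) - i ≠ e → ρ (p e) i j = 0 := fun i j hij => by
      rw [hp, Matrix.of_apply, if_neg hij]
    have h2 := T.lie_h_lie_of_diag h1 hv
    refine Submodule.mem_iSup_of_mem _ (Submodule.mem_iSup_of_mem ?_
      (Module.End.mem_eigenspace_iff.mpr h2))
    refine ⟨d + ((-e).toNat - 1), ?_⟩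
    obtain ⟨m, hm⟩ : ∃ m : ℕ, e = -(m + 1 : ℤ) := ⟨(-e).toNat - 1, by omega⟩
    subst hm
    have : (-(-((m : ℤ) + 1))).toNat - 1 = m := by omega
    rw [this]
    push_cast
    ring
  · have : p e = 0 := by
      apply T.injective
      rw [hp, map_zero]
      ext i j
      rw [Matrix.of_apply, Matrix.zero_apply]
      split_ifs with h
      · refine hy i j (Fin.le_def.mpr ?_)
        omega
      · rfl
    rw [this, zero_lie]
    exact zero_mem _

theorem lie_mem_low {y : L} (hy : ∀ i j, i ≤ j → ρ y i j = 0) {c : ℂ} {v m : M}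
    (hv : ⁅T.h, v⁆ = c • v) (hm : m ∈ (ℂ ∙ v) ⊔ T.low M c) : ⁅y, m⁆ ∈ T.low M c := by
  have key : (ℂ ∙ v) ⊔ T.low M c ≤ (T.low M c).comap (LieModule.toEnd ℂ L M y) := by
    refine sup_le ?_ (iSup₂_le fun μ hμ w hw => ?_)
    · rw [Submodule.span_singleton_le_iff_mem]
      exact T.lie_mem_low_of_eigen hy ⟨0, by simp⟩ hv
    · obtain ⟨d, rfl⟩ := hμ
      exact T.lie_mem_low_of_eigen hy ⟨d + 1, by push_cast; ring⟩
        (Module.End.mem_eigenspace_iff.mp hw)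
  exact key hm

omit T in
variable (ρ) in
/-- The span of the vectors `y₁ ⋯ yᵢ v` with `i ≤ k` and `y₁, …, yᵢ` strictly lower triangular. -/
def lowerWords (v : M) : ℕ → Submodule ℂ M
  | 0 => ℂ ∙ v
  | k + 1 => lowerWords v k ⊔ Submodule.span ℂ {m | ∃ y : L, (∀ i j, i ≤ j → ρ y i j = 0) ∧
      ∃ s ∈ lowerWords v k, m = ⁅y, s⁆}

theorem lowerWords_le {c : ℂ} {v : M} (hv : ⁅T.h, v⁆ = c • v) (k : ℕ) :
    lowerWords ρ v k ≤ (ℂ ∙ v) ⊔ T.low M c := by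
  induction k with
  | zero => exact le_sup_left
  | succ k ih =>
    refine sup_le ih (Submodule.span_le.mpr ?_)
    rintro _ ⟨y, hy, s, hs, rfl⟩
    exact Submodule.mem_sup_right (T.lie_mem_low hy hv (ih hs))

/-- The upper triangular elements can be moved to the right through a word of strictly lower
triangular ones without lengthening it. -/
theorem lie_mem_lowerWords {lam : Fin n → ℤ} {v : M} (hv : v ∈ hwSpace ρ M lam) (k : ℕ) :
    ∀ x : L, (∀ i j, j < i → ρ x i j = 0) → ∀ s ∈ lowerWords ρ v k, ⁅x, s⁆ ∈ lowerWords ρ v k := by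
  induction k with
  | zero =>
    intro x hx s hs
    obtain ⟨c, rfl⟩ := Submodule.mem_span_singleton.mp hs
    obtain ⟨a, b, ha, hb, rfl⟩ := T.exists_diag_add_strictUpper hx
    rw [lie_smul, add_lie, hv.2 b hb, mem_weightSpace.mp hv.1 a ha, add_zero]
    exact Submodule.smul_mem _ _ (Submodule.smul_mem _ _ (Submodule.mem_span_singleton_self v))
  | succ k ih =>
    intro x hx s hs
    have key : lowerWords ρ v (k + 1) ≤
        (lowerWords ρ v (k + 1)).comap (LieModule.toEnd ℂ L M x) := by
      refine sup_le (fun (s : M) hs => Submodule.mem_sup_left (ih x hx s hs))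
        (Submodule.span_le.mpr ?_)
      rintro _ ⟨y, hy, s, hs, rfl⟩
      change ⁅x, ⁅y, s⁆⁆ ∈ lowerWords ρ v (k + 1)
      obtain ⟨a, b, ha, hb, hab⟩ := T.exists_lower_add_upper ⁅x, y⁆
      rw [leibniz_lie, hab, add_lie]
      refine add_mem (add_mem ?_ ?_) ?_
      · exact Submodule.mem_sup_right (Submodule.subset_span ⟨a, ha, s, hs, rfl⟩)
      · exact Submodule.mem_sup_left (ih b hb s hs)
      · exact Submodule.mem_sup_right (Submodule.subset_span ⟨y, hy, _, ih x hx s hs, rfl⟩)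
    exact key hs

/-- The submodule generated by a highest weight vector `v` is the sum of `ℂ v` and of eigenspaces
of `h` of strictly lower eigenvalues. -/
theorem lieSpan_le_sup_low {lam : Fin n → ℤ} {v : M} (hv : v ∈ hwSpace ρ M lam) :
    (LieSubmodule.lieSpan ℂ L {v} : Submodule ℂ M) ≤
      (ℂ ∙ v) ⊔ T.low M (weightEval lam (ρ T.h)) := by
  have mono : Monotone (lowerWords ρ v) := monotone_nat_of_le_succ fun k => le_sup_left
  let S : LieSubmodule ℂ L M :=
    { (⨆ k, lowerWords ρ v k : Submodule ℂ M) with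
      lie_mem := by
        intro x m hm
        obtain ⟨k, hk⟩ := (Submodule.mem_iSup_of_directed _ mono.directed_le).mp hm
        obtain ⟨a, b, ha, hb, rfl⟩ := T.exists_lower_add_upper x
        rw [add_lie]
        refine (Submodule.mem_iSup_of_directed _ mono.directed_le).mpr ⟨k + 1, add_mem ?_ ?_⟩
        · exact Submodule.mem_sup_right (Submodule.subset_span ⟨a, ha, m, hk, rfl⟩)
        · exact Submodule.mem_sup_left (T.lie_mem_lowerWords hv k b hb m hk) }
  have h1 : LieSubmodule.lieSpan ℂ L {v} ≤ S := by
    rw [LieSubmodule.lieSpan_le, Set.singleton_subset_iff]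
    exact Submodule.mem_iSup_of_mem 0 (Submodule.mem_span_singleton_self v)
  intro m hm
  obtain ⟨k, hk⟩ := (Submodule.mem_iSup_of_directed _ mono.directed_le).mp (h1 hm)
  exact T.lowerWords_le (mem_weightSpace.mp hv.1 _ T.isDiag_h) k hk

end TriangularData

/-- A vector in the sum of the eigenspaces for the eigenvalues in `s` is killed by a polynomial
in the endomorphism that does not vanish at a given `μ ∉ s`. -/
theorem exists_aeval_eq_zero {V : Type} [AddCommGroup V] [Module ℂ V] (f : Module.End ℂ V)
    {s : Set ℂ} {μ : ℂ} (hμ : μ ∉ s) {v : V} (hv : v ∈ ⨆ c ∈ s, Module.End.eigenspace f c) :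
    ∃ p : Polynomial ℂ, Polynomial.aeval f p v = 0 ∧ p.eval μ ≠ 0 := by
  rw [iSup_subtype'] at hv
  refine Submodule.iSup_induction _ (motive := fun v => ∃ p : Polynomial ℂ,
    Polynomial.aeval f p v = 0 ∧ p.eval μ ≠ 0) hv ?_ ⟨1, by simp⟩ ?_
  · rintro ⟨c, hc⟩ w hw
    refine ⟨Polynomial.X - Polynomial.C c, ?_, ?_⟩
    · simpa [sub_eq_zero, Module.End.mem_eigenspace_iff, Algebra.algebraMap_eq_smul_one] using hw
    · simp only [Polynomial.eval_sub, Polynomial.eval_X, Polynomial.eval_C]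
      exact sub_ne_zero.mpr fun h => hμ (h ▸ hc)
  · rintro x y ⟨p, hp, hp'⟩ ⟨q, hq, hq'⟩
    refine ⟨p * q, ?_, by simp [hp', hq']⟩
    have h1 : Polynomial.aeval f (p * q) x = 0 := by
      rw [mul_comm, map_mul, Module.End.mul_apply, hp, map_zero]
    rw [map_add, h1, map_mul, Module.End.mul_apply, hq, map_zero, add_zero]

theorem aeval_apply_of_eigen {V : Type} [AddCommGroup V] [Module ℂ V] (f : Module.End ℂ V)
    {c : ℂ} {v : V} (hv : f v = c • v) (p : Polynomial ℂ) :
    Polynomial.aeval f p v = p.eval c • v := by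
  induction p using Polynomial.induction_on' with
  | add p q hp hq => simp [hp, hq, add_smul]
  | monomial k a =>
    have : (f ^ k) v = c ^ k • v := by
      induction k with
      | zero => simp
      | succ k ih => rw [pow_succ', Module.End.mul_apply, ih, map_smul, hv, smul_smul, pow_succ]
    rw [Polynomial.aeval_monomial, Module.End.mul_apply, this, Polynomial.eval_monomial, mul_smul]
    simp [Algebra.algebraMap_eq_smul_one, smul_comm a]

theorem aeval_mem {V : Type} [AddCommGroup V] [Module ℂ V] (f : Module.End ℂ V)
    {A : Submodule ℂ V} (hA : ∀ v ∈ A, f v ∈ A) (p : Polynomial ℂ) {v : V} (hv : v ∈ A) :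
    Polynomial.aeval f p v ∈ A := by
  induction p using Polynomial.induction_on' with
  | add p q hp hq => rw [map_add]; exact add_mem hp hq
  | monomial k a =>
    have : (f ^ k) v ∈ A := by
      induction k with
      | zero => simpa using hv
      | succ k ih => rw [pow_succ', Module.End.mul_apply]; exact hA _ ih
    rw [Polynomial.aeval_monomial, Module.End.mul_apply]
    simpa [Algebra.algebraMap_eq_smul_one] using A.smul_mem a this

/-- An eigenvalue of an eigenvector in a sum of eigenspaces is one of theirs. -/
theorem eigenvalue_mem {V : Type} [AddCommGroup V] [Module ℂ V] (f : Module.End ℂ V)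
    {s : Set ℂ} {μ : ℂ} {v : V} (hv : v ∈ ⨆ c ∈ s, Module.End.eigenspace f c) (h0 : v ≠ 0)
    (hf : f v = μ • v) : μ ∈ s := by
  by_contra hμ
  obtain ⟨p, hp, hp'⟩ := exists_aeval_eq_zero f hμ hv
  rw [aeval_apply_of_eigen f hf] at hp
  exact (smul_ne_zero hp' h0) hp

end HighestWeight

/-! ### Irreducible highest weight modules -/

section LeftQuotient

variable {L : Type} [LieRing L] [LieAlgebra ℂ L]

/-- The cyclic `L`-module `U(L) / I` defined by a left ideal `I` of `U(L)`. -/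
def LeftQuotient (I : Submodule (UniversalEnvelopingAlgebra ℂ L)
    (UniversalEnvelopingAlgebra ℂ L)) : Type :=
  UniversalEnvelopingAlgebra ℂ L ⧸ I

variable (I : Submodule (UniversalEnvelopingAlgebra ℂ L) (UniversalEnvelopingAlgebra ℂ L))

instance : AddCommGroup (LeftQuotient I) :=
  inferInstanceAs (AddCommGroup (UniversalEnvelopingAlgebra ℂ L ⧸ I))

instance : Module (UniversalEnvelopingAlgebra ℂ L) (LeftQuotient I) :=
  inferInstanceAs (Module (UniversalEnvelopingAlgebra ℂ L) (UniversalEnvelopingAlgebra ℂ L ⧸ I))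

instance : Module ℂ (LeftQuotient I) :=
  inferInstanceAs (Module ℂ (UniversalEnvelopingAlgebra ℂ L ⧸ I))

instance : IsScalarTower ℂ (UniversalEnvelopingAlgebra ℂ L) (LeftQuotient I) :=
  inferInstanceAs (IsScalarTower ℂ (UniversalEnvelopingAlgebra ℂ L)
    (UniversalEnvelopingAlgebra ℂ L ⧸ I))

instance : LieRingModule L (LeftQuotient I) where
  bracket x v := UniversalEnvelopingAlgebra.ι ℂ x • v
  add_lie x y v := by
    rw [map_add, add_smul]
  lie_add x v w := smul_add (UniversalEnvelopingAlgebra.ι ℂ x) v w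
  leibniz_lie x y v := by
    change UniversalEnvelopingAlgebra.ι ℂ x • UniversalEnvelopingAlgebra.ι ℂ y • v =
      UniversalEnvelopingAlgebra.ι ℂ ⁅x, y⁆ • v +
        UniversalEnvelopingAlgebra.ι ℂ y • UniversalEnvelopingAlgebra.ι ℂ x • v
    rw [LieHom.map_lie, LieRing.of_associative_ring_bracket, sub_smul, mul_smul, mul_smul,
      sub_add_cancel]

theorem lie_leftQuotient (x : L) (v : LeftQuotient I) :
    ⁅x, v⁆ = UniversalEnvelopingAlgebra.ι ℂ x • v := rfl

instance : LieModule ℂ L (LeftQuotient I) where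
  smul_lie c x v := by
    rw [lie_leftQuotient, lie_leftQuotient, map_smul, smul_assoc]
  lie_smul c x v := by
    rw [lie_leftQuotient, lie_leftQuotient]
    rw [← algebraMap_smul (UniversalEnvelopingAlgebra ℂ L) c v,
      ← algebraMap_smul (UniversalEnvelopingAlgebra ℂ L) c (_ • v), ← mul_smul, ← mul_smul,
      Algebra.commutes]

/-- The projection `U(L) → U(L) / I`. -/
def leftMk : UniversalEnvelopingAlgebra ℂ L →ₗ[UniversalEnvelopingAlgebra ℂ L] LeftQuotient I :=
  Submodule.mkQ I

theorem leftMk_eq_zero {u : UniversalEnvelopingAlgebra ℂ L} : leftMk I u = 0 ↔ u ∈ I :=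
  Submodule.Quotient.mk_eq_zero I

theorem leftMk_surjective : Function.Surjective (leftMk I) := Submodule.mkQ_surjective I

/-- An additive subgroup of `U(L)` containing `1` and stable under scalars and under left
multiplication by `L` is everything. -/
theorem universalEnveloping_induction {p : UniversalEnvelopingAlgebra ℂ L → Prop} (h1 : p 1)
    (hadd : ∀ a b, p a → p b → p (a + b)) (hsmul : ∀ (c : ℂ) a, p a → p (c • a))
    (hι : ∀ x a, p a → p (UniversalEnvelopingAlgebra.ι ℂ x * a))
    (u : UniversalEnvelopingAlgebra ℂ L) : p u := by
  have h0 : p 0 := by simpa using hsmul 0 1 h1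
  suffices h : ∀ a, p a → p (u * a) by simpa using h 1 h1
  have hs : Function.Surjective (UniversalEnvelopingAlgebra.mkAlgHom ℂ L) :=
    Quotient.mk_surjective
  obtain ⟨w, rfl⟩ := hs u
  induction w using TensorAlgebra.induction with
  | algebraMap r => intro a ha; simpa [Algebra.smul_def] using hsmul r a ha
  | ι x => exact fun a ha => hι x a ha
  | mul w w' hw hw' =>
    intro a ha
    rw [map_mul, mul_assoc]
    exact hw _ (hw' _ ha)
  | add w w' hw hw' =>
    intro a ha
    rw [map_add, add_mul]
    exact hadd _ _ (hw _ ha) (hw' _ ha)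

theorem lieSpan_leftMk_one : LieSubmodule.lieSpan ℂ L {leftMk I 1} = ⊤ := by
  rw [eq_top_iff]
  intro v _
  obtain ⟨u, rfl⟩ := leftMk_surjective I v
  refine universalEnveloping_induction
    (p := fun u => leftMk I u ∈ LieSubmodule.lieSpan ℂ L {leftMk I 1}) ?_ ?_ ?_ ?_ u
  · exact LieSubmodule.subset_lieSpan (Set.mem_singleton _)
  · intro a b ha hb
    rw [map_add]; exact add_mem ha hb
  · intro c a ha
    rw [← algebraMap_smul (UniversalEnvelopingAlgebra ℂ L) c a, map_smul, algebraMap_smul]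
    exact SMulMemClass.smul_mem c ha
  · intro x a ha
    rw [← smul_eq_mul, map_smul, ← lie_leftQuotient]
    exact LieSubmodule.lie_mem _ ha

/-- The submodule of `U(L) / I` given by a left ideal. -/
def leftIdealMap (J : Submodule (UniversalEnvelopingAlgebra ℂ L)
    (UniversalEnvelopingAlgebra ℂ L)) : LieSubmodule ℂ L (LeftQuotient I) where
  __ := (J.map (leftMk I)).restrictScalars ℂ
  lie_mem := by
    intro x m hm
    exact (J.map (leftMk I)).smul_mem (UniversalEnvelopingAlgebra.ι ℂ x) hm

theorem mem_leftIdealMap {J : Submodule (UniversalEnvelopingAlgebra ℂ L)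
    (UniversalEnvelopingAlgebra ℂ L)} (hJ : I ≤ J) {u : UniversalEnvelopingAlgebra ℂ L} :
    leftMk I u ∈ leftIdealMap I J ↔ u ∈ J := by
  constructor
  · rintro ⟨w, hw, hwu⟩
    have h1 : u - w ∈ I := by
      rw [← leftMk_eq_zero, map_sub, hwu, sub_self]
    simpa using J.add_mem (hJ h1) hw
  · intro h
    exact ⟨u, h, rfl⟩

end LeftQuotient

section Irreducible

variable {N n : ℕ} {L : Type} [LieRing L] [LieAlgebra ℂ L]
variable {ρ : L →ₗ⁅ℂ⁆ Matrix (Fin N) (Fin N) ℂ}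
variable {M : Type} [AddCommGroup M] [Module ℂ M] [LieRingModule L M] [LieModule ℂ L M]

theorem leftMk_one_mem_hwSpace {lam : Fin n → ℤ}
    {I : Submodule (UniversalEnvelopingAlgebra ℂ L) (UniversalEnvelopingAlgebra ℂ L)}
    (hI : vermaIdeal ρ lam ≤ I) : leftMk I 1 ∈ hwSpace ρ (LeftQuotient I) lam := by
  refine ⟨mem_weightSpace.mpr fun x hx => ?_, fun x hx => ?_⟩
  · rw [lie_leftQuotient, ← map_smul, smul_eq_mul, mul_one,
      ← algebraMap_smul (UniversalEnvelopingAlgebra ℂ L), ← map_smul, ← sub_eq_zero, ← map_sub,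
      smul_eq_mul, mul_one, leftMk_eq_zero]
    exact hI (Submodule.subset_span (Or.inr ⟨x, hx, rfl⟩))
  · rw [lie_leftQuotient, ← map_smul, smul_eq_mul, mul_one, leftMk_eq_zero]
    exact hI (Submodule.subset_span (Or.inl ⟨x, hx, rfl⟩))

variable (M) in
/-- The action of `U(L)` on an `L`-module. -/
def envelopingAction : UniversalEnvelopingAlgebra ℂ L →ₐ[ℂ] Module.End ℂ M :=
  UniversalEnvelopingAlgebra.lift ℂ (LieModule.toEnd ℂ L M)

theorem envelopingAction_ι (x : L) (m : M) :
    envelopingAction M (UniversalEnvelopingAlgebra.ι ℂ x) m = ⁅x, m⁆ := by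
  rw [envelopingAction, UniversalEnvelopingAlgebra.lift_ι_apply]; rfl

variable (L) in
/-- The left ideal of the elements of `U(L)` that kill a vector. -/
def annihilatorIdeal (v : M) :
    Submodule (UniversalEnvelopingAlgebra ℂ L) (UniversalEnvelopingAlgebra ℂ L) where
  carrier := {u | envelopingAction M u v = 0}
  add_mem' {a b} ha hb := by
    change envelopingAction M (a + b) v = 0
    rw [map_add, LinearMap.add_apply, show envelopingAction M a v = 0 from ha,
      show envelopingAction M b v = 0 from hb, add_zero]
  zero_mem' := by
    change envelopingAction M 0 v = 0
    simp
  smul_mem' c a ha := by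
    change envelopingAction M (c * a) v = 0
    rw [map_mul, Module.End.mul_apply, show envelopingAction M a v = 0 from ha, map_zero]

theorem mem_annihilatorIdeal {v : M} {u : UniversalEnvelopingAlgebra ℂ L} :
    u ∈ annihilatorIdeal L v ↔ envelopingAction M u v = 0 := Iff.rfl

theorem vermaIdeal_le_annihilatorIdeal {lam : Fin n → ℤ} {v : M} (hv : v ∈ hwSpace ρ M lam) :
    vermaIdeal ρ lam ≤ annihilatorIdeal L v := by
  refine Submodule.span_le.mpr ?_
  rintro u (⟨x, hx, rfl⟩ | ⟨x, hx, rfl⟩)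
  · change envelopingAction M _ v = 0
    rw [envelopingAction_ι, hv.2 x hx]
  · change envelopingAction M _ v = 0
    rw [map_sub, LinearMap.sub_apply, envelopingAction_ι, mem_weightSpace.mp hv.1 x hx,
      AlgHom.commutes, Module.algebraMap_end_apply, sub_self]

theorem annihilatorIdeal_ne_top {v : M} (hv : v ≠ 0) : annihilatorIdeal L v ≠ ⊤ := by
  intro h
  have : (1 : UniversalEnvelopingAlgebra ℂ L) ∈ annihilatorIdeal L v := h ▸ Submodule.mem_top
  rw [mem_annihilatorIdeal, map_one] at this
  exact hv this

theorem vermaIdeal_ne_top {lam : Fin n → ℤ} {v : M} (hv : v ∈ hwSpace ρ M lam) (h0 : v ≠ 0) :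
    vermaIdeal ρ lam ≠ ⊤ := fun h =>
  annihilatorIdeal_ne_top (L := L) h0 (top_le_iff.mp (h ▸ vermaIdeal_le_annihilatorIdeal hv))

/-- When the Verma module does not vanish, the Verma ideal is one of the left ideals whose sum is
`maxIdeal`. Otherwise `maxIdeal` is a sum of no ideals, hence zero. -/
theorem vermaIdeal_le_maxIdeal {lam : Fin n → ℤ} (h : vermaIdeal ρ lam ≠ ⊤) :
    vermaIdeal ρ lam ≤ maxIdeal ρ lam :=
  le_sSup ⟨le_rfl, h⟩

theorem TriangularData.weightEval_h_notMem (T : TriangularData ρ n) (lam : Fin n → ℤ) :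
    weightEval lam (ρ T.h) ∉ {μ : ℂ | ∃ d : ℕ, μ = weightEval lam (ρ T.h) - 2 * (d + 1)} := by
  rintro ⟨d, hd⟩
  have h1 : (2 : ℂ) * (d + 1) = 0 := by linear_combination hd
  have h2 : (d : ℂ) + 1 ≠ 0 := by exact_mod_cast Nat.succ_ne_zero d
  simp [h2] at h1

/-- A proper submodule of a module generated by a highest weight vector lies in the lower
eigenspaces of `h`. -/
theorem TriangularData.le_low_of_notMem (T : TriangularData ρ n) {lam : Fin n → ℤ} {v : M}
    (hv : v ∈ hwSpace ρ M lam) (hgen : LieSubmodule.lieSpan ℂ L {v} = ⊤)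
    {A : LieSubmodule ℂ L M} (hA : v ∉ A) :
    (A : Submodule ℂ M) ≤ T.low M (weightEval lam (ρ T.h)) := by
  intro m hm
  have h1 : m ∈ (ℂ ∙ v) ⊔ T.low M (weightEval lam (ρ T.h)) :=
    T.lieSpan_le_sup_low hv (hgen ▸ LieSubmodule.mem_top m)
  obtain ⟨w, hw, l, hl, rfl⟩ := Submodule.mem_sup.mp h1
  obtain ⟨c, rfl⟩ := Submodule.mem_span_singleton.mp hw
  -- A polynomial in `h` that kills `l` but not `v` shows that `v` is in `A` when `c ≠ 0`.
  obtain ⟨p, hp, hp'⟩ := exists_aeval_eq_zero _ (T.weightEval_h_notMem lam) hl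
  have h2 := aeval_mem (LieModule.toEnd ℂ L M T.h) (A := (A : Submodule ℂ M))
    (fun v hv => A.lie_mem hv) p hm
  rw [map_add, hp, add_zero, map_smul, aeval_apply_of_eigen (c := weightEval lam (ρ T.h)) _
    (mem_weightSpace.mp hv.1 _ T.isDiag_h)] at h2
  by_cases hc : c = 0
  · simpa [hc] using hl
  · refine absurd ?_ hA
    have h3 := A.smul_mem (c * p.eval (weightEval lam (ρ T.h)))⁻¹ h2
    rwa [smul_smul c, smul_smul, inv_mul_cancel₀ (mul_ne_zero hc hp'), one_smul] at h3

/-- The largest proper left ideal containing the Verma ideal is the annihilator of a highest weight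
vector in any irreducible module. -/
theorem TriangularData.maxIdeal_eq (T : TriangularData ρ n) [LieModule.IsIrreducible ℂ L M]
    {lam : Fin n → ℤ} {v : M} (hv : v ∈ hwSpace ρ M lam) (h0 : v ≠ 0) :
    maxIdeal ρ lam = annihilatorIdeal L v := by
  have hK := vermaIdeal_le_annihilatorIdeal hv
  refine le_antisymm (sSup_le ?_) (le_sSup ⟨hK, annihilatorIdeal_ne_top h0⟩)
  rintro I ⟨hI, hI'⟩
  by_contra hIK
  -- An element of `I` that does not kill `v` can be multiplied into `1 + K`.
  obtain ⟨i, hi, hiK⟩ := SetLike.not_le_iff_exists.mp hIK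
  set K := annihilatorIdeal L v
  have hs : I ⊔ K = ⊤ := by
    rw [Submodule.eq_top_iff']
    let S : LieSubmodule ℂ L M :=
      { carrier := {m | ∃ u ∈ I, envelopingAction M u v = m}
        add_mem' := by
          rintro _ _ ⟨a, ha, rfl⟩ ⟨b, hb, rfl⟩
          exact ⟨a + b, add_mem ha hb, by rw [map_add, LinearMap.add_apply]⟩
        zero_mem' := ⟨0, zero_mem _, by simp⟩
        smul_mem' := by
          rintro c _ ⟨a, ha, rfl⟩
          refine ⟨c • a, ?_, by rw [map_smul, LinearMap.smul_apply]⟩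
          rw [← algebraMap_smul (UniversalEnvelopingAlgebra ℂ L) c a]
          exact I.smul_mem _ ha
        lie_mem := by
          rintro x _ ⟨a, ha, rfl⟩
          exact ⟨UniversalEnvelopingAlgebra.ι ℂ x * a, I.smul_mem _ ha, by
            rw [map_mul, Module.End.mul_apply, envelopingAction_ι]⟩ }
    have hS : S = ⊤ := (eq_bot_or_eq_top S).resolve_left fun h => hiK (by
      have : envelopingAction M i v ∈ S := ⟨i, hi, rfl⟩
      rw [h, LieSubmodule.mem_bot] at this
      exact this)
    intro u
    obtain ⟨a, ha, hau⟩ : envelopingAction M u v ∈ S := hS ▸ LieSubmodule.mem_top _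
    rw [show u = a + (u - a) by abel]
    refine Submodule.add_mem_sup ha ?_
    rw [mem_annihilatorIdeal, map_sub, LinearMap.sub_apply, hau, sub_self]
  have hV := leftMk_one_mem_hwSpace (ρ := ρ) (lam := lam) le_rfl
  have hgen := lieSpan_leftMk_one (vermaIdeal ρ lam)
  -- Both proper ideals map to the lower eigenspaces of the Verma module, yet their sum contains
  -- `1`.
  have key : ∀ J, vermaIdeal ρ lam ≤ J → J ≠ ⊤ → ∀ u ∈ J, leftMk (vermaIdeal ρ lam) u ∈
      T.low (LeftQuotient (vermaIdeal ρ lam)) (weightEval lam (ρ T.h)) := by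
    intro J hJ hJ' u hu
    refine T.le_low_of_notMem hV hgen (A := leftIdealMap _ J) ?_
      ((mem_leftIdealMap _ hJ).mpr hu)
    rw [mem_leftIdealMap _ hJ]
    intro h
    exact hJ' ((Ideal.eq_top_iff_one J).mpr h)
  obtain ⟨a, ha, b, hb, hab⟩ := Submodule.mem_sup.mp
    (hs ▸ Submodule.mem_top : (1 : UniversalEnvelopingAlgebra ℂ L) ∈ I ⊔ K)
  have h1 := add_mem (key I hI hI' a ha) (key K hK (annihilatorIdeal_ne_top h0) b hb)
  rw [← map_add, hab] at h1
  refine T.weightEval_h_notMem lam (eigenvalue_mem _ h1 ?_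
    (mem_weightSpace.mp hV.1 _ T.isDiag_h))
  rw [Ne, leftMk_eq_zero]
  exact fun h => annihilatorIdeal_ne_top (L := L) h0 ((Ideal.eq_top_iff_one _).mpr (hK h))

/-- The generator of the irreducible highest weight module. -/
def irrepOne (ρ : L →ₗ⁅ℂ⁆ Matrix (Fin N) (Fin N) ℂ) (lam : Fin n → ℤ) : Irrep ρ lam :=
  leftMk (maxIdeal ρ lam) 1

/-- An irreducible module with a highest weight vector of weight `λ` is isomorphic to
`Irrep ρ λ`. -/
theorem TriangularData.exists_irrep_equiv (T : TriangularData ρ n)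
    [LieModule.IsIrreducible ℂ L M] {lam : Fin n → ℤ} {v : M} (hv : v ∈ hwSpace ρ M lam)
    (h0 : v ≠ 0) : ∃ e : Irrep ρ lam ≃ₗ⁅ℂ, L⁆ M, e (irrepOne ρ lam) = v := by
  letI : Module (UniversalEnvelopingAlgebra ℂ L) M :=
    Module.compHom M (envelopingAction (L := L) M).toRingHom
  have hsm : ∀ (u : UniversalEnvelopingAlgebra ℂ L) (m : M), u • m = envelopingAction M u m :=
    fun _ _ => rfl
  let f : UniversalEnvelopingAlgebra ℂ L →ₗ[UniversalEnvelopingAlgebra ℂ L] M :=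
    LinearMap.toSpanSingleton _ M v
  have hker : maxIdeal ρ lam = LinearMap.ker f := by
    rw [T.maxIdeal_eq hv h0]
    ext u
    rfl
  have hf : Function.Surjective f := by
    let S : LieSubmodule ℂ L M :=
      { carrier := Set.range f
        add_mem' := by
          rintro _ _ ⟨a, rfl⟩ ⟨b, rfl⟩
          exact ⟨a + b, map_add f a b⟩
        zero_mem' := ⟨0, map_zero f⟩
        smul_mem' := by
          rintro c _ ⟨a, rfl⟩
          refine ⟨algebraMap ℂ _ c * a, ?_⟩
          rw [← smul_eq_mul, map_smul, hsm, AlgHom.commutes, Module.algebraMap_end_apply]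
        lie_mem := by
          rintro x _ ⟨a, rfl⟩
          refine ⟨UniversalEnvelopingAlgebra.ι ℂ x * a, ?_⟩
          rw [← smul_eq_mul, map_smul, hsm, envelopingAction_ι] }
    have hS : S = ⊤ := (eq_bot_or_eq_top S).resolve_left fun h => h0 (by
      have : v ∈ S := ⟨1, by simp [f]⟩
      rwa [h, LieSubmodule.mem_bot] at this)
    intro m
    have : m ∈ S := hS ▸ LieSubmodule.mem_top m
    exact this
  let e : Irrep ρ lam ≃ₗ[UniversalEnvelopingAlgebra ℂ L] M :=
    (Submodule.quotEquivOfEq _ _ hker).trans (f.quotKerEquivOfSurjective hf)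
  refine ⟨{
    toFun := e
    invFun := e.symm
    left_inv := e.left_inv
    right_inv := e.right_inv
    map_add' := e.map_add
    map_smul' := fun c m => by
      rw [RingHom.id_apply, ← algebraMap_smul (UniversalEnvelopingAlgebra ℂ L) c m, map_smul, hsm,
        AlgHom.commutes, Module.algebraMap_end_apply]
    map_lie' := fun {x m} => by
      change e (UniversalEnvelopingAlgebra.ι ℂ x • m) = _
      rw [map_smul, hsm, envelopingAction_ι] }, ?_⟩
  change (1 : UniversalEnvelopingAlgebra ℂ L) • v = v
  rw [one_smul]

/-- In an irreducible module, the highest weight vectors are unique up to a scalar. -/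
theorem TriangularData.mem_span_of_mem_hwSpace (T : TriangularData ρ n)
    [LieModule.IsIrreducible ℂ L M] {lam mu : Fin n → ℤ} {v w : M} (hv : v ∈ hwSpace ρ M lam)
    (hv0 : v ≠ 0) (hw : w ∈ hwSpace ρ M mu) (hw0 : w ≠ 0) : w ∈ ℂ ∙ v := by
  have hgen : ∀ u : M, u ≠ 0 → LieSubmodule.lieSpan ℂ L {u} = ⊤ := fun u hu =>
    (eq_bot_or_eq_top _).resolve_left fun h => hu
      ((LieSubmodule.lieSpan_eq_bot_iff ℂ L M).mp h u rfl)
  -- Each of the two `h`-eigenvalues is at most the other one.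
  have key : ∀ {lam mu : Fin n → ℤ} {v w : M}, v ∈ hwSpace ρ M lam → v ≠ 0 →
      w ∈ hwSpace ρ M mu → w ≠ 0 →
      ∃ d : ℕ, weightEval mu (ρ T.h) = weightEval lam (ρ T.h) - 2 * d := by
    intro lam mu v w hv hv0 hw hw0
    have h1 : w ∈ (ℂ ∙ v) ⊔ T.low M (weightEval lam (ρ T.h)) :=
      T.lieSpan_le_sup_low hv (hgen v hv0 ▸ LieSubmodule.mem_top w)
    have h2 : (ℂ ∙ v) ⊔ T.low M (weightEval lam (ρ T.h)) ≤
        ⨆ μ ∈ {μ : ℂ | ∃ d : ℕ, μ = weightEval lam (ρ T.h) - 2 * d},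
          Module.End.eigenspace (LieModule.toEnd ℂ L M T.h) μ := by
      refine sup_le ?_ (iSup₂_le ?_)
      · rw [Submodule.span_singleton_le_iff_mem]
        exact Submodule.mem_iSup_of_mem _ (Submodule.mem_iSup_of_mem ⟨0, by simp⟩
          (Module.End.mem_eigenspace_iff.mpr (mem_weightSpace.mp hv.1 _ T.isDiag_h)))
      · rintro _ ⟨d, rfl⟩
        exact le_iSup₂_of_le _ ⟨d + 1, by push_cast; rfl⟩ le_rfl
    exact eigenvalue_mem _ (h2 h1) hw0 (mem_weightSpace.mp hw.1 _ T.isDiag_h)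
  obtain ⟨d, hd⟩ := key hv hv0 hw hw0
  obtain ⟨e, he⟩ := key hw hw0 hv hv0
  have hde : d = 0 := by
    have h1 : ((d + e : ℕ) : ℂ) = 0 := by push_cast; linear_combination (hd + he) / 2
    have : d + e = 0 := by exact_mod_cast h1
    omega
  rw [hde] at hd
  -- The component of `w` in the lower eigenspaces has the same eigenvalue as `v`, so it vanishes.
  have h1 : w ∈ (ℂ ∙ v) ⊔ T.low M (weightEval lam (ρ T.h)) :=
    T.lieSpan_le_sup_low hv (hgen v hv0 ▸ LieSubmodule.mem_top w)
  obtain ⟨u, hu, l, hl, huw⟩ := Submodule.mem_sup.mp h1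
  obtain ⟨c, rfl⟩ := Submodule.mem_span_singleton.mp hu
  by_cases hl0 : l = 0
  · exact Submodule.mem_span_singleton.mpr ⟨c, by rw [← huw, hl0, add_zero]⟩
  · refine absurd (eigenvalue_mem _ hl hl0 (μ := weightEval lam (ρ T.h)) ?_)
      (T.weightEval_h_notMem lam)
    have h2 : l = w - c • v := by rw [← huw]; abel
    have h3 : ⁅T.h, w⁆ = weightEval lam (ρ T.h) • w := by
      rw [mem_weightSpace.mp hw.1 _ T.isDiag_h, hd]; simp
    change ⁅T.h, l⁆ = _
    rw [h2, lie_sub, h3, lie_smul, mem_weightSpace.mp hv.1 _ T.isDiag_h, smul_sub, smul_comm c]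

theorem TriangularData.eq_of_mem_hwSpace (T : TriangularData ρ n)
    [LieModule.IsIrreducible ℂ L M] {lam mu : Fin n → ℤ} {v w : M} (hv : v ∈ hwSpace ρ M lam)
    (hv0 : v ≠ 0) (hw : w ∈ hwSpace ρ M mu) (hw0 : w ≠ 0) : mu = lam := by
  obtain ⟨c, rfl⟩ := Submodule.mem_span_singleton.mp (T.mem_span_of_mem_hwSpace hv hv0 hw hw0)
  apply T.weightEval_t_injective
  have h1 := mem_weightSpace.mp hw.1 _ T.isDiag_t
  rw [lie_smul, mem_weightSpace.mp hv.1 _ T.isDiag_t, smul_comm] at h1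
  exact (smul_left_injective ℂ hw0 h1).symm

theorem TriangularData.finrank_hwSpace (T : TriangularData ρ n)
    [LieModule.IsIrreducible ℂ L M] {lam : Fin n → ℤ} {v : M} (hv : v ∈ hwSpace ρ M lam)
    (hv0 : v ≠ 0) (mu : Fin n → ℤ) :
    Module.finrank ℂ (hwSpace ρ M mu) = if mu = lam then 1 else 0 := by
  split_ifs with h
  · subst h
    have : hwSpace ρ M mu = ℂ ∙ v := by
      refine le_antisymm (fun w hw => ?_) ?_
      · by_cases hw0 : w = 0
        · rw [hw0]; exact zero_mem _
        · exact T.mem_span_of_mem_hwSpace hv hv0 hw hw0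
      · rwa [Submodule.span_singleton_le_iff_mem]
    rw [this, finrank_span_singleton hv0]
  · have : hwSpace ρ M mu = ⊥ := by
      rw [eq_bot_iff]
      intro w hw
      by_contra hw0
      exact h (T.eq_of_mem_hwSpace hv hv0 hw hw0)
    rw [this, finrank_bot]

theorem irrepOne_mem_hwSpace {lam : Fin n → ℤ} (h : vermaIdeal ρ lam ≠ ⊤) :
    irrepOne ρ lam ∈ hwSpace ρ (Irrep ρ lam) lam :=
  leftMk_one_mem_hwSpace (vermaIdeal_le_maxIdeal h)

theorem lieSpan_irrepOne (lam : Fin n → ℤ) :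
    LieSubmodule.lieSpan ℂ L {irrepOne ρ lam} = ⊤ :=
  lieSpan_leftMk_one (maxIdeal ρ lam)

theorem irrepHom_ext {lam : Fin n → ℤ} {f g : Irrep ρ lam →ₗ⁅ℂ, L⁆ M}
    (h : f (irrepOne ρ lam) = g (irrepOne ρ lam)) : f = g := by
  ext m
  have hm : m ∈ LieSubmodule.lieSpan ℂ L {irrepOne ρ lam} := by
    rw [lieSpan_irrepOne]; exact LieSubmodule.mem_top m
  induction hm using LieSubmodule.lieSpan_induction with
  | mem x hx => rw [Set.mem_singleton_iff.mp hx, h]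
  | zero => rw [map_zero, map_zero]
  | add x y _ _ hx hy => rw [map_add, map_add, hx, hy]
  | smul a x _ hx => rw [map_smul, map_smul, hx]
  | lie x y _ hy => rw [LieModuleHom.map_lie, LieModuleHom.map_lie, hy]

theorem map_mem_hwSpace {M' : Type} [AddCommGroup M'] [Module ℂ M'] [LieRingModule L M']
    [LieModule ℂ L M'] (f : M →ₗ⁅ℂ, L⁆ M') {lam : Fin n → ℤ} {v : M}
    (hv : v ∈ hwSpace ρ M lam) : f v ∈ hwSpace ρ M' lam :=
  ⟨mem_weightSpace.mpr fun x hx => by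
    rw [← LieModuleHom.map_lie, mem_weightSpace.mp hv.1 x hx, map_smul], fun x hx => by
    rw [← LieModuleHom.map_lie, hv.2 x hx, map_zero]⟩

variable (M) in
/-- Evaluation at the generator identifies the homomorphisms from `Irrep ρ λ` with highest weight
vectors. -/
def evalIrrepOne {lam : Fin n → ℤ} (h : vermaIdeal ρ lam ≠ ⊤) :
    (Irrep ρ lam →ₗ⁅ℂ, L⁆ M) →ₗ[ℂ] hwSpace ρ M lam where
  toFun f := ⟨f (irrepOne ρ lam), map_mem_hwSpace f (irrepOne_mem_hwSpace h)⟩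
  map_add' _ _ := rfl
  map_smul' _ _ := rfl

theorem evalIrrepOne_injective {lam : Fin n → ℤ} (h : vermaIdeal ρ lam ≠ ⊤) :
    Function.Injective (evalIrrepOne (M := M) h) := fun _ _ hfg =>
  irrepHom_ext (congrArg Subtype.val hfg)

end Irreducible

/-! ### Unitarizable modules -/

section Unitarizable

variable {N n : ℕ} {L : Type} [LieRing L] [LieAlgebra ℂ L]
variable {ρ : L →ₗ⁅ℂ⁆ Matrix (Fin N) (Fin N) ℂ}
variable {M : Type} [AddCommGroup M] [Module ℂ M] [LieRingModule L M] [LieModule ℂ L M]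
variable {M' : Type} [AddCommGroup M'] [Module ℂ M'] [LieRingModule L M'] [LieModule ℂ L M']

open scoped ComplexConjugate Matrix

variable (ρ M) in
/-- A module is unitarizable when it has a positive definite Hermitian form for which the adjoint
of the action of a matrix is the action of its conjugate transpose. In particular `L` is stable
under the conjugate transpose. -/
def IsUnitarizable : Prop :=
  ∃ B : M →ₗ⋆[ℂ] M →ₗ[ℂ] ℂ, (∀ v w, conj (B w v) = B v w) ∧ (∀ v, v ≠ 0 → 0 < (B v v).re) ∧
    ∀ x : L, ∃ y : L, ρ y = (ρ x)ᴴ ∧ ∀ v w, B ⁅x, v⁆ w = B v ⁅y, w⁆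

theorem IsUnitarizable.of_injective (h : IsUnitarizable ρ M) (f : M' →ₗ⁅ℂ, L⁆ M)
    (hf : Function.Injective f) : IsUnitarizable ρ M' := by
  obtain ⟨B, h1, h2, h3⟩ := h
  refine ⟨(B.comp (f : M' →ₗ[ℂ] M)).compl₂ (f : M' →ₗ[ℂ] M), fun v w => h1 _ _, fun v hv => ?_,
    fun x => ?_⟩
  · exact h2 _ fun h => hv (hf (h.trans (map_zero f).symm))
  · obtain ⟨y, hy, hxy⟩ := h3 x
    refine ⟨y, hy, fun v w => ?_⟩
    change B (f ⁅x, v⁆) (f w) = B (f v) (f ⁅y, w⁆)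
    rw [LieModuleHom.map_lie, LieModuleHom.map_lie, hxy]

theorem IsUnitarizable.submodule (h : IsUnitarizable ρ M) (A : LieSubmodule ℂ L M) :
    IsUnitarizable ρ A := h.of_injective A.incl A.injective_incl

/-- In a unitarizable module, the orthogonal of a submodule is a complementary submodule. -/
theorem IsUnitarizable.exists_isCompl [FiniteDimensional ℂ M] (h : IsUnitarizable ρ M)
    (A : LieSubmodule ℂ L M) : ∃ C : LieSubmodule ℂ L M, IsCompl A C := by
  obtain ⟨B, h1, h2, h3⟩ := h
  let core : InnerProductSpace.Core ℂ M :=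
    { inner := fun v w => B v w
      conj_inner_symm := h1
      re_inner_nonneg := fun v => by
        by_cases hv : v = 0
        · simp [hv]
        · exact (h2 v hv).le
      add_left := fun x y z => by rw [map_add]; rfl
      smul_left := fun x y r => by rw [LinearMap.map_smulₛₗ]; rfl
      definite := fun v hv => by
        by_contra h0
        have := h2 v h0
        rw [hv] at this
        exact lt_irrefl _ this }
  let C : LieSubmodule ℂ L M :=
    { carrier := {m | ∀ a ∈ A, B a m = 0}
      add_mem' := fun {x y} hx hy a ha => by rw [map_add, hx a ha, hy a ha, add_zero]
      zero_mem' := fun a _ => map_zero _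
      smul_mem' := fun c x hx a ha => by rw [map_smul, hx a ha, smul_zero]
      lie_mem := by
        intro x m hm a ha
        obtain ⟨y, -, hy⟩ := h3 x
        rw [← h1, hy, h1]
        exact hm _ (A.lie_mem ha) }
  refine ⟨C, ?_⟩
  rw [← LieSubmodule.isCompl_toSubmodule]
  letI : NormedAddCommGroup M := core.toNormedAddCommGroup
  letI : InnerProductSpace ℂ M := InnerProductSpace.ofCore core.toCore
  have hC : (C : Submodule ℂ M) = (A : Submodule ℂ M)ᗮ := by
    ext m
    rw [Submodule.mem_orthogonal]
    rfl
  rw [hC]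
  exact Submodule.isCompl_orthogonal _

/-- The highest weights of a unitarizable module are nonnegative on the commutators `[e, e*]`,
because `‖e* v‖² = λ([e, e*]) ‖v‖²` for a highest weight vector `v` of weight `λ`. -/
theorem IsUnitarizable.re_weightEval_nonneg (hρ : Function.Injective ρ) (h : IsUnitarizable ρ M)
    {lam : Fin n → ℤ} {v : M} (hv : v ∈ hwSpace ρ M lam) (h0 : v ≠ 0) {e e' : L}
    (he : ∀ i j, j ≤ i → ρ e i j = 0) (he' : ρ e' = (ρ e)ᴴ) (hd : (ρ ⁅e, e'⁆).IsDiag) :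
    0 ≤ (weightEval lam (ρ ⁅e, e'⁆)).re := by
  obtain ⟨B, h1, h2, h3⟩ := h
  obtain ⟨y, hy, hxy⟩ := h3 e'
  have hye : y = e := hρ (by rw [hy, he', Matrix.conjTranspose_conjTranspose])
  subst hye
  have h4 : B ⁅e', v⁆ ⁅e', v⁆ = weightEval lam (ρ ⁅y, e'⁆) * B v v := by
    rw [hxy, leibniz_lie, hv.2 y he, lie_zero, add_zero, mem_weightSpace.mp hv.1 _ hd, map_smul,
      smul_eq_mul]
  have h5 : 0 ≤ (B ⁅e', v⁆ ⁅e', v⁆).re := by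
    by_cases hz : ⁅e', v⁆ = 0
    · simp [hz]
    · exact (h2 _ hz).le
  have h6 : (B v v).im = 0 := Complex.conj_eq_iff_im.mp (h1 v v)
  rw [h4, Complex.mul_re, h6, mul_zero, sub_zero] at h5
  exact nonneg_of_mul_nonneg_left h5 (h2 v h0)

variable (M) in
/-- A module is integral when the eigenvectors of the separating diagonal element are weight
vectors of integral weight. -/
def TriangularData.IsIntegral (T : TriangularData ρ n) : Prop :=
  ∀ v : M, v ≠ 0 → ∀ c : ℂ, ⁅T.t, v⁆ = c • v → ∃ β : Fin n → ℤ, v ∈ weightSpace ρ M β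

theorem TriangularData.IsIntegral.of_injective {T : TriangularData ρ n} (h : T.IsIntegral M)
    (f : M' →ₗ⁅ℂ, L⁆ M) (hf : Function.Injective f) : T.IsIntegral M' := by
  intro v hv c hc
  obtain ⟨β, hβ⟩ := h (f v) (fun h => hv (hf (h.trans (map_zero f).symm))) c
    (by rw [← LieModuleHom.map_lie, hc, map_smul])
  refine ⟨β, mem_weightSpace.mpr fun x hx => hf ?_⟩
  rw [LieModuleHom.map_lie, map_smul, mem_weightSpace.mp hβ x hx]

theorem TriangularData.IsIntegral.submodule {T : TriangularData ρ n} (h : T.IsIntegral M)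
    (A : LieSubmodule ℂ L M) : T.IsIntegral A := h.of_injective A.incl A.injective_incl

/-- A module spanned by vectors of integral weight is integral. -/
theorem TriangularData.isIntegral_of_iSup_eq_top (T : TriangularData ρ n)
    (h : ⨆ β : Fin n → ℤ, weightSpace ρ M β = ⊤) : T.IsIntegral M := by
  intro v hv c hc
  set f := LieModule.toEnd ℂ L M T.t
  have hle : ∀ β : Fin n → ℤ, weightSpace ρ M β ≤
      Module.End.eigenspace f (weightEval β (ρ T.t)) := fun β w hw =>
    Module.End.mem_eigenspace_iff.mpr (mem_weightSpace.mp hw _ T.isDiag_t)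
  have hind := (Module.End.eigenspaces_iSupIndep f).comp T.weightEval_t_injective
  have h1 : v ∈ ⨆ μ ∈ Set.range fun β : Fin n → ℤ => weightEval β (ρ T.t),
      Module.End.eigenspace f μ := by
    rw [iSup_range]
    have : (⊤ : Submodule ℂ M) ≤ _ := h ▸ iSup_mono hle
    exact this Submodule.mem_top
  obtain ⟨β, rfl⟩ := eigenvalue_mem f h1 hv hc
  refine ⟨β, ?_⟩
  -- Split `v` along `β` and the other weights; the second part must vanish.
  have h2 : v ∈ weightSpace ρ M β ⊔ ⨆ (γ : Fin n → ℤ) (_ : γ ≠ β), weightSpace ρ M γ := by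
    have : (⊤ : Submodule ℂ M) ≤
        weightSpace ρ M β ⊔ ⨆ (γ : Fin n → ℤ) (_ : γ ≠ β), weightSpace ρ M γ := by
      rw [← h]
      refine iSup_le fun γ => ?_
      by_cases hγ : γ = β
      · rw [hγ]; exact le_sup_left
      · exact le_sup_of_le_right (le_iSup₂_of_le γ hγ le_rfl)
    exact this Submodule.mem_top
  obtain ⟨a, ha, b, hb, hab⟩ := Submodule.mem_sup.mp h2
  have hb1 : b ∈ ⨆ (γ : Fin n → ℤ) (_ : γ ≠ β),
      Module.End.eigenspace f (weightEval γ (ρ T.t)) := iSup₂_mono (fun γ _ => hle γ) hb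
  have hb2 : b ∈ Module.End.eigenspace f (weightEval β (ρ T.t)) := by
    have : b = v - a := by rw [← hab]; abel
    rw [this]
    exact sub_mem (Module.End.mem_eigenspace_iff.mpr hc) (hle β ha)
  have hb0 : b = 0 := Submodule.disjoint_def.mp (hind β) b hb2 hb1
  rw [← hab, hb0, add_zero]
  exact ha

/-- Distinct weights are distinct eigenvalues of `t`, so that there are finitely many. -/
theorem TriangularData.finite_weights [FiniteDimensional ℂ M] (T : TriangularData ρ n) :
    {β : Fin n → ℤ | weightSpace ρ M β ≠ ⊥}.Finite := by
  refine ((Module.End.finite_hasEigenvalue (LieModule.toEnd ℂ L M T.t)).preimage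
    (T.weightEval_t_injective.injOn)).subset fun β hβ => ?_
  obtain ⟨v, hv, h0⟩ := Submodule.exists_mem_ne_zero_of_ne_bot hβ
  exact Module.End.hasEigenvalue_of_hasEigenvector
    ⟨Module.End.mem_eigenspace_iff.mpr (mem_weightSpace.mp hv _ T.isDiag_t), h0⟩

theorem TriangularData.finite_highestWeights [FiniteDimensional ℂ M] (T : TriangularData ρ n) :
    {β : Fin n → ℤ | hwSpace ρ M β ≠ ⊥}.Finite := by
  refine (T.finite_weights (M := M)).subset fun β hβ h => hβ ?_
  rw [eq_bot_iff, ← h]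
  exact fun v hv => hv.1

/-- A nonzero finite-dimensional integral module has a highest weight vector: an eigenvector of the
separating diagonal element in the top eigenspace of `h`. -/
theorem TriangularData.IsIntegral.exists_hwVector [FiniteDimensional ℂ M] [Nontrivial M]
    {T : TriangularData ρ n} (h : T.IsIntegral M) :
    ∃ (lam : Fin n → ℤ) (v : M), v ∈ hwSpace ρ M lam ∧ v ≠ 0 := by
  set f := LieModule.toEnd ℂ L M T.h
  set g := LieModule.toEnd ℂ L M T.t
  -- The eigenvalue `c` of `h` has the largest real part. Strictly upper triangular elements raise
  -- it by positive even numbers, hence they kill the `c`-eigenspace.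
  obtain ⟨c, hc, hmax⟩ := Set.exists_max_image _ Complex.re (Module.End.finite_hasEigenvalue f)
    (Module.End.exists_eigenvalue f)
  have hht : ⁅T.h, T.t⁆ = (2 * (0 : ℤ) : ℂ) • T.t := T.lie_h_of_diag fun i j hij =>
    T.isDiag_t fun h => hij (by rw [h]; omega)
  have hg : ∀ v ∈ Module.End.eigenspace f c, g v ∈ Module.End.eigenspace f c := by
    intro v hv
    rw [Module.End.mem_eigenspace_iff] at hv ⊢
    change ⁅T.h, v⁆ = c • v at hv
    change ⁅T.h, ⁅T.t, v⁆⁆ = c • ⁅T.t, v⁆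
    rw [leibniz_lie, hht, hv]
    simp
  have : Nontrivial (Module.End.eigenspace f c) := Submodule.nontrivial_iff_ne_bot.mpr hc
  obtain ⟨d, hd⟩ := Module.End.exists_eigenvalue (g.restrict hg)
  obtain ⟨⟨v, hv⟩, hvd⟩ := hd.exists_hasEigenvector
  have hv0 : v ≠ 0 := fun h => hvd.2 (Subtype.ext h)
  have hgv : ⁅T.t, v⁆ = d • v := congrArg Subtype.val (Module.End.mem_eigenspace_iff.mp hvd.1)
  obtain ⟨β, hβ⟩ := h v hv0 d hgv
  refine ⟨β, v, ⟨hβ, fun x hx => ?_⟩, hv0⟩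
  obtain ⟨p, hp, hxp⟩ := T.exists_sum_diagPart x
  rw [hxp, sum_lie]
  refine Finset.sum_eq_zero fun e _ => ?_
  by_cases he : 0 < e
  · have h1 : ∀ i j : Fin N, (j : ℤ) - i ≠ e → ρ (p e) i j = 0 := fun i j hij => by
      rw [hp, Matrix.of_apply, if_neg hij]
    have h2 := T.lie_h_lie_of_diag h1 (Module.End.mem_eigenspace_iff.mp hv)
    by_contra hne
    have h3 := hmax (c + 2 * e) (Module.End.hasEigenvalue_of_hasEigenvector
      ⟨Module.End.mem_eigenspace_iff.mpr h2, hne⟩)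
    have h4 : (0 : ℝ) < e := by exact_mod_cast he
    have h5 : (c + 2 * (e : ℂ)).re = c.re + 2 * e := by simp
    rw [h5] at h3
    linarith
  · have : p e = 0 := by
      apply T.injective
      rw [hp, map_zero]
      ext i j
      rw [Matrix.of_apply, Matrix.zero_apply]
      split_ifs with h
      · refine hx i j (Fin.le_def.mpr ?_)
        omega
      · rfl
    rw [this, zero_lie]

/-- A submodule of a unitarizable module that is generated by a highest weight vector is
irreducible. -/
theorem TriangularData.isIrreducible_lieSpan [FiniteDimensional ℂ M] (T : TriangularData ρ n)
    (h : IsUnitarizable ρ M) {lam : Fin n → ℤ} {v : M} (hv : v ∈ hwSpace ρ M lam) (h0 : v ≠ 0) :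
    LieModule.IsIrreducible ℂ L (LieSubmodule.lieSpan ℂ L {v}) := by
  set S := LieSubmodule.lieSpan ℂ L {v}
  have hvS : v ∈ S := LieSubmodule.subset_lieSpan rfl
  let w : S := ⟨v, hvS⟩
  have hw : w ∈ hwSpace ρ S lam :=
    ⟨mem_weightSpace.mpr fun x hx => Subtype.ext (mem_weightSpace.mp hv.1 x hx),
      fun x hx => Subtype.ext (hv.2 x hx)⟩
  have hw0 : w ≠ 0 := fun h => h0 (congrArg Subtype.val h)
  have hgen : LieSubmodule.lieSpan ℂ L {w} = ⊤ := by
    rw [eq_top_iff]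
    rintro ⟨m, hm⟩ -
    have h1 : S ≤ (LieSubmodule.lieSpan ℂ L {w}).map S.incl := by
      rw [LieSubmodule.lieSpan_le, Set.singleton_subset_iff]
      exact ⟨w, LieSubmodule.subset_lieSpan rfl, rfl⟩
    obtain ⟨m', hm', h2⟩ := h1 hm
    have : m' = ⟨m, hm⟩ := Subtype.ext h2
    rwa [this] at hm'
  have : Nontrivial S := ⟨w, 0, hw0⟩
  refine LieModule.IsIrreducible.mk fun A hA => ?_
  obtain ⟨C, hC⟩ := (h.submodule S).exists_isCompl A
  have htop : ∀ D : LieSubmodule ℂ L S, w ∈ D → D = ⊤ := fun D hD => by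
    rw [eq_top_iff, ← hgen, LieSubmodule.lieSpan_le, Set.singleton_subset_iff]
    exact hD
  -- If neither `A` nor its complement contains `w`, then both lie in the lower eigenspaces of `h`,
  -- and so does `w`.
  by_cases hwA : w ∈ A
  · exact htop A hwA
  · exfalso
    by_cases hwC : w ∈ C
    · rw [htop C hwC] at hC
      exact hA (eq_bot_of_isCompl_top hC)
    · have h1 : (⊤ : Submodule ℂ S) ≤ T.low S (weightEval lam (ρ T.h)) := by
        have h2 : (A : Submodule ℂ S) ⊔ C = ⊤ := by
          rw [← LieSubmodule.sup_toSubmodule, hC.sup_eq_top, LieSubmodule.top_toSubmodule]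
        rw [← h2]
        exact sup_le (T.le_low_of_notMem hw hgen hwA) (T.le_low_of_notMem hw hgen hwC)
      exact T.weightEval_h_notMem lam (eigenvalue_mem _ (h1 Submodule.mem_top) hw0
        (mem_weightSpace.mp hw.1 _ T.isDiag_h))

/-- The irreducible module of highest weight `λ` embeds in every unitarizable module with a highest
weight vector of weight `λ`. -/
theorem TriangularData.exists_irrepHom [FiniteDimensional ℂ M] (T : TriangularData ρ n)
    (h : IsUnitarizable ρ M) {lam : Fin n → ℤ} {v : M} (hv : v ∈ hwSpace ρ M lam) (h0 : v ≠ 0) :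
    ∃ f : Irrep ρ lam →ₗ⁅ℂ, L⁆ M, Function.Injective f ∧ f (irrepOne ρ lam) = v := by
  have := T.isIrreducible_lieSpan h hv h0
  let w : LieSubmodule.lieSpan ℂ L {v} := ⟨v, LieSubmodule.subset_lieSpan rfl⟩
  obtain ⟨e, he⟩ := T.exists_irrep_equiv (M := LieSubmodule.lieSpan ℂ L {v}) (v := w)
    ⟨mem_weightSpace.mpr fun x hx => Subtype.ext (mem_weightSpace.mp hv.1 x hx),
      fun x hx => Subtype.ext (hv.2 x hx)⟩ (fun h => h0 (congrArg Subtype.val h))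
  refine ⟨(LieSubmodule.incl _).comp e.toLieModuleHom, ?_, ?_⟩
  · exact (LieSubmodule.injective_incl _).comp e.injective
  · change (e (irrepOne ρ lam) : M) = v
    rw [he]

/-- In a unitarizable module, the multiplicity of `Irrep ρ λ` is the dimension of the space of
highest weight vectors of weight `λ`. -/
theorem TriangularData.finrank_irrepHom [FiniteDimensional ℂ M] (T : TriangularData ρ n)
    (h : IsUnitarizable ρ M) {lam : Fin n → ℤ} (hlam : vermaIdeal ρ lam ≠ ⊤) :
    Module.finrank ℂ (Irrep ρ lam →ₗ⁅ℂ, L⁆ M) = Module.finrank ℂ (hwSpace ρ M lam) := by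
  refine (LinearEquiv.ofBijective (evalIrrepOne M hlam)
    ⟨evalIrrepOne_injective hlam, ?_⟩).finrank_eq
  rintro ⟨v, hv⟩
  by_cases h0 : v = 0
  · exact ⟨0, Subtype.ext h0.symm⟩
  · obtain ⟨f, -, hf⟩ := T.exists_irrepHom h hv h0
    exact ⟨f, Subtype.ext hf⟩

end Unitarizable

/-! ### Additive invariants of unitarizable modules -/

section Additive

variable {N n : ℕ} {L : Type} [LieRing L] [LieAlgebra ℂ L]
variable {ρ : L →ₗ⁅ℂ⁆ Matrix (Fin N) (Fin N) ℂ}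
variable {M : Type} [AddCommGroup M] [Module ℂ M] [LieRingModule L M] [LieModule ℂ L M]
variable {M' : Type} [AddCommGroup M'] [Module ℂ M'] [LieRingModule L M'] [LieModule ℂ L M']

/-- The dimensions of subspaces add up in a direct sum when membership is tested on the
components. -/
theorem finrank_eq_add_of_isCompl {V : Type} [AddCommGroup V] [Module ℂ V] [FiniteDimensional ℂ V]
    {A B : Submodule ℂ V} (h : IsCompl A B) (S : Submodule ℂ V) (SA : Submodule ℂ A)
    (SB : Submodule ℂ B) (hS : ∀ (a : A) (b : B), (a : V) + b ∈ S ↔ a ∈ SA ∧ b ∈ SB) :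
    Module.finrank ℂ S = Module.finrank ℂ SA + Module.finrank ℂ SB := by
  let f : (SA × SB) →ₗ[ℂ] S :=
    { toFun := fun x => ⟨(x.1 : A) + (x.2 : B), (hS _ _).mpr ⟨x.1.2, x.2.2⟩⟩
      map_add' := fun x y => Subtype.ext (by simp; abel)
      map_smul' := fun c x => Subtype.ext (by simp) }
  have hf : Function.Bijective f := by
    constructor
    · rw [injective_iff_map_eq_zero]
      rintro ⟨⟨⟨a, ha⟩, ha'⟩, ⟨⟨b, hb⟩, hb'⟩⟩ h0
      have h1 : a + b = 0 := congrArg Subtype.val h0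
      have h2 : a = 0 := Submodule.disjoint_def.mp h.disjoint a ha
        (by rw [eq_neg_of_add_eq_zero_left h1]; exact neg_mem hb)
      have h3 : b = 0 := by rwa [h2, zero_add] at h1
      subst h2 h3
      rfl
    · rintro ⟨s, hs⟩
      have : s ∈ A ⊔ B := h.sup_eq_top ▸ Submodule.mem_top
      obtain ⟨a, ha, b, hb, rfl⟩ := Submodule.mem_sup.mp this
      have := (hS ⟨a, ha⟩ ⟨b, hb⟩).mp hs
      exact ⟨⟨⟨⟨a, ha⟩, this.1⟩, ⟨⟨b, hb⟩, this.2⟩⟩, rfl⟩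
  rw [← (LinearEquiv.ofBijective f hf).finrank_eq, Module.finrank_prod]

theorem add_eq_add_iff_of_isCompl {V : Type} [AddCommGroup V] [Module ℂ V]
    {A B : Submodule ℂ V} (h : IsCompl A B) {a a' b b' : V} (ha : a ∈ A) (ha' : a' ∈ A)
    (hb : b ∈ B) (hb' : b' ∈ B) : a + b = a' + b' ↔ a = a' ∧ b = b' := by
  constructor
  · intro hab
    have h1 : a - a' = b' - b := by
      rw [sub_eq_sub_iff_add_eq_add, hab, add_comm]
    have h2 : a - a' = 0 := Submodule.disjoint_def.mp h.disjoint _ (sub_mem ha ha')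
      (h1 ▸ sub_mem hb' hb)
    exact ⟨sub_eq_zero.mp h2, (sub_eq_zero.mp (h1 ▸ h2 : b' - b = 0)).symm⟩
  · rintro ⟨rfl, rfl⟩; rfl

theorem add_mem_weightSpace_iff {A B : LieSubmodule ℂ L M} (h : IsCompl A B) (β : Fin n → ℤ)
    (a : A) (b : B) : (a : M) + b ∈ weightSpace ρ M β ↔
      a ∈ weightSpace ρ A β ∧ b ∈ weightSpace ρ B β := by
  rw [← LieSubmodule.isCompl_toSubmodule] at h
  simp only [mem_weightSpace, lie_add, smul_add, ← forall_and]
  refine forall_congr' fun x => imp_congr_right fun _ => ?_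
  rw [add_eq_add_iff_of_isCompl h (A.lie_mem a.2) (A.smul_mem _ a.2) (B.lie_mem b.2)
    (B.smul_mem _ b.2)]
  simp only [Subtype.ext_iff]
  rfl

theorem add_mem_hwSpace_iff {A B : LieSubmodule ℂ L M} (h : IsCompl A B) (β : Fin n → ℤ)
    (a : A) (b : B) : (a : M) + b ∈ hwSpace ρ M β ↔ a ∈ hwSpace ρ A β ∧ b ∈ hwSpace ρ B β := by
  rw [mem_hwSpace, mem_hwSpace, mem_hwSpace, add_mem_weightSpace_iff h, and_and_and_comm]
  refine and_congr_right fun _ => ?_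
  rw [← LieSubmodule.isCompl_toSubmodule] at h
  rw [← forall_and]
  refine forall_congr' fun x => ?_
  rw [← imp_and]
  refine imp_congr_right fun _ => ?_
  rw [lie_add, ← add_zero (0 : M), add_eq_add_iff_of_isCompl h (A.lie_mem a.2) A.zero_mem
    (B.lie_mem b.2) B.zero_mem]
  simp only [Subtype.ext_iff]
  rfl

theorem finrank_weightSpace_add [FiniteDimensional ℂ M] {A B : LieSubmodule ℂ L M}
    (h : IsCompl A B) (β : Fin n → ℤ) : Module.finrank ℂ (weightSpace ρ M β) =
      Module.finrank ℂ (weightSpace ρ A β) + Module.finrank ℂ (weightSpace ρ B β) :=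
  finrank_eq_add_of_isCompl (LieSubmodule.isCompl_toSubmodule.mpr h) _ _ _
    (add_mem_weightSpace_iff h β)

theorem finrank_hwSpace_add [FiniteDimensional ℂ M] {A B : LieSubmodule ℂ L M}
    (h : IsCompl A B) (β : Fin n → ℤ) : Module.finrank ℂ (hwSpace ρ M β) =
      Module.finrank ℂ (hwSpace ρ A β) + Module.finrank ℂ (hwSpace ρ B β) :=
  finrank_eq_add_of_isCompl (LieSubmodule.isCompl_toSubmodule.mpr h) _ _ _
    (add_mem_hwSpace_iff h β)

theorem finrank_weightSpace_congr (e : M ≃ₗ⁅ℂ, L⁆ M') (β : Fin n → ℤ) :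
    Module.finrank ℂ (weightSpace ρ M β) = Module.finrank ℂ (weightSpace ρ M' β) := by
  have : weightSpace ρ M' β = (weightSpace ρ M β).map (e.toLinearEquiv : M →ₗ[ℂ] M') := by
    ext m
    simp only [Submodule.mem_map, mem_weightSpace]
    constructor
    · intro hm
      refine ⟨e.symm m, fun x hx => ?_, e.apply_symm_apply m⟩
      have h1 : e.symm ⁅x, m⁆ = ⁅x, e.symm m⁆ := e.symm.toLieModuleHom.map_lie x m
      rw [← h1, hm x hx, map_smul]
    · rintro ⟨m, hm, rfl⟩ x hx
      have h1 : ⁅x, e m⁆ = e ⁅x, m⁆ := (e.toLieModuleHom.map_lie x m).symm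
      change ⁅x, e m⁆ = _ • e m
      rw [h1, hm x hx, map_smul]
  rw [this]
  exact (e.toLinearEquiv.submoduleMap (weightSpace ρ M β)).finrank_eq

theorem finrank_hwSpace_congr (e : M ≃ₗ⁅ℂ, L⁆ M') (β : Fin n → ℤ) :
    Module.finrank ℂ (hwSpace ρ M β) = Module.finrank ℂ (hwSpace ρ M' β) := by
  have : hwSpace ρ M' β = (hwSpace ρ M β).map (e.toLinearEquiv : M →ₗ[ℂ] M') := by
    ext m
    rw [Submodule.mem_map]
    constructor
    · exact fun hm => ⟨e.symm m, map_mem_hwSpace e.symm.toLieModuleHom hm, e.apply_symm_apply m⟩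
    · rintro ⟨m, hm, rfl⟩
      exact map_mem_hwSpace e.toLieModuleHom hm
  rw [this]
  exact (e.toLinearEquiv.submoduleMap (hwSpace ρ M β)).finrank_eq

theorem formalChar_congr (e : M ≃ₗ⁅ℂ, L⁆ M') : formalChar ρ n M = formalChar ρ n M' := by
  unfold formalChar
  simp_rw [finrank_weightSpace_congr e]

theorem TriangularData.formalChar_add (T : TriangularData ρ n) [FiniteDimensional ℂ M]
    {A B : LieSubmodule ℂ L M} (h : IsCompl A B) :
    formalChar ρ n M = formalChar ρ n A + formalChar ρ n B := by
  have hfin : ∀ C : LieSubmodule ℂ L M, (Function.support fun β : Fin n → ℤ =>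
      (AddMonoidAlgebra.single β (Module.finrank ℂ (weightSpace ρ C β) : ℤ) :
        AddMonoidAlgebra ℤ (Fin n → ℤ))).Finite := by
    intro C
    refine (T.finite_weights (M := C)).subset fun β hβ h => hβ ?_
    simp only
    rw [h, finrank_bot, Nat.cast_zero]
    exact AddMonoidAlgebra.single_zero β
  unfold formalChar
  rw [← finsum_add_distrib (hfin A) (hfin B)]
  refine finsum_congr fun β => ?_
  rw [finrank_weightSpace_add h, Nat.cast_add]
  exact AddMonoidAlgebra.single_add _ _ _

theorem isIrreducible_of_isAtom {A : LieSubmodule ℂ L M} (hA : IsAtom A) :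
    LieModule.IsIrreducible ℂ L A := by
  have : Nontrivial A := (LieSubmodule.nontrivial_iff_ne_bot ℂ L M).mpr hA.1
  refine LieModule.IsIrreducible.mk fun C hC => ?_
  have h1 : C.map A.incl ≤ A := by
    rintro _ ⟨m, -, rfl⟩
    exact m.2
  rcases hA.le_iff.mp h1 with h | h
  · refine absurd ?_ hC
    rw [_root_.eq_bot_iff]
    intro m hm
    have : A.incl m ∈ C.map A.incl := ⟨m, hm, rfl⟩
    rw [h, LieSubmodule.mem_bot] at this
    exact Subtype.ext this
  · rw [_root_.eq_top_iff]
    rintro ⟨m, hm⟩ -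
    rw [← h] at hm
    obtain ⟨m', hm', h2⟩ := hm
    rwa [show m' = ⟨m, _⟩ from Subtype.ext h2] at hm'

/-- An isomorphism-invariant additive function on finite-dimensional modules is determined on the
unitarizable integral ones by its values on the irreducible highest weight modules, each counted
with the dimension of the space of highest weight vectors. -/
theorem TriangularData.additive_eq_finsum (T : TriangularData ρ n) {G : Type} [AddCommGroup G]
    (F : ∀ (M : Type) [AddCommGroup M] [Module ℂ M] [LieRingModule L M] [LieModule ℂ L M], G)
    (hiso : ∀ (M M' : Type) [AddCommGroup M] [Module ℂ M] [LieRingModule L M] [LieModule ℂ L M]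
      [AddCommGroup M'] [Module ℂ M'] [LieRingModule L M'] [LieModule ℂ L M'],
      (M ≃ₗ⁅ℂ, L⁆ M') → F M = F M')
    (hadd : ∀ (M : Type) [AddCommGroup M] [Module ℂ M] [LieRingModule L M] [LieModule ℂ L M]
      [FiniteDimensional ℂ M] (A B : LieSubmodule ℂ L M), IsCompl A B → F M = F A + F B) :
    ∀ (M : Type) [AddCommGroup M] [Module ℂ M] [LieRingModule L M] [LieModule ℂ L M]
      [FiniteDimensional ℂ M], IsUnitarizable ρ M → T.IsIntegral M →
      F M = ∑ᶠ lam : Fin n → ℤ, Module.finrank ℂ (hwSpace ρ M lam) • F (Irrep ρ lam) := by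
  suffices key : ∀ (d : ℕ) (M : Type) [AddCommGroup M] [Module ℂ M] [LieRingModule L M]
      [LieModule ℂ L M] [FiniteDimensional ℂ M], Module.finrank ℂ M = d → IsUnitarizable ρ M →
      T.IsIntegral M →
      F M = ∑ᶠ lam : Fin n → ℤ, Module.finrank ℂ (hwSpace ρ M lam) • F (Irrep ρ lam) from
    fun M => key _ M rfl
  intro d
  induction d using Nat.strong_induction_on with
  | _ d ih =>
  intro M _ _ _ _ _ hd hU hI
  rcases subsingleton_or_nontrivial M with hM | hM
  · have h1 : F M = 0 := by
      have h2 : (⊥ : LieSubmodule ℂ L M) = ⊤ := Subsingleton.elim _ _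
      have h3 := hadd M ⊤ ⊤ (by
        rw [← h2]
        exact ⟨disjoint_bot_left, codisjoint_iff.mpr (by simp [h2])⟩)
      rw [hiso _ M (LieModuleEquiv.ofTop ℂ L M)] at h3
      simpa using h3
    rw [h1, finsum_eq_zero_of_forall_eq_zero]
    intro lam
    rw [show hwSpace ρ M lam = ⊥ from Subsingleton.elim _ _, finrank_bot, zero_smul]
  -- Split off an irreducible submodule `A` and apply the induction hypothesis to a complement.
  · have : Nontrivial (LieSubmodule ℂ L M) := inferInstance
    obtain ⟨A, hA, -⟩ := (eq_bot_or_exists_atom_le (⊤ : LieSubmodule ℂ L M)).resolve_left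
      top_ne_bot
    obtain ⟨B, hAB⟩ := hU.exists_isCompl A
    have := isIrreducible_of_isAtom hA
    have : Nontrivial A := (LieSubmodule.nontrivial_iff_ne_bot ℂ L M).mpr hA.1
    obtain ⟨lam, v, hv, h0⟩ := (hI.submodule A).exists_hwVector
    obtain ⟨e, -⟩ := T.exists_irrep_equiv hv h0
    have hlt : Module.finrank ℂ B < d := by
      have h1 := Submodule.finrank_add_eq_of_isCompl (LieSubmodule.isCompl_toSubmodule.mpr hAB)
      have h2 : 0 < Module.finrank ℂ A := Module.finrank_pos
      have h3 : Module.finrank ℂ (A : Submodule ℂ M) = Module.finrank ℂ A := rfl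
      have h4 : Module.finrank ℂ (B : Submodule ℂ M) = Module.finrank ℂ B := rfl
      omega
    have hB := ih _ hlt B rfl (hU.submodule B) (hI.submodule B)
    have hdec : ∀ mu, Module.finrank ℂ (hwSpace ρ M mu) • F (Irrep ρ mu) =
        (if mu = lam then F (Irrep ρ mu) else 0) +
          Module.finrank ℂ (hwSpace ρ B mu) • F (Irrep ρ mu) := by
      intro mu
      rw [finrank_hwSpace_add hAB, T.finrank_hwSpace hv h0, add_smul]
      split_ifs <;> simp
    rw [hadd M A B hAB, hB, finsum_congr hdec, finsum_add_distrib, ← hiso _ _ e]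
    · congr 1
      rw [finsum_eq_single _ lam (fun mu hmu => if_neg hmu), if_pos rfl]
    · exact (Set.finite_singleton lam).subset fun mu hmu => by
        by_contra h
        exact hmu (if_neg h)
    · refine (T.finite_highestWeights (M := B)).subset fun mu hmu h => hmu ?_
      simp only
      rw [h, finrank_bot, zero_smul]

end Additive

/-! ### The symmetric and the exterior square of the vector representation -/

theorem sym_leibniz {L M : Type} [LieRing L] [LieAlgebra ℂ L] [AddCommGroup M] [Module ℂ M]
    [LieRingModule L M] [LieModule ℂ L M] (x : L) (f g : SymmetricAlgebra ℂ M) :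
    ⁅x, f * g⁆ = f * ⁅x, g⁆ + g * ⁅x, f⁆ := by
  rw [lie_sym, lie_sym, lie_sym, Derivation.leibniz, smul_eq_mul, smul_eq_mul]

section FormSpace

open scoped Matrix

/-- The matrices `A` with `Aᵀ = s A`, a model of the symmetric square (`s = 1`) and of the exterior
square (`s = -1`) of the vector representation of `𝔤𝔩_N`. -/
def formSubmodule (N : ℕ) (s : ℤˣ) : Submodule ℂ (gl N) where
  carrier := {A | Aᵀ = ((s : ℤ) : ℂ) • A}
  add_mem' {A B} hA hB := by
    change (A + B)ᵀ = _
    rw [Matrix.transpose_add, show Aᵀ = _ from hA, show Bᵀ = _ from hB, smul_add]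
  zero_mem' := by
    change (0 : gl N)ᵀ = _
    rw [Matrix.transpose_zero, smul_zero]
  smul_mem' c A hA := by
    change (c • A)ᵀ = _
    rw [Matrix.transpose_smul, show Aᵀ = _ from hA, smul_comm]

/-- The space `formSubmodule N s`, on which a matrix `X` acts by `A ↦ X A + A Xᵀ`. -/
def FormSpace (N : ℕ) (s : ℤˣ) : Type := formSubmodule N s

variable {N : ℕ} {s : ℤˣ}

instance : AddCommGroup (FormSpace N s) := inferInstanceAs (AddCommGroup (formSubmodule N s))

instance : Module ℂ (FormSpace N s) := inferInstanceAs (Module ℂ (formSubmodule N s))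

instance : FiniteDimensional ℂ (FormSpace N s) :=
  inferInstanceAs (FiniteDimensional ℂ (formSubmodule N s))

variable (N s) in
/-- The inclusion in the space of matrices. -/
def formIncl : FormSpace N s →ₗ[ℂ] gl N := (formSubmodule N s).subtype

theorem formIncl_injective : Function.Injective (formIncl N s) := Subtype.val_injective

theorem transpose_formIncl (A : FormSpace N s) :
    (formIncl N s A)ᵀ = ((s : ℤ) : ℂ) • formIncl N s A := A.2

theorem units_mul_self (s : ℤˣ) : ((s : ℤ) : ℂ) * ((s : ℤ) : ℂ) = 1 := by
  rw [← Int.cast_mul, Int.units_coe_mul_self, Int.cast_one]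

/-- The action of `𝔤𝔩_N` on the tensor square of the vector representation, seen as the space of
matrices. -/
def formAct (X A : gl N) : gl N := X * A + A * Xᵀ

instance : LieRingModule (gl N) (FormSpace N s) where
  bracket X A := ⟨formAct X (formIncl N s A), by
    change (formAct X _)ᵀ = _
    rw [formAct, Matrix.transpose_add, Matrix.transpose_mul, Matrix.transpose_mul,
      transpose_formIncl, Matrix.transpose_transpose, Matrix.smul_mul, Matrix.mul_smul,
      ← smul_add, add_comm]⟩
  add_lie X Y A := Subtype.ext (by
    change formAct (X + Y) (formIncl N s A) =
      formAct X (formIncl N s A) + formAct Y (formIncl N s A)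
    simp only [formAct, Matrix.transpose_add]
    noncomm_ring)
  lie_add X A B := Subtype.ext (by
    change formAct X (formIncl N s (A + B)) =
      formAct X (formIncl N s A) + formAct X (formIncl N s B)
    simp only [formAct, map_add]
    noncomm_ring)
  leibniz_lie X Y A := Subtype.ext (by
    change formAct X (formAct Y (formIncl N s A)) =
      formAct ⁅X, Y⁆ (formIncl N s A) + formAct Y (formAct X (formIncl N s A))
    simp only [formAct, LieRing.of_associative_ring_bracket, Matrix.transpose_sub,
      Matrix.transpose_mul]
    noncomm_ring)

theorem formIncl_lie (X : gl N) (A : FormSpace N s) :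
    formIncl N s ⁅X, A⁆ = X * formIncl N s A + formIncl N s A * Xᵀ := rfl

instance : LieModule ℂ (gl N) (FormSpace N s) where
  smul_lie c X A := formIncl_injective (by
    rw [map_smul, formIncl_lie, formIncl_lie, Matrix.transpose_smul, Matrix.smul_mul,
      Matrix.mul_smul, smul_add])
  lie_smul c X A := formIncl_injective (by
    rw [map_smul, formIncl_lie, formIncl_lie, map_smul, Matrix.smul_mul, Matrix.mul_smul,
      smul_add])

variable (s) in
/-- The symmetrization (`s = 1`) or antisymmetrization (`s = -1`) `A ↦ A + s Aᵀ`. -/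
def formProj : gl N →ₗ[ℂ] FormSpace N s where
  toFun A := ⟨A + ((s : ℤ) : ℂ) • Aᵀ, by
    change (A + ((s : ℤ) : ℂ) • Aᵀ)ᵀ = _
    rw [Matrix.transpose_add, Matrix.transpose_smul, Matrix.transpose_transpose, smul_add,
      smul_smul, units_mul_self, one_smul, add_comm]⟩
  map_add' A B := Subtype.ext (by
    change (A + B) + ((s : ℤ) : ℂ) • (A + B)ᵀ =
      (A + ((s : ℤ) : ℂ) • Aᵀ) + (B + ((s : ℤ) : ℂ) • Bᵀ)
    rw [Matrix.transpose_add, smul_add]; abel)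
  map_smul' c A := Subtype.ext (by
    change c • A + ((s : ℤ) : ℂ) • (c • A)ᵀ = c • (A + ((s : ℤ) : ℂ) • Aᵀ)
    rw [Matrix.transpose_smul, smul_add, smul_comm c])

theorem formIncl_formProj (A : gl N) :
    formIncl N s (formProj s A) = A + ((s : ℤ) : ℂ) • Aᵀ := rfl

theorem formProj_formIncl (A : FormSpace N s) : formProj s (formIncl N s A) = (2 : ℂ) • A := by
  apply formIncl_injective
  rw [formIncl_formProj, transpose_formIncl, smul_smul, units_mul_self, map_smul, one_smul,
    two_smul]

theorem lie_formProj (X A : gl N) : ⁅X, formProj s A⁆ = formProj s (X * A + A * Xᵀ) := by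
  apply formIncl_injective
  rw [formIncl_lie, formIncl_formProj, formIncl_formProj, Matrix.transpose_add,
    Matrix.transpose_mul, Matrix.transpose_mul, Matrix.transpose_transpose, mul_add, add_mul,
    Matrix.mul_smul, Matrix.smul_mul, smul_add]
  abel

variable (s) in
/-- The product `e_a e_b` (`s = 1`) or `e_a ∧ e_b` (`s = -1`) of basis vectors, that is the matrix
`E_ab + s E_ba`, as an element of degree one of the symmetric algebra. -/
def formVar (a b : Fin N) : SymmetricAlgebra ℂ (FormSpace N s) :=
  SymmetricAlgebra.ι ℂ _ (formProj s (Matrix.single a b 1))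

theorem ι_formProj (A : gl N) : SymmetricAlgebra.ι ℂ (FormSpace N s) (formProj s A) =
    ∑ a, ∑ b, A a b • formVar s a b := by
  conv_lhs => rw [Matrix.matrix_eq_sum_single A]
  simp only [map_sum]
  refine Finset.sum_congr rfl fun a _ => Finset.sum_congr rfl fun b _ => ?_
  rw [formVar, ← map_smul, ← map_smul, Matrix.smul_single, smul_eq_mul, mul_one]

theorem ι_eq_sum_formVar (A : FormSpace N s) : SymmetricAlgebra.ι ℂ (FormSpace N s) A =
    ∑ a, ∑ b, (2⁻¹ * formIncl N s A a b) • formVar s a b := by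
  have h : A = (2⁻¹ : ℂ) • formProj s (formIncl N s A) := by
    rw [formProj_formIncl, smul_smul, inv_mul_cancel₀ two_ne_zero, one_smul]
  conv_lhs => rw [h]
  rw [map_smul, ι_formProj]
  simp only [Finset.smul_sum, smul_smul]

theorem lie_formVar (X : gl N) (a b : Fin N) :
    ⁅X, formVar s a b⁆ = ∑ c, X c a • formVar s c b + ∑ c, X c b • formVar s a c := by
  rw [formVar, lie_sym_ι, lie_formProj, map_add, map_add, ι_formProj, ι_formProj]
  congr 1
  · refine Finset.sum_congr rfl fun c _ => ?_
    rw [Finset.sum_eq_single b]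
    · simp
    · intro d _ hd
      simp [hd]
    · simp
  · rw [Finset.sum_eq_single a]
    · refine Finset.sum_congr rfl fun c _ => ?_
      simp
    · intro d _ hd
      simp [hd]
    · simp

theorem formVar_swap (a b : Fin N) : formVar s b a = ((s : ℤ) : ℂ) • formVar s a b := by
  rw [formVar, formVar, ← map_smul]
  congr 1
  apply formIncl_injective
  rw [map_smul, formIncl_formProj, formIncl_formProj, smul_add, smul_smul, units_mul_self,
    one_smul, Matrix.transpose_single, Matrix.transpose_single, add_comm]

end FormSpace

/-! ### The Fischer form -/

section Fischer

open scoped ComplexConjugate Matrix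
open MvPolynomial

variable {σ : Type} [Fintype σ]

/-- The product of the factorials of the exponents of a monomial. -/
def monomialFactorial (m : σ →₀ ℕ) : ℕ := ∏ v, (m v).factorial

theorem monomialFactorial_add_single [DecidableEq σ] (m : σ →₀ ℕ) (w : σ) :
    monomialFactorial (m + Finsupp.single w 1) = monomialFactorial m * (m w + 1) := by
  unfold monomialFactorial
  rw [← Finset.mul_prod_erase _ _ (Finset.mem_univ w),
    ← Finset.mul_prod_erase _ _ (Finset.mem_univ w)]
  have h : ∀ v ∈ Finset.univ.erase w,
      ((m + Finsupp.single w 1 : σ →₀ ℕ) v).factorial = (m v).factorial := by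
    intro v hv
    rw [Finsupp.add_apply, Finsupp.single_eq_of_ne (Finset.ne_of_mem_erase hv), add_zero]
  rw [Finset.prod_congr rfl h, Finsupp.add_apply, Finsupp.single_eq_same, Nat.factorial_succ]
  ring

/-- The sum that defines the Fischer form may be taken over any finite set containing the support of
the first polynomial. -/
theorem sum_support_eq {f : MvPolynomial σ ℂ} {t : Finset (σ →₀ ℕ)} (ht : f.support ⊆ t)
    (g : MvPolynomial σ ℂ) :
    ∑ m ∈ f.support, (monomialFactorial m : ℂ) * conj (coeff m f) * coeff m g =
      ∑ m ∈ t, (monomialFactorial m : ℂ) * conj (coeff m f) * coeff m g := by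
  refine Finset.sum_subset ht fun m _ hm => ?_
  rw [notMem_support_iff.mp hm, map_zero, mul_zero, zero_mul]

variable (σ) in
/-- The Fischer form on polynomials: the monomials are orthogonal and the norm of a monomial is the
product of the factorials of its exponents. Multiplication by a variable is adjoint to the partial
derivative. -/
def fischer : MvPolynomial σ ℂ →ₗ⋆[ℂ] MvPolynomial σ ℂ →ₗ[ℂ] ℂ :=
  LinearMap.mk₂'ₛₗ _ _
    (fun f g => ∑ m ∈ f.support, (monomialFactorial m : ℂ) * conj (coeff m f) * coeff m g)
    (fun f f' g => by
      classical
      rw [sum_support_eq (t := f.support ∪ f'.support) support_add,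
        sum_support_eq (f := f) (t := f.support ∪ f'.support) Finset.subset_union_left,
        sum_support_eq (f := f') (t := f.support ∪ f'.support) Finset.subset_union_right,
        ← Finset.sum_add_distrib]
      refine Finset.sum_congr rfl fun m _ => ?_
      rw [coeff_add, map_add]; ring)
    (fun c f g => by
      rw [sum_support_eq (t := f.support) support_smul, smul_eq_mul, Finset.mul_sum]
      refine Finset.sum_congr rfl fun m _ => ?_
      rw [coeff_smul, smul_eq_mul, map_mul]; ring)
    (fun f g g' => by
      rw [← Finset.sum_add_distrib]
      refine Finset.sum_congr rfl fun m _ => ?_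
      rw [coeff_add]; ring)
    (fun c f g => by
      rw [RingHom.id_apply, smul_eq_mul, Finset.mul_sum]
      refine Finset.sum_congr rfl fun m _ => ?_
      rw [coeff_smul, smul_eq_mul]; ring)

theorem fischer_apply (f g : MvPolynomial σ ℂ) : fischer σ f g =
    ∑ m ∈ f.support, (monomialFactorial m : ℂ) * conj (coeff m f) * coeff m g := rfl

theorem fischer_monomial (m : σ →₀ ℕ) (c : ℂ) (g : MvPolynomial σ ℂ) :
    fischer σ (monomial m c) g = (monomialFactorial m : ℂ) * conj c * coeff m g := by
  classical
  rw [fischer_apply, sum_support_eq (t := {m}) support_monomial_subset, Finset.sum_singleton,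
    coeff_monomial, if_pos rfl]

theorem conj_fischer (f g : MvPolynomial σ ℂ) : conj (fischer σ g f) = fischer σ f g := by
  classical
  rw [fischer_apply, fischer_apply,
    sum_support_eq (t := f.support ∪ g.support) Finset.subset_union_right,
    sum_support_eq (t := f.support ∪ g.support) Finset.subset_union_left, map_sum]
  refine Finset.sum_congr rfl fun m _ => ?_
  rw [map_mul, map_mul, Complex.conj_conj, Complex.conj_natCast]
  ring

theorem fischer_self_pos {f : MvPolynomial σ ℂ} (hf : f ≠ 0) : 0 < (fischer σ f f).re := by
  rw [fischer_apply, Complex.re_sum]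
  refine Finset.sum_pos (fun m hm => ?_) (Finset.nonempty_of_ne_empty (by simpa using hf))
  rw [mul_assoc, mul_comm (conj _), Complex.mul_conj, ← Complex.ofReal_natCast,
    ← Complex.ofReal_mul, Complex.ofReal_re]
  refine mul_pos (Nat.cast_pos.mpr (Finset.prod_pos fun v _ => Nat.factorial_pos _))
    (Complex.normSq_pos.mpr (mem_support_iff.mp hm))

theorem fischer_X_mul (w : σ) (f g : MvPolynomial σ ℂ) :
    fischer σ (X w * f) g = fischer σ f (pderiv w g) := by
  classical
  induction f using MvPolynomial.induction_on' with
  | monomial m c =>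
    rw [X, monomial_mul, one_mul, fischer_monomial, fischer_monomial, add_comm,
      monomialFactorial_add_single, coeff_pderiv]
    push_cast
    ring
  | add p q hp hq =>
    rw [mul_add, map_add, map_add, LinearMap.add_apply, LinearMap.add_apply, hp, hq]

theorem fischer_pderiv (w : σ) (f g : MvPolynomial σ ℂ) :
    fischer σ (pderiv w f) g = fischer σ f (X w * g) := by
  rw [← conj_fischer, ← fischer_X_mul, conj_fischer]

/-- The derivation of the polynomial ring that extends the endomorphism with matrix `c` of the span
of the variables. -/
def matrixDerivation (c : Matrix σ σ ℂ) : Derivation ℂ (MvPolynomial σ ℂ) (MvPolynomial σ ℂ) :=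
  ∑ v, ∑ w, c w v • (X w : MvPolynomial σ ℂ) • pderiv v

theorem matrixDerivation_apply (c : Matrix σ σ ℂ) (f : MvPolynomial σ ℂ) :
    matrixDerivation c f = ∑ v, ∑ w, c w v • (X w * pderiv v f) := by
  have h : ∀ (t : Finset σ) (D : σ → Derivation ℂ (MvPolynomial σ ℂ) (MvPolynomial σ ℂ)),
      (∑ v ∈ t, D v) f = ∑ v ∈ t, D v f := fun t D => by
    classical
    induction t using Finset.induction_on with
    | empty => simp
    | insert a t ha ih => rw [Finset.sum_insert ha, Finset.sum_insert ha, Derivation.add_apply, ih]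
  simp only [matrixDerivation, h, Derivation.smul_apply, smul_eq_mul]

theorem matrixDerivation_X (c : Matrix σ σ ℂ) (v : σ) :
    matrixDerivation c (X v) = ∑ w, c w v • X w := by
  classical
  rw [matrixDerivation_apply, Finset.sum_eq_single v]
  · simp
  · intro u _ hu
    simp [pderiv_X_of_ne hu.symm]
  · simp

theorem fischer_matrixDerivation (c : Matrix σ σ ℂ) (f g : MvPolynomial σ ℂ) :
    fischer σ (matrixDerivation c f) g = fischer σ f (matrixDerivation cᴴ g) := by
  rw [matrixDerivation_apply, matrixDerivation_apply, Finset.sum_comm]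
  simp only [map_sum, LinearMap.sum_apply, LinearMap.map_smulₛₗ, LinearMap.smul_apply, smul_eq_mul,
    Matrix.conjTranspose_apply, RingHom.id_apply, fischer_X_mul, ← fischer_pderiv]
  rfl

/-- The coefficients of the action of a matrix on pairs of indices. -/
def pairMatrix {N : ℕ} (Y : gl N) : Matrix (Fin N × Fin N) (Fin N × Fin N) ℂ :=
  Matrix.of fun w v => (if w.2 = v.2 then Y w.1 v.1 else 0) + if w.1 = v.1 then Y w.2 v.2 else 0

theorem conjTranspose_pairMatrix {N : ℕ} (Y : gl N) : (pairMatrix Y)ᴴ = pairMatrix Yᴴ := by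
  ext w v
  simp only [pairMatrix, Matrix.conjTranspose_apply, Matrix.of_apply, star_add, eq_comm]
  congr 1 <;> split_ifs <;> simp

variable {N : ℕ} {s : ℤˣ}

variable (N s) in
/-- The embedding of the symmetric algebra of `FormSpace N s` in the polynomials in the matrix
entries. -/
def formToPoly : SymmetricAlgebra ℂ (FormSpace N s) →ₐ[ℂ] MvPolynomial (Fin N × Fin N) ℂ :=
  SymmetricAlgebra.lift
    { toFun := fun A => ∑ v : Fin N × Fin N, formIncl N s A v.1 v.2 • X v
      map_add' := fun A B => by
        simp only [map_add, Matrix.add_apply, add_smul, Finset.sum_add_distrib]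
      map_smul' := fun c A => by
        simp only [map_smul, Matrix.smul_apply, smul_assoc, Finset.smul_sum, RingHom.id_apply] }

theorem formToPoly_ι (A : FormSpace N s) : formToPoly N s (SymmetricAlgebra.ι ℂ _ A) =
    ∑ v : Fin N × Fin N, formIncl N s A v.1 v.2 • X v :=
  SymmetricAlgebra.lift_ι_apply _ A

theorem formToPoly_injective : Function.Injective (formToPoly N s) := by
  let Ψ : MvPolynomial (Fin N × Fin N) ℂ →ₐ[ℂ] SymmetricAlgebra ℂ (FormSpace N s) :=
    aeval fun v => (2⁻¹ : ℂ) • formVar s v.1 v.2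
  have h : Ψ.comp (formToPoly N s) = AlgHom.id ℂ _ := by
    apply SymmetricAlgebra.algHom_ext
    ext A
    change Ψ (formToPoly N s (SymmetricAlgebra.ι ℂ _ A)) = SymmetricAlgebra.ι ℂ _ A
    rw [formToPoly_ι, ι_eq_sum_formVar, map_sum, Fintype.sum_prod_type]
    refine Finset.sum_congr rfl fun a _ => Finset.sum_congr rfl fun b _ => ?_
    rw [map_smul, aeval_X, smul_smul, mul_comm]
  exact Function.LeftInverse.injective (g := Ψ) fun x => congrArg (fun g => g x) h

/-- The embedding in the polynomials intertwines the action of a matrix with a linear vector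
field. -/
theorem formToPoly_lie (Y : gl N) (f : SymmetricAlgebra ℂ (FormSpace N s)) :
    formToPoly N s ⁅Y, f⁆ = matrixDerivation (pairMatrix Y) (formToPoly N s f) := by
  induction f using SymmetricAlgebra.induction with
  | algebraMap r => rw [lie_sym, Derivation.map_algebraMap, map_zero, AlgHom.commutes,
      Derivation.map_algebraMap]
  | ι A =>
    rw [lie_sym_ι, formToPoly_ι, formToPoly_ι, formIncl_lie, map_sum]
    simp only [Derivation.map_smul, matrixDerivation_X, Finset.smul_sum]
    rw [Finset.sum_comm]
    refine Finset.sum_congr rfl fun w _ => ?_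
    simp only [smul_smul, ← Finset.sum_smul]
    congr 1
    rw [Matrix.add_apply, Matrix.mul_apply, Matrix.mul_apply]
    simp only [pairMatrix, Matrix.of_apply, mul_add, mul_ite, mul_zero, Fintype.sum_prod_type,
      Finset.sum_add_distrib]
    congr 1
    · refine Finset.sum_congr rfl fun a _ => ?_
      rw [Finset.sum_ite_eq, if_pos (Finset.mem_univ _), mul_comm]
    · rw [Finset.sum_comm]
      refine Finset.sum_congr rfl fun b _ => ?_
      rw [Finset.sum_ite_eq, if_pos (Finset.mem_univ _), Matrix.transpose_apply]
  | mul f g hf hg => rw [sym_leibniz, map_add, map_mul, map_mul, map_mul, hf, hg,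
      Derivation.leibniz, smul_eq_mul, smul_eq_mul]
  | add f g hf hg => rw [lie_add, map_add, map_add, map_add, hf, hg]

variable (N s) in
/-- The Fischer form makes the symmetric algebra of `FormSpace N s` unitarizable. -/
theorem isUnitarizable_sym : IsUnitarizable (LieHom.id : gl N →ₗ⁅ℂ⁆ gl N)
    (SymmetricAlgebra ℂ (FormSpace N s)) := by
  refine ⟨((fischer (Fin N × Fin N)).comp (formToPoly N s).toLinearMap).compl₂
    (formToPoly N s).toLinearMap, fun f g => conj_fischer _ _, fun f hf => ?_, fun Y =>
    ⟨Yᴴ, rfl, fun f g => ?_⟩⟩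
  · exact fischer_self_pos fun h => hf (formToPoly_injective (h.trans (map_zero _).symm))
  · change fischer _ (formToPoly N s ⁅Y, f⁆) (formToPoly N s g) =
      fischer _ (formToPoly N s f) (formToPoly N s ⁅Yᴴ, g⁆)
    rw [formToPoly_lie, formToPoly_lie, fischer_matrixDerivation, conjTranspose_pairMatrix]

end Fischer

/-! ### Determinants and Pfaffians as highest weight vectors -/

section Pfaffian

variable {R : Type} [CommRing R] {m : ℕ}

/-- The product `∏ᵢ A(v_{i,0}, v_{i,1})` of values of a bilinear form, as a multilinear map. -/
def pairingProduct (A : Matrix (Fin m × Fin 2) (Fin m × Fin 2) R) :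
    MultilinearMap R (fun _ : Fin m × Fin 2 => (Fin m × Fin 2 → R)) R where
  toFun v := ∏ i, v (i, 0) ⬝ᵥ A.mulVec (v (i, 1))
  map_update_add' := by
    intro _ v p x y
    obtain ⟨i, b⟩ := p
    have h : ∀ z, ∏ j ∈ Finset.univ.erase i, (Function.update v (i, b) z (j, 0) ⬝ᵥ
        A.mulVec (Function.update v (i, b) z (j, 1))) =
        ∏ j ∈ Finset.univ.erase i, (v (j, 0) ⬝ᵥ A.mulVec (v (j, 1))) := by
      intro z
      refine Finset.prod_congr rfl fun j hj => ?_
      have hj := Finset.ne_of_mem_erase hj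
      rw [Function.update_of_ne (by simp [hj]), Function.update_of_ne (by simp [hj])]
    simp only [← Finset.mul_prod_erase _ _ (Finset.mem_univ i), h, ← add_mul]
    congr 1
    fin_cases b
    · simp [Function.update_of_ne, add_dotProduct]
    · simp [Function.update_of_ne, Matrix.mulVec_add, dotProduct_add]
  map_update_smul' := by
    intro _ v p c x
    obtain ⟨i, b⟩ := p
    have h : ∀ z, ∏ j ∈ Finset.univ.erase i, (Function.update v (i, b) z (j, 0) ⬝ᵥ
        A.mulVec (Function.update v (i, b) z (j, 1))) =
        ∏ j ∈ Finset.univ.erase i, (v (j, 0) ⬝ᵥ A.mulVec (v (j, 1))) := by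
      intro z
      refine Finset.prod_congr rfl fun j hj => ?_
      have hj := Finset.ne_of_mem_erase hj
      rw [Function.update_of_ne (by simp [hj]), Function.update_of_ne (by simp [hj])]
    simp only [← Finset.mul_prod_erase _ _ (Finset.mem_univ i), h, smul_eq_mul, ← mul_assoc]
    congr 1
    fin_cases b
    · simp [Function.update_of_ne, smul_dotProduct]
    · simp [Function.update_of_ne, Matrix.mulVec_smul, dotProduct_smul]

/-- The Pfaffian of a matrix with rows and columns indexed by the pairs `(i, 0), (i, 1)`, without
the usual factor `1 / (2ᵐ m!)`. -/
def pfaffianSum (A : Matrix (Fin m × Fin 2) (Fin m × Fin 2) R) : R :=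
  ∑ σ : Equiv.Perm (Fin m × Fin 2), Equiv.Perm.sign σ • ∏ i, A (σ (i, 0)) (σ (i, 1))

/-- For a fixed `A`, both sides are alternating in the columns of `B`, so that they agree up to the
value at `B = 1`. -/
theorem pfaffianSum_transpose_mul_mul (A B : Matrix (Fin m × Fin 2) (Fin m × Fin 2) R) :
    pfaffianSum (B.transpose * A * B) = B.det * pfaffianSum A := by
  set f := MultilinearMap.alternatization (pairingProduct A)
  have hf : ∀ C : Matrix (Fin m × Fin 2) (Fin m × Fin 2) R,
      f (fun p => C.transpose p) = pfaffianSum (C.transpose * A * C) := by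
    intro C
    rw [MultilinearMap.alternatization_apply]
    refine Finset.sum_congr rfl fun σ _ => ?_
    have h : pairingProduct A (fun p => C.transpose (σ p)) =
        ∏ i, (C.transpose * A * C) (σ (i, 0)) (σ (i, 1)) := by
      change ∏ i, (C.transpose (σ (i, 0)) ⬝ᵥ A.mulVec (C.transpose (σ (i, 1)))) = _
      refine Finset.prod_congr rfl fun i _ => ?_
      rw [Matrix.mul_assoc, Matrix.mul_apply]
      rfl
    exact congrArg (Equiv.Perm.sign σ • ·) h
  have h1 := hf 1
  rw [Matrix.transpose_one, one_mul, mul_one] at h1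
  have h2 := DFunLike.congr_fun
    (AlternatingMap.eq_smul_basis_det (Pi.basisFun R (Fin m × Fin 2)) f) fun p => B.transpose p
  have h3 : (Pi.basisFun R (Fin m × Fin 2)).det (fun p => B.transpose p) = B.det := by
    rw [Pi.basisFun_det]
    exact Matrix.det_transpose B
  have h4 : f (Pi.basisFun R (Fin m × Fin 2)) = pfaffianSum A := by
    rw [← h1]
    congr 1
    ext p q
    rw [Pi.basisFun_apply, Matrix.one_apply, Pi.single_apply]
    simp only [eq_comm]
  rw [← hf B, h2, AlternatingMap.smul_apply, h3, h4, smul_eq_mul, mul_comm]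

theorem map_pfaffianSum {R' : Type} [CommRing R'] (f : R →+* R')
    (A : Matrix (Fin m × Fin 2) (Fin m × Fin 2) R) :
    f (pfaffianSum A) = pfaffianSum (A.map f) := by
  simp only [pfaffianSum, map_sum, Units.smul_def, map_zsmul, map_prod, Matrix.map_apply]

variable (m) in
/-- The standard symplectic form, with `(i, 0)` and `(i, 1)` paired. -/
def stdSymplectic : Matrix (Fin m × Fin 2) (Fin m × Fin 2) ℂ :=
  Matrix.of fun p q => if p.1 = q.1 then
    (((if p.2 = 0 ∧ q.2 = 1 then 1 else if p.2 = 1 ∧ q.2 = 0 then -1 else 0 : ℤ)) : ℂ) else 0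

/-- A nonzero term of the Pfaffian of the standard symplectic form comes from a permutation of the
pairs followed by exchanges inside the pairs, and equals `1`. -/
theorem stdSymplectic_term (σ : Equiv.Perm (Fin m × Fin 2)) :
    (Equiv.Perm.sign σ • ∏ i, stdSymplectic m (σ (i, 0)) (σ (i, 1)) = 0) ∨
      (Equiv.Perm.sign σ • ∏ i, stdSymplectic m (σ (i, 0)) (σ (i, 1)) = 1) := by
  by_cases h : ∀ i, (σ (i, 0)).1 = (σ (i, 1)).1
  · right
    have hfst : ∀ i b, (σ (i, b)).1 = (σ (i, 0)).1 := by
      intro i b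
      fin_cases b
      · rfl
      · exact (h i).symm
    have hsurj : Function.Surjective fun i => (σ (i, 0)).1 := by
      intro j
      refine ⟨(σ.symm (j, 0)).1, ?_⟩
      change (σ ((σ.symm (j, 0)).1, 0)).1 = j
      rw [← hfst _ (σ.symm (j, 0)).2, Prod.mk.eta, Equiv.apply_symm_apply]
    let π : Equiv.Perm (Fin m) := Equiv.ofBijective _
      ⟨Finite.injective_iff_surjective.mpr hsurj, hsurj⟩
    have hinj : ∀ i, Function.Injective fun b => (σ (i, b)).2 := by
      intro i b b' hb
      have h1 : σ (i, b) = σ (i, b') := Prod.ext ((hfst i b).trans (hfst i b').symm) hb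
      exact congrArg Prod.snd (σ.injective h1)
    let τ : Fin m → Equiv.Perm (Fin 2) := fun i => Equiv.ofBijective _
      ⟨hinj i, Finite.injective_iff_surjective.mp (hinj i)⟩
    have hσ : σ = (Equiv.prodCongrLeft fun _ => π) * Equiv.prodCongrRight τ := by
      ext p : 1
      obtain ⟨i, b⟩ := p
      exact Prod.ext (hfst i b) rfl
    have hsign : Equiv.Perm.sign σ = ∏ i, Equiv.Perm.sign (τ i) := by
      rw [hσ, Equiv.Perm.sign_mul, Equiv.Perm.sign_prodCongrLeft, Equiv.Perm.sign_prodCongrRight,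
        Fin.prod_univ_two, Int.units_mul_self, one_mul]
    have hτ : ∀ t : Equiv.Perm (Fin 2), (if t 0 = 0 ∧ t 1 = 1 then 1 else
        if t 0 = 1 ∧ t 1 = 0 then -1 else 0 : ℤ) = (Equiv.Perm.sign t : ℤ) := by decide
    have hterm : ∀ i, stdSymplectic m (σ (i, 0)) (σ (i, 1)) =
        ((Equiv.Perm.sign (τ i) : ℤ) : ℂ) := by
      intro i
      rw [← hτ, stdSymplectic, Matrix.of_apply, if_pos (h i)]
      rfl
    rw [Finset.prod_congr rfl fun i _ => hterm i, hsign, Units.smul_def, zsmul_eq_mul,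
      ← Int.cast_prod, ← Int.cast_mul, ← Units.coe_prod, ← Units.val_mul, Int.units_mul_self]
    simp
  · left
    obtain ⟨i, hi⟩ := not_forall.mp h
    rw [Finset.prod_eq_zero (Finset.mem_univ i) (by rw [stdSymplectic, Matrix.of_apply, if_neg hi]),
      smul_zero]

/-- No cancellation occurs in the Pfaffian of the standard symplectic form: it counts the
permutations with a nonzero term. -/
theorem pfaffianSum_stdSymplectic_ne_zero : pfaffianSum (stdSymplectic m) ≠ 0 := by
  classical
  have h : pfaffianSum (stdSymplectic m) =
      ((Finset.univ.filter fun σ : Equiv.Perm (Fin m × Fin 2) =>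
        Equiv.Perm.sign σ • ∏ i, stdSymplectic m (σ (i, 0)) (σ (i, 1)) = 1).card : ℂ) := by
    rw [pfaffianSum, Finset.card_filter, Nat.cast_sum]
    refine Finset.sum_congr rfl fun σ _ => ?_
    rcases stdSymplectic_term σ with h | h <;> simp [h]
  rw [h, Nat.cast_ne_zero, Finset.card_ne_zero]
  refine ⟨1, Finset.mem_filter.mpr ⟨Finset.mem_univ _, ?_⟩⟩
  simp [stdSymplectic]

end Pfaffian

section SemiInvariants

variable {N n : ℕ} {L : Type} [LieRing L] [LieAlgebra ℂ L]
variable {ρ : L →ₗ⁅ℂ⁆ Matrix (Fin N) (Fin N) ℂ}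
variable {M : Type} [AddCommGroup M] [Module ℂ M] [LieRingModule L M] [LieModule ℂ L M]

theorem lie_sym_one (x : L) : ⁅x, (1 : SymmetricAlgebra ℂ M)⁆ = 0 := by
  rw [lie_sym, Derivation.map_one_eq_zero]

theorem weightEval_add (β γ : Fin n → ℤ) (X : gl N) :
    weightEval (β + γ) X = weightEval β X + weightEval γ X := by
  unfold weightEval
  rw [← Finset.sum_add_distrib]
  refine Finset.sum_congr rfl fun j _ => ?_
  split_ifs
  · rw [Pi.add_apply, Int.cast_add, add_mul]
  · rw [add_zero]

theorem weightEval_zero (X : gl N) : weightEval (0 : Fin n → ℤ) X = 0 := by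
  simp [weightEval]

theorem one_mem_weightSpace : (1 : SymmetricAlgebra ℂ M) ∈
    weightSpace ρ (SymmetricAlgebra ℂ M) (0 : Fin n → ℤ) :=
  mem_weightSpace.mpr fun x _ => by rw [lie_sym_one, weightEval_zero, zero_smul]

theorem one_mem_hwSpace : (1 : SymmetricAlgebra ℂ M) ∈
    hwSpace ρ (SymmetricAlgebra ℂ M) (0 : Fin n → ℤ) :=
  ⟨one_mem_weightSpace, fun x _ => lie_sym_one x⟩

theorem mul_mem_weightSpace {β γ : Fin n → ℤ} {f g : SymmetricAlgebra ℂ M}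
    (hf : f ∈ weightSpace ρ (SymmetricAlgebra ℂ M) β)
    (hg : g ∈ weightSpace ρ (SymmetricAlgebra ℂ M) γ) :
    f * g ∈ weightSpace ρ (SymmetricAlgebra ℂ M) (β + γ) :=
  mem_weightSpace.mpr fun x hx => by
    rw [sym_leibniz, mem_weightSpace.mp hf x hx, mem_weightSpace.mp hg x hx, weightEval_add,
      mul_smul_comm, mul_smul_comm, mul_comm g, ← add_smul, add_comm]

theorem mul_mem_hwSpace {β γ : Fin n → ℤ} {f g : SymmetricAlgebra ℂ M}
    (hf : f ∈ hwSpace ρ (SymmetricAlgebra ℂ M) β) (hg : g ∈ hwSpace ρ (SymmetricAlgebra ℂ M) γ) :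
    f * g ∈ hwSpace ρ (SymmetricAlgebra ℂ M) (β + γ) :=
  ⟨mul_mem_weightSpace hf.1 hg.1, fun x hx => by
    rw [sym_leibniz, hf.2 x hx, hg.2 x hx, mul_zero, mul_zero, add_zero]⟩

/-- The action of `x` is the infinitesimal part of an algebra homomorphism `f ↦ f + ε (x f)` to the
dual numbers. Since it commutes with determinants and Pfaffians, it reduces the action on these to
their behaviour under the matrix `1 + ε Y`. -/
theorem symDualHom_eq (x : L) (f : SymmetricAlgebra ℂ M) :
    symDualHom (LieModule.toEnd ℂ L M x) f =
      TrivSqZeroExt.inl f + DualNumber.eps * TrivSqZeroExt.inl ⁅x, f⁆ := by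
  apply TrivSqZeroExt.ext
  · simp [symDualHom_fst]
  · have : (symDualHom (LieModule.toEnd ℂ L M x) f).snd = ⁅x, f⁆ := rfl
    simp [this]

section Matrices

variable {ι : Type} [Fintype ι] [DecidableEq ι]

/-- If `1 + ε x` multiplies `f` by `1 + ε c`, then `f` is an eigenvector of `x` with eigenvalue
`c`. -/
theorem lie_eq_smul_of_symDualHom {x : L} {f : SymmetricAlgebra ℂ M} {c : ℂ}
    (h : symDualHom (LieModule.toEnd ℂ L M x) f =
      (1 + algebraMap ℂ (DualNumber (SymmetricAlgebra ℂ M)) c * DualNumber.eps) *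
        TrivSqZeroExt.inl f) : ⁅x, f⁆ = c • f := by
  rw [symDualHom_eq] at h
  have := congrArg TrivSqZeroExt.snd h
  simpa [Algebra.smul_def, TrivSqZeroExt.algebraMap_eq_inl'] using this

theorem det_one_add_eps (Y : Matrix ι ι ℂ) :
    (1 + (DualNumber.eps : DualNumber (SymmetricAlgebra ℂ M)) •
      Y.map (algebraMap ℂ (DualNumber (SymmetricAlgebra ℂ M)))).det =
      1 + algebraMap ℂ (DualNumber (SymmetricAlgebra ℂ M)) Y.trace * DualNumber.eps := by
  rw [Matrix.det_one_add_smul, sq, DualNumber.eps_mul_eps, mul_zero, add_zero]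
  simp [Matrix.trace]

/-- If a Lie algebra element acts on the rows of a matrix by `Y`, the determinant is an
eigenvector with eigenvalue the trace of `Y`. -/
theorem lie_det_of_left {x : L} {A : Matrix ι ι (SymmetricAlgebra ℂ M)} {Y : Matrix ι ι ℂ}
    (h : ∀ a b, ⁅x, A a b⁆ = ∑ c, Y c a • A c b) : ⁅x, A.det⁆ = Y.trace • A.det := by
  set R := DualNumber (SymmetricAlgebra ℂ M)
  set ε : R := DualNumber.eps
  set Y' := Y.map (algebraMap ℂ R)
  let j : SymmetricAlgebra ℂ M →ₐ[ℂ] R := TrivSqZeroExt.inlAlgHom ℂ _ _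
  have hA : A.map (symDualHom (LieModule.toEnd ℂ L M x)) =
      (1 + ε • Y').transpose * A.map j := by
    ext1 a b
    rw [Matrix.map_apply, symDualHom_eq, h, Matrix.transpose_add, Matrix.transpose_one, add_mul,
      one_mul, Matrix.add_apply, Matrix.map_apply, Matrix.transpose_smul, Matrix.smul_mul,
      Matrix.smul_apply, Matrix.mul_apply, smul_eq_mul]
    change j _ + ε * j _ = _
    rw [map_sum]
    simp [Y', Algebra.smul_def]
  apply lie_eq_smul_of_symDualHom
  rw [AlgHom.map_det, AlgHom.mapMatrix_apply, hA, Matrix.det_mul, Matrix.det_transpose,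
    det_one_add_eps]
  congr 1
  exact (AlgHom.map_det j A).symm

/-- If `x` acts on the rows and on the columns of `A` by `Y`, then `1 + ε x` maps `A` to
`(1 + ε Y)ᵀ A (1 + ε Y)`. -/
theorem map_symDualHom_eq {x : L} {A : Matrix ι ι (SymmetricAlgebra ℂ M)} {Y : Matrix ι ι ℂ}
    (h : ∀ a b, ⁅x, A a b⁆ = ∑ c, Y c a • A c b + ∑ c, Y c b • A a c) :
    A.map (symDualHom (LieModule.toEnd ℂ L M x)) =
      (1 + (DualNumber.eps : DualNumber (SymmetricAlgebra ℂ M)) •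
        Y.map (algebraMap ℂ (DualNumber (SymmetricAlgebra ℂ M)))).transpose *
      A.map (TrivSqZeroExt.inlAlgHom ℂ (SymmetricAlgebra ℂ M) (SymmetricAlgebra ℂ M)) *
      (1 + (DualNumber.eps : DualNumber (SymmetricAlgebra ℂ M)) •
        Y.map (algebraMap ℂ (DualNumber (SymmetricAlgebra ℂ M)))) := by
  set R := DualNumber (SymmetricAlgebra ℂ M)
  set ε : R := DualNumber.eps with hε
  set Y' := Y.map (algebraMap ℂ R)
  set j : SymmetricAlgebra ℂ M →ₐ[ℂ] R := TrivSqZeroExt.inlAlgHom ℂ _ _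
  have h2 : (1 + ε • Y').transpose * A.map j * (1 + ε • Y') =
      A.map j + ε • (Y'.transpose * A.map j) + ε • (A.map j * Y') := by
    rw [Matrix.transpose_add, Matrix.transpose_one, Matrix.transpose_smul]
    have h0 : ε * ε = 0 := DualNumber.eps_mul_eps
    simp only [add_mul, mul_add, one_mul, mul_one, Matrix.mul_smul, Matrix.smul_mul, smul_smul,
      h0, zero_smul, add_zero]
  rw [h2]
  ext1 a b
  rw [Matrix.map_apply, symDualHom_eq, h, Matrix.add_apply, Matrix.add_apply, Matrix.map_apply,
    Matrix.smul_apply, Matrix.smul_apply, Matrix.mul_apply, Matrix.mul_apply, smul_eq_mul,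
    smul_eq_mul]
  change j _ + ε * j _ = _
  rw [map_add, map_sum, map_sum, mul_add, ← add_assoc]
  simp [Y', Algebra.smul_def, mul_comm]

/-- If a Lie algebra element acts on the rows and on the columns of a matrix by `Y`, the
determinant is an eigenvector with eigenvalue twice the trace of `Y`. -/
theorem lie_det {x : L} {A : Matrix ι ι (SymmetricAlgebra ℂ M)} {Y : Matrix ι ι ℂ}
    (h : ∀ a b, ⁅x, A a b⁆ = ∑ c, Y c a • A c b + ∑ c, Y c b • A a c) :
    ⁅x, A.det⁆ = (2 * Y.trace) • A.det := by
  apply lie_eq_smul_of_symDualHom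
  rw [AlgHom.map_det, AlgHom.mapMatrix_apply, map_symDualHom_eq h, Matrix.det_mul, Matrix.det_mul,
    Matrix.det_transpose, det_one_add_eps]
  set j := TrivSqZeroExt.inlAlgHom ℂ (SymmetricAlgebra ℂ M) (SymmetricAlgebra ℂ M)
  have hj : (A.map j).det = TrivSqZeroExt.inl A.det := (AlgHom.map_det j A).symm
  rw [hj, map_mul, map_ofNat]
  set ε : DualNumber (SymmetricAlgebra ℂ M) := DualNumber.eps with hε
  have h0 : ε * ε = 0 := DualNumber.eps_mul_eps
  set c := algebraMap ℂ (DualNumber (SymmetricAlgebra ℂ M)) Y.trace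
  linear_combination (c * c * TrivSqZeroExt.inl A.det) * h0

end Matrices

/-- If a Lie algebra element acts on the rows and on the columns of a matrix by `Y`, the Pfaffian
is an eigenvector with eigenvalue the trace of `Y`. -/
theorem lie_pfaffianSum {m : ℕ} {x : L}
    {A : Matrix (Fin m × Fin 2) (Fin m × Fin 2) (SymmetricAlgebra ℂ M)}
    {Y : Matrix (Fin m × Fin 2) (Fin m × Fin 2) ℂ}
    (h : ∀ a b, ⁅x, A a b⁆ = ∑ c, Y c a • A c b + ∑ c, Y c b • A a c) :
    ⁅x, pfaffianSum A⁆ = Y.trace • pfaffianSum A := by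
  apply lie_eq_smul_of_symDualHom
  have h1 := map_pfaffianSum (symDualHom (LieModule.toEnd ℂ L M x)).toRingHom A
  have h2 := map_pfaffianSum
    (TrivSqZeroExt.inlAlgHom ℂ (SymmetricAlgebra ℂ M) (SymmetricAlgebra ℂ M)).toRingHom A
  refine h1.trans ?_
  refine (congrArg pfaffianSum (map_symDualHom_eq h)).trans ?_
  rw [pfaffianSum_transpose_mul_mul, det_one_add_eps]
  congr 1
  exact h2.symm

theorem prod_mem_range_ι_pow {κ : Type} (t : Finset κ) (f : κ → SymmetricAlgebra ℂ M)
    (hf : ∀ i ∈ t, f i ∈ LinearMap.range (SymmetricAlgebra.ι ℂ M)) :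
    ∏ i ∈ t, f i ∈ LinearMap.range (SymmetricAlgebra.ι ℂ M) ^ t.card := by
  classical
  induction t using Finset.induction_on with
  | empty => simp
  | insert a t ha ih =>
    rw [Finset.prod_insert ha, Finset.card_insert_of_notMem ha, pow_succ']
    exact Submodule.mul_mem_mul (hf a (Finset.mem_insert_self a t))
      (ih fun i hi => hf i (Finset.mem_insert_of_mem hi))

end SemiInvariants

/-! ### The triangular structure of `𝔤𝔩_N` -/

section GeneralLinear

variable {N : ℕ}

/-- The powers of a transcendental number, here a Liouville number, are linearly independent over
the integers. -/
theorem exists_injective_powers : ∃ x : ℂ, ∀ n : ℕ,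
    Function.Injective fun β : Fin n → ℤ => ∑ i, (β i : ℂ) * x ^ (i : ℕ) := by
  have h1 : Transcendental ℤ ((liouvilleNumber 2 : ℝ) : ℂ) :=
    (transcendental_algebraMap_iff (R := ℤ) (A := ℂ) (S := ℝ) Complex.ofReal_injective).mpr
      (transcendental_liouvilleNumber le_rfl)
  refine ⟨((liouvilleNumber 2 : ℝ) : ℂ), fun n β γ h => ?_⟩
  set x : ℂ := ((liouvilleNumber 2 : ℝ) : ℂ)
  let p : Polynomial ℤ := ∑ i : Fin n, Polynomial.monomial (i : ℕ) (β i - γ i)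
  have hp : Polynomial.aeval x p = 0 := by
    simp only [p, map_sum, Polynomial.aeval_monomial]
    simp only [eq_intCast, Int.cast_sub, sub_mul, Finset.sum_sub_distrib]
    exact sub_eq_zero.mpr h
  have hp0 : p = 0 := (transcendental_iff.mp h1) p hp
  funext i
  have h2 : p.coeff (i : ℕ) = β i - γ i := by
    simp only [p, Polynomial.finsetSum_coeff, Polynomial.coeff_monomial]
    rw [Finset.sum_eq_single i]
    · simp
    · intro j _ hj
      exact if_neg fun h => hj (Fin.ext h)
    · simp
  rw [hp0, Polynomial.coeff_zero] at h2
  exact sub_eq_zero.mp h2.symm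

/-- A complex number whose powers are linearly independent over the integers. -/
def separatingNumber : ℂ := exists_injective_powers.choose

theorem separatingNumber_spec (n : ℕ) : Function.Injective
    fun β : Fin n → ℤ => ∑ i, (β i : ℂ) * separatingNumber ^ (i : ℕ) :=
  exists_injective_powers.choose_spec n

theorem weightEval_self (β : Fin N → ℤ) (X : gl N) :
    weightEval β X = ∑ i, (β i : ℂ) * X i i := by
  unfold weightEval
  refine Finset.sum_congr rfl fun i _ => ?_
  rw [dif_pos i.2]

variable (N) in
/-- The standard triangular structure of `𝔤𝔩_N`. -/
def glTriangular : TriangularData (LieHom.id : gl N →ₗ⁅ℂ⁆ gl N) N where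
  injective := Function.injective_id
  exists_diagPart x d := ⟨_, rfl⟩
  h := Matrix.diagonal fun i : Fin N => (N : ℂ) - 1 - 2 * (i : ℕ)
  map_h := rfl
  t := Matrix.diagonal fun i : Fin N => separatingNumber ^ (i : ℕ)
  isDiag_t := Matrix.isDiag_diagonal _
  weightEval_t_injective := by
    intro β γ h
    apply separatingNumber_spec N
    simpa [weightEval_self] using h

end GeneralLinear

/-! ### Weights and highest weight vectors of the symmetric algebra of `FormSpace N s` -/

section FormWeights

variable {N : ℕ} {s : ℤˣ}

/-- The inclusion of `𝔤𝔩_N` in matrices. -/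
abbrev glId (N : ℕ) : gl N →ₗ⁅ℂ⁆ gl N := LieHom.id

theorem lie_formVar_of_isDiag {X : gl N} (hX : X.IsDiag) (a b : Fin N) :
    ⁅X, formVar s a b⁆ = (X a a + X b b) • formVar s a b := by
  rw [lie_formVar, add_smul]
  congr 1
  · exact Finset.sum_eq_single a (fun c _ hc => by rw [hX hc, zero_smul]) (by simp)
  · exact Finset.sum_eq_single b (fun c _ hc => by rw [hX hc, zero_smul]) (by simp)

theorem formVar_mem_weightSpace (a b : Fin N) : formVar s a b ∈
    weightSpace (glId N) (SymmetricAlgebra ℂ (FormSpace N s))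
      (Pi.single a 1 + Pi.single b 1 : Fin N → ℤ) := by
  refine mem_weightSpace.mpr fun X hX => ?_
  change ⁅X, formVar s a b⁆ = weightEval _ X • formVar s a b
  rw [lie_formVar_of_isDiag (show X.IsDiag from hX), weightEval_add, weightEval_self,
    weightEval_self]
  simp [Pi.single_apply]

theorem iSup_weightSpace_sym : ⨆ β : Fin N → ℤ,
    weightSpace (glId N) (SymmetricAlgebra ℂ (FormSpace N s)) β = ⊤ := by
  rw [eq_top_iff]
  rintro f -
  set W := ⨆ β : Fin N → ℤ, weightSpace (glId N) (SymmetricAlgebra ℂ (FormSpace N s)) β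
  induction f using SymmetricAlgebra.induction with
  | algebraMap r =>
    rw [Algebra.algebraMap_eq_smul_one]
    exact W.smul_mem _ (Submodule.mem_iSup_of_mem 0 one_mem_weightSpace)
  | ι A =>
    rw [ι_eq_sum_formVar]
    exact W.sum_mem fun a _ => W.sum_mem fun b _ => W.smul_mem _
      (Submodule.mem_iSup_of_mem _ (formVar_mem_weightSpace a b))
  | add f g hf hg => exact add_mem hf hg
  | mul f g hf hg =>
    refine Submodule.iSup_induction _ (motive := fun f => f * g ∈ W) hf ?_ ?_ ?_
    · intro β f hf
      refine Submodule.iSup_induction _ (motive := fun g => f * g ∈ W) hg ?_ ?_ ?_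
      · intro γ g hg
        exact Submodule.mem_iSup_of_mem _ (mul_mem_weightSpace hf hg)
      · rw [mul_zero]; exact zero_mem _
      · intro g g' hg hg'
        rw [mul_add]; exact add_mem hg hg'
    · rw [zero_mul]; exact zero_mem _
    · intro f f' hf hf'
      rw [add_mul]; exact add_mem hf hf'

section Blocks

variable {ι : Type} [Fintype ι] [DecidableEq ι] {κ : ι → Fin N} {c : ℕ}

theorem sum_eq_sum_block {V : Type} [AddCommMonoid V] (hκ : Function.Injective κ)
    (hc : ∀ i, i ∈ Set.range κ ↔ (i : ℕ) < c) (f : Fin N → V)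
    (hf : ∀ i : Fin N, c ≤ (i : ℕ) → f i = 0) : ∑ i, f i = ∑ a, f (κ a) :=
  (Fintype.sum_of_injective κ hκ _ _
    (fun i hi => hf i (not_lt.mp fun h => hi ((hc i).mpr h))) fun _ => rfl).symm

/-- An upper triangular matrix preserves the span of the first `c` basis vectors, so it acts on the
variables of the leading block by its own leading block. -/
theorem lie_formVar_block (hκ : Function.Injective κ)
    (hc : ∀ i, i ∈ Set.range κ ↔ (i : ℕ) < c) {X : gl N} (hX : ∀ i j, j < i → X i j = 0) (a b : ι) :
    ⁅X, formVar s (κ a) (κ b)⁆ = ∑ d, X.submatrix κ κ d a • formVar s (κ d) (κ b) +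
      ∑ d, X.submatrix κ κ d b • formVar s (κ a) (κ d) := by
  have hlt : ∀ (i : Fin N) (a : ι), c ≤ (i : ℕ) → X i (κ a) = 0 := fun i a hi =>
    hX _ _ (Fin.lt_def.mpr (((hc (κ a)).mp ⟨a, rfl⟩).trans_le hi))
  rw [lie_formVar]
  congr 1
  · exact sum_eq_sum_block hκ hc _ fun i hi => by rw [hlt i a hi, zero_smul]
  · exact sum_eq_sum_block hκ hc _ fun i hi => by rw [hlt i b hi, zero_smul]

/-- A vector on which the upper triangular matrices act by `r` times the trace of their leading
block of size `c` is a highest weight vector of weight `r (ε₁ + ⋯ + ε_c)`. -/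
theorem mem_hwSpace_of_trace {M : Type} [AddCommGroup M] [Module ℂ M] [LieRingModule (gl N) M]
    [LieModule ℂ (gl N) M] (hκ : Function.Injective κ)
    (hc : ∀ i, i ∈ Set.range κ ↔ (i : ℕ) < c) {f : M} {r : ℕ}
    (hf : ∀ X : gl N, (∀ i j, j < i → X i j = 0) →
      ⁅X, f⁆ = ((r : ℂ) * (X.submatrix κ κ).trace) • f) :
    f ∈ hwSpace (glId N) M (fun i : Fin N => if (i : ℕ) < c then (r : ℤ) else 0) := by
  refine ⟨mem_weightSpace.mpr fun X hX => ?_, fun X hX => ?_⟩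
  · rw [hf X fun i j hij => hX hij.ne']
    congr 1
    rw [weightEval_self, sum_eq_sum_block hκ hc, Matrix.trace, Finset.mul_sum]
    · refine Finset.sum_congr rfl fun a _ => ?_
      rw [if_pos ((hc (κ a)).mp ⟨a, rfl⟩)]
      simp
    · intro i hi
      rw [if_neg (not_lt.mpr hi)]
      simp
  · have h0 : (X.submatrix κ κ).trace = 0 := Finset.sum_eq_zero fun a _ => hX (κ a) (κ a) le_rfl
    rw [hf X fun i j hij => hX i j hij.le, h0, mul_zero, zero_smul]

end Blocks

theorem formVar_mem_range (a b : Fin N) :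
    formVar s a b ∈ LinearMap.range (SymmetricAlgebra.ι ℂ (FormSpace N s)) := ⟨_, rfl⟩

/-- The leading principal minor of size `c` of a generic symmetric matrix is a highest weight vector
of weight `2 (ε₁ + ⋯ + ε_c)`. -/
theorem exists_hwVector_sym {c : ℕ} (hc : c ≤ N) : ∃ f : SymmetricAlgebra ℂ (FormSpace N 1),
    f ≠ 0 ∧ f ∈ LinearMap.range (SymmetricAlgebra.ι ℂ (FormSpace N 1)) ^ c ∧
    f ∈ hwSpace (glId N) (SymmetricAlgebra ℂ (FormSpace N 1))
      (fun i : Fin N => if (i : ℕ) < c then ((2 : ℕ) : ℤ) else 0) := by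
  let κ : Fin c → Fin N := Fin.castLE hc
  let A : Matrix (Fin c) (Fin c) (SymmetricAlgebra ℂ (FormSpace N 1)) :=
    Matrix.of fun a b => formVar 1 (κ a) (κ b)
  have hκ : Function.Injective κ := Fin.castLE_injective hc
  have hκc : ∀ i, i ∈ Set.range κ ↔ (i : ℕ) < c := fun i =>
    ⟨by rintro ⟨a, rfl⟩; exact a.2, fun h => ⟨⟨i, h⟩, rfl⟩⟩
  refine ⟨A.det, fun h0 => ?_, ?_, ?_⟩
  -- The minor does not vanish at the form given by the identity matrix.
  · let ev : SymmetricAlgebra ℂ (FormSpace N 1) →ₐ[ℂ] ℂ := SymmetricAlgebra.lift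
      ((Matrix.traceLinearMap (Fin N) ℂ ℂ).comp (formIncl N 1))
    have hA : ev.mapMatrix A = (2 : ℂ) • (1 : Matrix (Fin c) (Fin c) ℂ) := by
      ext a b
      change ev (SymmetricAlgebra.ι ℂ _ _) = _
      rw [SymmetricAlgebra.lift_ι_apply, LinearMap.comp_apply, formIncl_formProj,
        Matrix.traceLinearMap_apply, Matrix.transpose_single, Matrix.smul_apply, Matrix.one_apply]
      by_cases hab : a = b
      · subst hab
        simp [one_add_one_eq_two]
      · have : κ a ≠ κ b := fun h => hab (hκ h)
        simp [hab, Matrix.trace_single_eq_of_ne _ _ _ this,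
          Matrix.trace_single_eq_of_ne _ _ _ this.symm]
    have h1 : ev A.det = 0 := by rw [h0, map_zero]
    rw [AlgHom.map_det, hA, Matrix.det_smul, Matrix.det_one] at h1
    simp at h1
  · rw [Matrix.det_apply]
    refine Submodule.sum_mem _ fun σ _ => ?_
    rw [Units.smul_def]
    refine zsmul_mem ?_ _
    have := prod_mem_range_ι_pow Finset.univ (fun i => A (σ i) i)
      fun i _ => formVar_mem_range (s := 1) (κ (σ i)) (κ i)
    rwa [Finset.card_univ, Fintype.card_fin] at this
  · refine mem_hwSpace_of_trace hκ hκc fun X hX => ?_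
    exact_mod_cast lie_det fun a b => lie_formVar_block hκ hκc hX a b

/-- The leading principal Pfaffian of size `2 m` of a generic alternating matrix is a highest weight
vector of weight `ε₁ + ⋯ + ε_{2m}`. -/
theorem exists_hwVector_skew {m : ℕ} (hm : 2 * m ≤ N) :
    ∃ f : SymmetricAlgebra ℂ (FormSpace N (-1)),
    f ≠ 0 ∧ f ∈ LinearMap.range (SymmetricAlgebra.ι ℂ (FormSpace N (-1))) ^ m ∧
    f ∈ hwSpace (glId N) (SymmetricAlgebra ℂ (FormSpace N (-1)))
      (fun i : Fin N => if (i : ℕ) < 2 * m then ((1 : ℕ) : ℤ) else 0) := by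
  let κ : Fin m × Fin 2 → Fin N := fun p => ⟨2 * p.1 + p.2, by omega⟩
  let A : Matrix (Fin m × Fin 2) (Fin m × Fin 2) (SymmetricAlgebra ℂ (FormSpace N (-1))) :=
    Matrix.of fun a b => formVar (-1) (κ a) (κ b)
  have hκ : Function.Injective κ := by
    intro p q h
    have h1 : 2 * (p.1 : ℕ) + p.2 = 2 * q.1 + q.2 := congrArg Fin.val h
    refine Prod.ext (Fin.ext ?_) (Fin.ext ?_) <;> omega
  have hκc : ∀ i, i ∈ Set.range κ ↔ (i : ℕ) < 2 * m := fun i =>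
    ⟨by
      rintro ⟨p, rfl⟩
      change 2 * (p.1 : ℕ) + p.2 < 2 * m
      omega, fun h => ⟨(⟨i / 2, by omega⟩, ⟨i % 2, by omega⟩), Fin.ext (by
        change 2 * ((i : ℕ) / 2) + (i : ℕ) % 2 = i
        omega)⟩⟩
  refine ⟨pfaffianSum A, fun h0 => ?_, ?_, ?_⟩
  -- The Pfaffian does not vanish at the standard symplectic form.
  · let ℓ : FormSpace N (-1) →ₗ[ℂ] ℂ :=
      { toFun := fun B => ∑ i : Fin m, formIncl N (-1) B (κ (i, 0)) (κ (i, 1))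
        map_add' := fun B C => by
          simp only [map_add, Matrix.add_apply, Finset.sum_add_distrib]
        map_smul' := fun z B => by
          simp only [map_smul, Matrix.smul_apply, Finset.smul_sum, RingHom.id_apply] }
    let ev : SymmetricAlgebra ℂ (FormSpace N (-1)) →ₐ[ℂ] ℂ := SymmetricAlgebra.lift ℓ
    have hA : A.map ev = stdSymplectic m := by
      ext p q
      change ev (SymmetricAlgebra.ι ℂ _ _) = _
      rw [SymmetricAlgebra.lift_ι_apply]
      change ∑ i : Fin m, formIncl N (-1) (formProj (-1) (Matrix.single (κ p) (κ q) 1)) _ _ = _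
      obtain ⟨i, b⟩ := p
      obtain ⟨j, d⟩ := q
      have hsum : ∀ a : Fin m, formIncl N (-1)
          (formProj (-1) (Matrix.single (κ (i, b)) (κ (j, d)) 1)) (κ (a, 0)) (κ (a, 1)) =
          if a = i then stdSymplectic m (i, b) (j, d) else 0 := by
        intro a
        rw [formIncl_formProj, Matrix.transpose_single, Matrix.add_apply, Matrix.smul_apply,
          Matrix.single_apply, Matrix.single_apply]
        simp only [hκ.eq_iff, Prod.mk.injEq, stdSymplectic, Matrix.of_apply]
        by_cases hai : a = i
        · subst hai
          by_cases hij : a = j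
          · subst hij
            fin_cases b <;> fin_cases d <;> simp
          · simp [hij, Ne.symm hij]
        · simp [hai, Ne.symm hai]
      rw [Finset.sum_congr rfl fun a _ => hsum a, Finset.sum_ite_eq', if_pos (Finset.mem_univ _)]
    have h1 : ev (pfaffianSum A) = 0 := by rw [h0, map_zero]
    have h2 := map_pfaffianSum ev.toRingHom A
    exact pfaffianSum_stdSymplectic_ne_zero (m := m) (by rw [← hA]; exact h2.symm.trans h1)
  · refine Submodule.sum_mem _ fun σ _ => ?_
    rw [Units.smul_def]
    refine zsmul_mem ?_ _
    have := prod_mem_range_ι_pow Finset.univ (fun i : Fin m => A (σ (i, 0)) (σ (i, 1)))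
      fun i _ => formVar_mem_range (s := -1) (κ (σ (i, 0))) (κ (σ (i, 1)))
    rwa [Finset.card_univ, Fintype.card_fin] at this
  · refine mem_hwSpace_of_trace hκ hκc fun X hX => ?_
    rw [Nat.cast_one, one_mul]
    exact lie_pfaffianSum fun a b => lie_formVar_block hκ hκc hX a b

/-- An induction principle for partitions: peeling off the first `r` columns, which have the same
length because `r` divides all the parts. The predicate `ok` restricts the lengths of the
columns. -/
theorem antitone_induction {n r : ℕ} (hr : 0 < r) {ok : ℕ → Prop} {Q : (Fin n → ℕ) → Prop}
    (h0 : Q 0) (hadd : ∀ μ ν, Q μ → Q ν → Q (μ + ν))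
    (hstep : ∀ c, 0 < c → c ≤ n → ok c → Q fun i => if (i : ℕ) < c then r else 0) :
    ∀ ν : Fin n → ℕ, Antitone ν → (∀ i, r ∣ ν i) →
      (∀ j, ok (Finset.univ.filter fun i => j < ν i).card) → Q ν := by
  suffices key : ∀ (k : ℕ) (ν : Fin n → ℕ), ∑ i, ν i = k → Antitone ν → (∀ i, r ∣ ν i) →
      (∀ j, ok (Finset.univ.filter fun i => j < ν i).card) → Q ν from fun ν => key _ ν rfl
  intro k
  induction k using Nat.strong_induction_on with
  | _ k ih =>
  intro ν hk hν hd hok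
  by_cases hz : ν = 0
  · rw [hz]; exact h0
  set c := (Finset.univ.filter fun i => 0 < ν i).card with hc
  have hpos : ∀ i : Fin n, 0 < ν i ↔ (i : ℕ) < c := by
    intro i
    constructor
    · intro hi
      have h1 : (Finset.Iic i).card ≤ c := Finset.card_le_card fun j hj =>
        Finset.mem_filter.mpr ⟨Finset.mem_univ _, hi.trans_le (hν (Finset.mem_Iic.mp hj))⟩
      rw [Fin.card_Iic] at h1
      omega
    · intro hi
      by_contra hn
      have h1 : c ≤ (Finset.Iio i).card := Finset.card_le_card fun j hj => by
        have h2 := (Finset.mem_filter.mp hj).2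
        rw [Finset.mem_Iio]
        by_contra h3
        have := hν (not_lt.mp h3)
        omega
      rw [Fin.card_Iio] at h1
      omega
  have hle : ∀ i : Fin n, (i : ℕ) < c → r ≤ ν i := fun i hi =>
    Nat.le_of_dvd ((hpos i).mpr hi) (hd i)
  have hc0 : 0 < c := by
    obtain ⟨i, hi⟩ := Function.ne_iff.mp hz
    have := (hpos i).mp (Nat.pos_of_ne_zero hi)
    omega
  have hcn : c ≤ n := by
    have := Finset.card_le_univ (Finset.univ.filter fun i => 0 < ν i)
    rwa [Fintype.card_fin] at this
  set step : Fin n → ℕ := fun i => if (i : ℕ) < c then r else 0 with hstep'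
  have hsplit : ν = (fun i => ν i - r) + step := by
    funext i
    simp only [Pi.add_apply, hstep']
    split_ifs with hi
    · have := hle i hi
      omega
    · have := (hpos i).not.mpr hi
      omega
  rw [hsplit]
  refine hadd _ _ (ih (∑ i, (ν i - r)) ?_ _ rfl ?_ ?_ ?_) (hstep c hc0 hcn (hok 0))
  · rw [← hk]
    refine Finset.sum_lt_sum (fun i _ => Nat.sub_le _ _) ⟨⟨0, by omega⟩, Finset.mem_univ _, ?_⟩
    have := hle ⟨0, by omega⟩ hc0
    omega
  · intro i j hij
    exact Nat.sub_le_sub_right (hν hij) r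
  · intro i
    exact Nat.dvd_sub (hd i) dvd_rfl
  · intro j
    have : (Finset.univ.filter fun i => j < ν i - r) =
        Finset.univ.filter fun i => j + r < ν i := by
      ext i
      simp only [Finset.mem_filter, Finset.mem_univ, true_and]
      omega
    rw [this]
    exact hok _

/-- The partitions of `2 k` that occur in the `k`-th symmetric power of `FormSpace N s`: those with
even rows for `s = 1` and those with even columns for `s = -1`. -/
def evenPartitions (N : ℕ) (s : ℤˣ) (k : ℕ) : Finset (Fin N → ℕ) :=
  if s = 1 then evenRows N (2 * k) else evenColumns N (2 * k)

/-- The highest weight vectors of the symmetric algebra of `FormSpace N s`: products of leading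
principal minors for `s = 1`, and of leading principal Pfaffians for `s = -1`. -/
theorem exists_hwVector_of_mem_evenPartitions {k : ℕ} {ν : Fin N → ℕ}
    (hν : ν ∈ evenPartitions N s k) : ∃ f : SymmetricAlgebra ℂ (FormSpace N s),
    f ≠ 0 ∧ f ∈ symPower ℂ (FormSpace N s) (gl N) k ∧
    f ∈ hwSpace (glId N) (SymmetricAlgebra ℂ (FormSpace N s)) (fun i => (ν i : ℤ)) := by
  let Q : (Fin N → ℕ) → Prop := fun ν => ∃ (k : ℕ) (f : SymmetricAlgebra ℂ (FormSpace N s)),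
    ∑ i, ν i = 2 * k ∧ f ≠ 0 ∧ f ∈ LinearMap.range (SymmetricAlgebra.ι ℂ (FormSpace N s)) ^ k ∧
    f ∈ hwSpace (glId N) (SymmetricAlgebra ℂ (FormSpace N s)) (fun i => (ν i : ℤ))
  have hQ0 : Q 0 := ⟨0, 1, by simp, one_ne_zero, by simp, one_mem_hwSpace⟩
  have : IsDomain (SymmetricAlgebra ℂ (FormSpace N s)) := inferInstance
  have hQadd : ∀ μ ν, Q μ → Q ν → Q (μ + ν) := by
    rintro μ ν ⟨k, f, hk, hf, hfk, hfw⟩ ⟨l, g, hl, hg, hgl, hgw⟩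
    refine ⟨k + l, f * g, ?_, mul_ne_zero hf hg, ?_, ?_⟩
    · simp only [Pi.add_apply, Finset.sum_add_distrib, hk, hl]; ring
    · rw [pow_add]; exact Submodule.mul_mem_mul hfk hgl
    · have := mul_mem_hwSpace hfw hgw
      convert this using 2
      funext i
      simp
  have hsum : ∀ (c r : ℕ), c ≤ N → ∑ i : Fin N, (if (i : ℕ) < c then r else 0) = r * c := by
    intro c r hc
    rw [Fin.sum_univ_eq_sum_range (fun i => if i < c then r else 0) N, ← Finset.sum_filter,
      Finset.sum_const, smul_eq_mul, mul_comm]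
    congr 1
    have : (Finset.range N).filter (· < c) = Finset.range c := by
      ext i
      simp only [Finset.mem_filter, Finset.mem_range]
      omega
    rw [this, Finset.card_range]
  have hQν : Q ν ∧ ∑ i, ν i = 2 * k := by
    unfold evenPartitions at hν
    split_ifs at hν with hs
    · subst hs
      simp only [evenRows, partitions, Finset.mem_filter, Finset.mem_piAntidiag] at hν
      refine ⟨antitone_induction two_pos (ok := fun _ => True) hQ0 hQadd (fun c _ hc _ => ?_) ν
        hν.1.2 (fun i => (hν.2 i).two_dvd) fun _ => trivial, hν.1.1.1⟩
      obtain ⟨f, h1, h2, h3⟩ := exists_hwVector_sym hc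
      refine ⟨c, f, hsum c 2 hc, h1, h2, ?_⟩
      convert h3 using 2
      funext i
      dsimp only
      split_ifs <;> rfl
    · have hs : s = -1 := (Int.units_eq_one_or s).resolve_left hs
      subst hs
      simp only [evenColumns, partitions, Finset.mem_filter, Finset.mem_piAntidiag] at hν
      refine ⟨antitone_induction one_pos (ok := Even) hQ0 hQadd (fun c _ hc hev => ?_) ν
        hν.1.2 (fun i => one_dvd _) hν.2, hν.1.1.1⟩
      obtain ⟨m, rfl⟩ := hev.two_dvd
      obtain ⟨f, h1, h2, h3⟩ := exists_hwVector_skew hc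
      refine ⟨m, f, by rw [hsum _ 1 hc, one_mul], h1, h2, ?_⟩
      convert h3 using 2
      funext i
      dsimp only
      split_ifs <;> rfl
  obtain ⟨⟨l, f, hl, h1, h2, h3⟩, hk⟩ := hQν
  have : l = k := by omega
  subst this
  exact ⟨f, h1, h2, h3⟩

end FormWeights

/-! ### A leading term argument for polynomials killed by derivations -/

section LeadingTerm

open MvPolynomial

variable {σ : Type} [Fintype σ]

theorem derivation_eq_sum_pderiv (D : Derivation ℂ (MvPolynomial σ ℂ) (MvPolynomial σ ℂ))
    (f : MvPolynomial σ ℂ) : D f = ∑ u, D (X u) * pderiv u f := by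
  classical
  induction f using MvPolynomial.induction_on with
  | C a => simp
  | add p q hp hq =>
    rw [map_add, hp, hq, ← Finset.sum_add_distrib]
    exact Finset.sum_congr rfl fun u _ => by rw [map_add, mul_add]
  | mul_X p v hp =>
    rw [Derivation.leibniz, hp, smul_eq_mul, smul_eq_mul]
    have h : ∀ u, D (X u) * pderiv u (p * X v) =
        (if v = u then p * D (X v) else 0) + X v * (D (X u) * pderiv u p) := by
      intro u
      rw [Derivation.leibniz, pderiv_X, smul_eq_mul, smul_eq_mul, Pi.single_apply]
      by_cases h : v = u
      · subst h
        simp only [if_true]; ring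
      · simp only [if_neg h]; ring
    rw [Finset.sum_congr rfl fun u _ => h u, Finset.sum_add_distrib, Finset.sum_ite_eq,
      if_pos (Finset.mem_univ _), Finset.mul_sum]

/-- A derivation that scales the variables scales each monomial. -/
theorem coeff_derivation_of_diag {D : Derivation ℂ (MvPolynomial σ ℂ) (MvPolynomial σ ℂ)}
    {c : σ → ℂ} (hD : ∀ u, D (X u) = c u • X u) (f : MvPolynomial σ ℂ) (m : σ →₀ ℕ) :
    coeff m (D f) = (∑ u, (m u : ℂ) * c u) * coeff m f := by
  classical
  induction f using MvPolynomial.induction_on' with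
  | monomial m' a =>
    rw [derivation_eq_sum_pderiv]
    have h : ∀ u, D (X u) * pderiv u (monomial m' a) =
        ((m' u : ℂ) * c u) • monomial m' a := by
      intro u
      rw [hD, smul_mul_assoc, X_mul_pderiv_monomial, mul_comm, mul_smul]
      rw [Nat.cast_smul_eq_nsmul]
    rw [Finset.sum_congr rfl fun u _ => h u, ← Finset.sum_smul, coeff_smul, smul_eq_mul,
      coeff_monomial]
    split_ifs with hm
    · rw [hm]
    · simp
  | add p q hp hq => rw [map_add, coeff_add, coeff_add, hp, hq, mul_add]

/-- All the monomials of `f` have weighted degree at least `r`. -/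
def HasOrder (w : σ → ℕ) (r : ℕ) (f : MvPolynomial σ ℂ) : Prop :=
  ∀ m, coeff m f ≠ 0 → r ≤ Finsupp.weight w m

variable {w : σ → ℕ} {r q : ℕ} {f g : MvPolynomial σ ℂ}

theorem HasOrder.zero : HasOrder w r 0 := fun m hm => absurd (coeff_zero m) hm

theorem HasOrder.add (hf : HasOrder w r f) (hg : HasOrder w r g) : HasOrder w r (f + g) := by
  intro m hm
  by_cases h : coeff m f = 0
  · rw [coeff_add, h, zero_add] at hm
    exact hg m hm
  · exact hf m h

theorem HasOrder.smul (c : ℂ) (hf : HasOrder w r f) : HasOrder w r (c • f) := by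
  intro m hm
  rw [coeff_smul, smul_eq_mul] at hm
  exact hf m (right_ne_zero_of_mul hm)

theorem HasOrder.mul (hf : HasOrder w r f) (hg : HasOrder w q g) :
    HasOrder w (r + q) (f * g) := by
  classical
  intro m hm
  rw [coeff_mul] at hm
  obtain ⟨x, hx, h⟩ := Finset.exists_ne_zero_of_sum_ne_zero hm
  rw [← Finset.HasAntidiagonal.mem_antidiagonal.mp hx, map_add]
  exact add_le_add (hf _ (left_ne_zero_of_mul h)) (hg _ (right_ne_zero_of_mul h))

theorem HasOrder.pderiv (hf : HasOrder w r f) (u : σ) :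
    HasOrder w (r - w u) (pderiv u f) := by
  intro m hm
  rw [coeff_pderiv] at hm
  have := hf _ (left_ne_zero_of_mul hm)
  rw [map_add, Finsupp.weight_single, one_smul] at this
  omega

theorem hasOrder_X (u : σ) : HasOrder w (w u) (X u) := by
  classical
  intro m hm
  rw [MvPolynomial.coeff_X] at hm
  have : Finsupp.single u 1 = m := by
    by_contra h
    exact hm (if_neg h)
  rw [← this, Finsupp.weight_single, one_smul]

/-- A polynomial all of whose monomials involve a variable of weight `1` vanishes, if it is killed
by derivations which turn each variable of weight `1` into a variable of weight `0` and the other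
variables into combinations of variables of weight `1`: such a derivation lowers the weight of the
terms of least weight. -/
theorem eq_zero_of_derivations (hw : ∀ v, w v ≤ 1) (hg : HasOrder w 1 g)
    (hD : ∀ v, w v = 1 → ∃ D : Derivation ℂ (MvPolynomial σ ℂ) (MvPolynomial σ ℂ), D g = 0 ∧
      (∃ (c : ℂ) (d : σ), c ≠ 0 ∧ w d = 0 ∧ D (X v) = c • X d) ∧
      ∀ u, u ≠ v → HasOrder w 1 (D (X u))) : g = 0 := by
  classical
  by_contra hg0
  obtain ⟨m₀, hm₀, hmin⟩ := Finset.exists_min_image g.support (Finsupp.weight w)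
    (Finset.nonempty_of_ne_empty (by simpa using hg0))
  have hc0 : coeff m₀ g ≠ 0 := mem_support_iff.mp hm₀
  have hr := hg m₀ hc0
  have hgr : HasOrder w (Finsupp.weight w m₀) g := fun m hm => hmin m (mem_support_iff.mpr hm)
  obtain ⟨v, hv, hmv⟩ : ∃ v, w v = 1 ∧ m₀ v ≠ 0 := by
    by_contra! h
    have : Finsupp.weight w m₀ = 0 := by
      rw [Finsupp.weight_apply]
      refine Finset.sum_eq_zero fun v hv => ?_
      have h1 : w v ≠ 1 := fun h1 => Finsupp.mem_support_iff.mp hv (h v h1)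
      have h2 : w v = 0 := by have := hw v; omega
      dsimp only
      rw [h2, smul_zero]
    omega
  -- The monomial `m X_v` of least weight contributes `m X_d` to `D g`; nothing else does.
  obtain ⟨D, hDg, ⟨c, d, hc, hd, hDv⟩, hDu⟩ := hD v hv
  obtain ⟨m, rfl⟩ : ∃ m, m₀ = m + Finsupp.single v 1 :=
    ⟨m₀ - Finsupp.single v 1, (tsub_add_cancel_of_le (by
      rw [Finsupp.single_le_iff]; omega)).symm⟩
  have hwt : Finsupp.weight w (m + Finsupp.single v 1) = Finsupp.weight w m + 1 := by
    rw [map_add, Finsupp.weight_single, hv, one_smul]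
  have h1 : coeff (Finsupp.single d 1 + m) (D g) = 0 := by rw [hDg, coeff_zero]
  rw [derivation_eq_sum_pderiv, coeff_sum, Finset.sum_eq_single v] at h1
  · rw [hDv, smul_mul_assoc, coeff_smul, coeff_X_mul, coeff_pderiv, smul_eq_mul] at h1
    exact mul_ne_zero hc (mul_ne_zero hc0 (by norm_cast)) h1
  · intro u _ huv
    by_contra hne
    have h2 := ((hDu u huv).mul (hgr.pderiv u)) _ hne
    have := hw u
    have h3 : Finsupp.weight w (Finsupp.single d 1 + m) = Finsupp.weight w m := by
      rw [map_add, Finsupp.weight_single, hd, smul_zero, zero_add]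
    rw [h3, hwt] at h2
    omega
  · simp

end LeadingTerm

/-! ### Uniqueness of the highest weight vectors of the symmetric algebra of `FormSpace N s` -/

section FormUniqueness

open MvPolynomial

variable {N : ℕ} {s : ℤˣ}

variable (N s) in
/-- The positions of the independent entries of the matrices in `FormSpace N s`. -/
abbrev PairIndex : Type := {v : Fin N × Fin N // v.1 < v.2 ∨ (s = 1 ∧ v.1 = v.2)}

/-- The factor that makes `formVar s a b` dual to the entry `(a, b)`: the diagonal entries of
`E_aa + E_aaᵀ` are `2`. -/
def pairFactor (v : PairIndex N s) : ℂ := if v.1.1 = v.1.2 then 2⁻¹ else 1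

theorem pairFactor_ne_zero (v : PairIndex N s) : pairFactor v ≠ 0 := by
  unfold pairFactor
  split_ifs <;> norm_num

theorem formSpace_ext {A B : FormSpace N s}
    (h : ∀ v : PairIndex N s, formIncl N s A v.1.1 v.1.2 = formIncl N s B v.1.1 v.1.2) :
    A = B := by
  have hlt : ∀ i j, i < j → formIncl N s A i j = formIncl N s B i j := fun i j hij =>
    h ⟨(i, j), Or.inl hij⟩
  have htr : ∀ (A : FormSpace N s) i j,
      formIncl N s A j i = ((s : ℤ) : ℂ) * formIncl N s A i j := fun A i j =>
    congrFun (congrFun (transpose_formIncl A) i) j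
  apply formIncl_injective
  ext i j
  rcases lt_trichotomy i j with hij | rfl | hij
  · exact hlt i j hij
  · rcases Int.units_eq_one_or s with hs | hs
    · exact h ⟨(i, i), Or.inr ⟨hs, rfl⟩⟩
    · have h0 : ∀ A : FormSpace N s, formIncl N s A i i = 0 := fun A => by
        have := htr A i i
        have hs' : ((s : ℤ) : ℂ) = -1 := by rw [hs]; norm_num
        rw [hs'] at this
        linear_combination this / 2
      rw [h0, h0]
  · rw [htr A, htr B, hlt j i hij]

theorem pairFactor_mul_formIncl (u v : PairIndex N s) :
    pairFactor v * formIncl N s (formProj s (Matrix.single v.1.1 v.1.2 1)) u.1.1 u.1.2 =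
      if v = u then 1 else 0 := by
  obtain ⟨⟨a, b⟩, hv⟩ := v
  obtain ⟨⟨c, d⟩, hu⟩ := u
  simp only [pairFactor, formIncl_formProj, Matrix.transpose_single, Matrix.add_apply,
    Matrix.smul_apply, Matrix.single_apply, Subtype.mk.injEq, Prod.mk.injEq, smul_eq_mul] at *
  rcases hv with hv | ⟨hs, hv⟩
  · have h : ¬(b = c ∧ a = d) := by
      rintro ⟨rfl, rfl⟩
      rcases hu with hu | hu
      · exact absurd hu hv.asymm
      · exact hv.ne hu.2.symm
    rw [if_neg hv.ne, if_neg h, mul_zero, add_zero, one_mul]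
  · subst hs
    obtain rfl : a = b := hv
    rw [if_pos rfl]
    by_cases h : a = c ∧ a = d
    · rw [if_pos h]; norm_num
    · rw [if_neg h]; simp

variable (N s) in
/-- The isomorphism of the symmetric algebra of `FormSpace N s` with the polynomial ring in the
independent entries. -/
def symEquivPoly : SymmetricAlgebra ℂ (FormSpace N s) ≃ₐ[ℂ] MvPolynomial (PairIndex N s) ℂ :=
  AlgEquiv.ofAlgHom
    (SymmetricAlgebra.lift
      { toFun := fun A => ∑ v : PairIndex N s, formIncl N s A v.1.1 v.1.2 • X v
        map_add' := fun A B => by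
          simp only [map_add, Matrix.add_apply, add_smul, Finset.sum_add_distrib]
        map_smul' := fun c A => by
          simp only [map_smul, Matrix.smul_apply, smul_assoc, Finset.smul_sum, RingHom.id_apply] })
    (aeval fun v => pairFactor v • formVar s v.1.1 v.1.2)
    (by
      apply MvPolynomial.algHom_ext
      intro v
      rw [AlgHom.comp_apply, aeval_X, map_smul, formVar, SymmetricAlgebra.lift_ι_apply]
      change pairFactor v • ∑ u : PairIndex N s,
        formIncl N s (formProj s (Matrix.single v.1.1 v.1.2 1)) u.1.1 u.1.2 • X u = X v
      simp only [Finset.smul_sum, smul_smul, pairFactor_mul_formIncl, ite_smul, one_smul, zero_smul]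
      rw [Finset.sum_ite_eq, if_pos (Finset.mem_univ _)])
    (by
      apply SymmetricAlgebra.algHom_ext
      ext A
      change aeval _ (SymmetricAlgebra.lift _ (SymmetricAlgebra.ι ℂ _ A)) =
        SymmetricAlgebra.ι ℂ _ A
      rw [SymmetricAlgebra.lift_ι_apply]
      change aeval _ (∑ v : PairIndex N s, formIncl N s A v.1.1 v.1.2 • X v) = _
      simp only [map_sum, map_smul, aeval_X, formVar]
      simp only [← map_smul, ← map_sum]
      congr 1
      apply formSpace_ext
      intro u
      simp only [map_sum, map_smul, Matrix.sum_apply, Matrix.smul_apply, smul_eq_mul,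
        pairFactor_mul_formIncl]
      simp)

theorem symEquivPoly_symm_X (v : PairIndex N s) :
    (symEquivPoly N s).symm (X v) = pairFactor v • formVar s v.1.1 v.1.2 :=
  aeval_X _ v

theorem symEquivPoly_formVar (v : PairIndex N s) :
    symEquivPoly N s (formVar s v.1.1 v.1.2) = (pairFactor v)⁻¹ • X v := by
  rw [← AlgEquiv.apply_symm_apply (symEquivPoly N s) (X v), symEquivPoly_symm_X, map_smul,
    smul_smul, inv_mul_cancel₀ (pairFactor_ne_zero v), one_smul]

theorem formVar_cases (a b : Fin N) :
    (∃ (u : PairIndex N s) (c : ℂ), c ≠ 0 ∧ symEquivPoly N s (formVar s a b) = c • X u ∧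
      (u.1 = (a, b) ∨ u.1 = (b, a))) ∨
    (s ≠ 1 ∧ a = b ∧ symEquivPoly N s (formVar s a b) = 0) := by
  rcases lt_trichotomy a b with h | rfl | h
  · exact Or.inl ⟨⟨(a, b), Or.inl h⟩, _, inv_ne_zero (pairFactor_ne_zero _),
      symEquivPoly_formVar ⟨(a, b), Or.inl h⟩, Or.inl rfl⟩
  · by_cases hs : s = 1
    · exact Or.inl ⟨⟨(a, a), Or.inr ⟨hs, rfl⟩⟩, _, inv_ne_zero (pairFactor_ne_zero _),
        symEquivPoly_formVar ⟨(a, a), Or.inr ⟨hs, rfl⟩⟩, Or.inl rfl⟩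
    · refine Or.inr ⟨hs, rfl, ?_⟩
      have h1 := formVar_swap (s := s) a a
      rw [(Int.units_eq_one_or s).resolve_left hs] at h1
      push_cast at h1
      rw [(Int.units_eq_one_or s).resolve_left hs]
      have h2 : (2 : ℂ) • formVar (-1) a a = 0 := by
        rw [two_smul]
        nth_rewrite 1 [h1]
        rw [neg_smul, one_smul, neg_add_cancel]
      rw [(smul_eq_zero.mp h2).resolve_left two_ne_zero, map_zero]
  · let u : PairIndex N s := ⟨(b, a), Or.inl h⟩
    refine Or.inl ⟨u, ((s : ℤ) : ℂ) * (pairFactor u)⁻¹,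
      mul_ne_zero (by simp) (inv_ne_zero (pairFactor_ne_zero u)), ?_, Or.inr rfl⟩
    rw [formVar_swap, map_smul, mul_smul]
    congr 1
    exact symEquivPoly_formVar u

variable (s) in
/-- The action of a matrix on the polynomial ring in the independent entries. -/
def polyAction (Y : gl N) :
    Derivation ℂ (MvPolynomial (PairIndex N s) ℂ) (MvPolynomial (PairIndex N s) ℂ) :=
  mkDerivation ℂ fun u => symEquivPoly N s ⁅Y, (symEquivPoly N s).symm (X u)⁆

theorem symEquivPoly_lie (Y : gl N) (f : SymmetricAlgebra ℂ (FormSpace N s)) :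
    symEquivPoly N s ⁅Y, f⁆ = polyAction s Y (symEquivPoly N s f) := by
  obtain ⟨p, rfl⟩ := (symEquivPoly N s).symm.surjective f
  rw [AlgEquiv.apply_symm_apply]
  induction p using MvPolynomial.induction_on with
  | C a =>
    rw [← algebraMap_eq, AlgEquiv.commutes, Derivation.map_algebraMap, lie_sym,
      Derivation.map_algebraMap, map_zero]
  | add p q hp hq => rw [map_add, lie_add, map_add, map_add, hp, hq]
  | mul_X p u hp =>
    rw [map_mul, sym_leibniz, map_add, map_mul, map_mul, hp, Derivation.leibniz, smul_eq_mul,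
      smul_eq_mul, AlgEquiv.apply_symm_apply, AlgEquiv.apply_symm_apply, polyAction,
      mkDerivation_X]

theorem polyAction_single_X (p q : Fin N) (u : PairIndex N s) :
    polyAction s (Matrix.single p q 1) (X u) =
      pairFactor u • ((if u.1.1 = q then symEquivPoly N s (formVar s p u.1.2) else 0) +
        if u.1.2 = q then symEquivPoly N s (formVar s u.1.1 p) else 0) := by
  rw [polyAction, mkDerivation_X, symEquivPoly_symm_X, lie_smul, map_smul, lie_formVar, map_add]
  congr 2
  · rw [Finset.sum_eq_single p]
    · rw [Matrix.single_apply]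
      by_cases h : u.1.1 = q
      · rw [if_pos ⟨rfl, h.symm⟩, if_pos h, one_smul]
      · rw [if_neg fun h' => h h'.2.symm, if_neg h, zero_smul, map_zero]
    · intro c _ hc
      rw [Matrix.single_apply_of_row_ne hc.symm, zero_smul]
    · simp
  · rw [Finset.sum_eq_single p]
    · rw [Matrix.single_apply]
      by_cases h : u.1.2 = q
      · rw [if_pos ⟨rfl, h.symm⟩, if_pos h, one_smul]
      · rw [if_neg fun h' => h h'.2.symm, if_neg h, zero_smul, map_zero]
    · intro c _ hc
      rw [Matrix.single_apply_of_row_ne hc.symm, zero_smul]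
    · simp

variable (s) in
/-- The involution of the indices such that the forms supported on the places `(i, partner s i)`
meet the dense orbit of the upper triangular group: the identity in the symmetric case, and the
exchange of `2 i` and `2 i + 1` in the alternating case, where the last index is fixed if `N` is
odd. -/
def partner (i : Fin N) : Fin N :=
  if s = 1 then i else
    if (i : ℕ) % 2 = 0 then (if h : (i : ℕ) + 1 < N then ⟨i + 1, h⟩ else i)
    else ⟨i - 1, by omega⟩

theorem partner_partner (i : Fin N) : partner s (partner s i) = i := by
  by_cases hs : s = 1
  · simp [partner, hs]
  · unfold partner
    simp only [if_neg hs]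
    by_cases h1 : (i : ℕ) % 2 = 0
    · by_cases h2 : (i : ℕ) + 1 < N
      · have h3 : ¬((i : ℕ) + 1) % 2 = 0 := by omega
        simp [h1, h2, h3]
      · simp [h1, h2]
    · have h3 : ((i : ℕ) - 1) % 2 = 0 := by omega
      have h4 : (i : ℕ) - 1 + 1 = i := by omega
      simp [h1, h3, h4]

theorem partner_lt {a b : Fin N} (hab : a < b) (h : partner s a ≠ b) : partner s a < b := by
  unfold partner at *
  split_ifs at * with h1 h2 h3
  · exact hab
  · rw [Fin.lt_def] at *
    have : (a : ℕ) + 1 ≠ b := fun h' => h (Fin.ext h')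
    change (a : ℕ) + 1 < b
    omega
  · exact hab
  · rw [Fin.lt_def] at *
    change (a : ℕ) - 1 < b
    omega

theorem partner_ne {a b : Fin N} (hs : s ≠ 1) (hab : a < b) : a ≠ partner s a := by
  unfold partner
  rw [if_neg hs]
  rw [Fin.lt_def] at hab
  split_ifs with h2 h3
  · exact fun h => by have := congrArg Fin.val h; simp at this
  · omega
  · exact fun h => by have := congrArg Fin.val h; simp at this; omega

/-- The weight `1` for the entries outside the places `(i, partner s i)`. -/
def offWeight (v : PairIndex N s) : ℕ := if partner s v.1.1 = v.1.2 then 0 else 1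

theorem hasOrder_formVar {a b : Fin N} (h : partner s a ≠ b) :
    HasOrder offWeight 1 (symEquivPoly N s (formVar s a b)) := by
  have h' : partner s b ≠ a := fun h' => h (by rw [← h', partner_partner])
  rcases formVar_cases (s := s) a b with ⟨u, c, _, hu, hu' | hu'⟩ | ⟨_, _, h0⟩
  · rw [hu]
    have : offWeight u = 1 := by rw [offWeight, hu', if_neg h]
    exact this ▸ (hasOrder_X u).smul c
  · rw [hu]
    have : offWeight u = 1 := by rw [offWeight, hu', if_neg h']
    exact this ▸ (hasOrder_X u).smul c
  · rw [h0]
    exact HasOrder.zero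

theorem formVar_partner {a b : Fin N} (hab : a < b) : ∃ (c : ℂ) (d : PairIndex N s),
    c ≠ 0 ∧ offWeight d = 0 ∧ symEquivPoly N s (formVar s a (partner s a)) = c • X d := by
  rcases formVar_cases (s := s) a (partner s a) with ⟨u, c, hc, hu, hu' | hu'⟩ | ⟨hs, h, _⟩
  · exact ⟨c, u, hc, by rw [offWeight, hu', if_pos rfl], hu⟩
  · exact ⟨c, u, hc, by rw [offWeight, hu', if_pos (partner_partner a)], hu⟩
  · exact absurd h (partner_ne hs hab)

/-- A highest weight vector is zero if each of its monomials involves a variable outside the places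
`(i, partner s i)`. -/
theorem eq_zero_of_hasOrder {ν : Fin N → ℤ} {f : SymmetricAlgebra ℂ (FormSpace N s)}
    (hf : f ∈ hwSpace (glId N) (SymmetricAlgebra ℂ (FormSpace N s)) ν)
    (ho : HasOrder offWeight 1 (symEquivPoly N s f)) : f = 0 := by
  have hw : ∀ v : PairIndex N s, offWeight v ≤ 1 := fun v => by
    unfold offWeight
    split_ifs <;> omega
  refine (map_eq_zero_iff _ (symEquivPoly N s).injective).mp (eq_zero_of_derivations hw ho ?_)
  intro v hv
  obtain ⟨⟨a, b⟩, hvab⟩ := v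
  have hab : partner s a ≠ b := fun h => by simp [offWeight, h] at hv
  have hlt : a < b := by
    rcases hvab with h | ⟨hs, h⟩
    · exact h
    · exact absurd (by simpa [partner, hs] using h) hab
  -- This matrix unit is strictly upper triangular and turns the variable at `(a, b)` into the one
  -- at `(a, partner s a)`; no other variable is turned into one at a special place.
  refine ⟨polyAction s (Matrix.single (partner s a) b 1), ?_, ?_, fun u hu => ?_⟩
  · rw [← symEquivPoly_lie, hf.2, map_zero]
    intro i j hji
    change Matrix.single (partner s a) b (1 : ℂ) i j = 0
    rw [Matrix.single_apply, if_neg]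
    rintro ⟨rfl, rfl⟩
    exact absurd (partner_lt hlt hab) (not_lt.mpr hji)
  · obtain ⟨c, d, hc, hd, h⟩ := formVar_partner (s := s) hlt
    refine ⟨pairFactor ⟨(a, b), hvab⟩ * c, d, mul_ne_zero (pairFactor_ne_zero _) hc, hd, ?_⟩
    rw [polyAction_single_X, if_neg hlt.ne, if_pos rfl, zero_add, h, smul_smul]
  · rw [polyAction_single_X]
    refine ((?_ : HasOrder _ 1 _).add ?_).smul _
    · split_ifs with h
      · apply hasOrder_formVar
        rw [partner_partner]
        rintro h'
        have h1 : u.1.1 ≤ u.1.2 := u.2.elim le_of_lt fun h => h.2.le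
        rw [h, ← h'] at h1
        exact absurd hlt (not_lt.mpr h1)
      · exact HasOrder.zero
    · split_ifs with h
      · apply hasOrder_formVar
        intro h'
        have h1 : u.1.1 = a := by rw [← partner_partner (s := s) u.1.1, h', partner_partner]
        exact hu (Subtype.ext (Prod.ext h1 h))
      · exact HasOrder.zero

/-- The weight of a weight vector in terms of the exponents of any of its monomials. -/
theorem weight_eq_of_coeff_ne_zero {ν : Fin N → ℤ} {f : SymmetricAlgebra ℂ (FormSpace N s)}
    (hf : f ∈ hwSpace (glId N) (SymmetricAlgebra ℂ (FormSpace N s)) ν) {m : PairIndex N s →₀ ℕ}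
    (hm : coeff m (symEquivPoly N s f) ≠ 0) (c : Fin N) :
    ν c = ∑ u, (m u : ℤ) * ((if u.1.1 = c then 1 else 0) + if u.1.2 = c then 1 else 0) := by
  have hdiag : (Matrix.single c c (1 : ℂ)).IsDiag := fun i j hij => by
    change Matrix.single c c (1 : ℂ) i j = 0
    rw [Matrix.single_apply, if_neg]
    rintro ⟨rfl, rfl⟩
    exact hij rfl
  have h1 : ⁅Matrix.single c c (1 : ℂ), f⁆ = (ν c : ℂ) • f := by
    have := mem_weightSpace.mp hf.1 (Matrix.single c c (1 : ℂ)) hdiag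
    rw [this]
    congr 1
    change weightEval ν (Matrix.single c c (1 : ℂ)) = _
    rw [weightEval_self, Finset.sum_eq_single c]
    · simp
    · intro i _ hi
      rw [Matrix.single_apply_of_row_ne hi.symm, mul_zero]
    · simp
  have h2 : ∀ u : PairIndex N s, polyAction s (Matrix.single c c 1) (X u) =
      ((if u.1.1 = c then 1 else 0) + if u.1.2 = c then 1 else 0 : ℂ) • X u := by
    intro u
    rw [polyAction, mkDerivation_X, symEquivPoly_symm_X, lie_smul, lie_formVar_of_isDiag hdiag,
      smul_comm, ← symEquivPoly_symm_X, map_smul, AlgEquiv.apply_symm_apply]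
    congr 1
    rw [Matrix.single_apply, Matrix.single_apply]
    simp [eq_comm]
  have h3 := congrArg (fun f => coeff m (symEquivPoly N s f)) h1
  simp only [symEquivPoly_lie, map_smul, coeff_smul, smul_eq_mul] at h3
  rw [coeff_derivation_of_diag h2] at h3
  have h4 := mul_right_cancel₀ hm h3
  exact_mod_cast h4.symm

/-- A nonzero highest weight vector has a monomial in the variables at the places
`(i, partner s i)`. -/
theorem exists_monomial {ν : Fin N → ℤ} {f : SymmetricAlgebra ℂ (FormSpace N s)}
    (hf : f ∈ hwSpace (glId N) (SymmetricAlgebra ℂ (FormSpace N s)) ν) (h0 : f ≠ 0) :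
    ∃ m, coeff m (symEquivPoly N s f) ≠ 0 ∧ ∀ u, m u ≠ 0 → partner s u.1.1 = u.1.2 := by
  by_contra! h
  refine h0 (eq_zero_of_hasOrder hf fun m hm => ?_)
  obtain ⟨u, hu, hu'⟩ := h m hm
  by_contra hlt
  have h1 : Finsupp.weight offWeight m = 0 := by omega
  rw [Finsupp.weight_apply, Finsupp.sum, Finset.sum_eq_zero_iff] at h1
  have := h1 u (Finsupp.mem_support_iff.mpr hu)
  rw [offWeight, if_neg hu', smul_eq_mul, mul_one] at this
  exact hu this

/-- A monomial in the variables at the places `(i, partner s i)` is determined by its weight. -/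
theorem exponent_eq {ν : Fin N → ℤ} {m : PairIndex N s →₀ ℕ}
    (hν : ∀ c, ν c = ∑ u, (m u : ℤ) * ((if u.1.1 = c then 1 else 0) + if u.1.2 = c then 1 else 0))
    (hm : ∀ u, m u ≠ 0 → partner s u.1.1 = u.1.2) (u : PairIndex N s)
    (hu : partner s u.1.1 = u.1.2) : ν u.1.1 = m u * (1 + if u.1.2 = u.1.1 then 1 else 0) := by
  rw [hν, Finset.sum_eq_single u]
  · rw [if_pos rfl]
  · intro v _ hv
    by_cases hmv : m v = 0
    · rw [hmv, Nat.cast_zero, zero_mul]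
    have h1 := hm v hmv
    have h2 : v.1.1 ≠ u.1.1 := fun h =>
      hv (Subtype.ext (Prod.ext h (by rw [← h1, ← hu, h])))
    have h3 : v.1.2 ≠ u.1.1 := by
      intro h
      have h4 : v.1.1 = u.1.2 := by rw [← hu, ← h, ← h1, partner_partner]
      have h5 : v.1.1 ≤ v.1.2 := v.2.elim le_of_lt fun h => h.2.le
      have h6 : u.1.1 ≤ u.1.2 := u.2.elim le_of_lt fun h => h.2.le
      rw [h, h4] at h5
      exact h2 (h4.trans (le_antisymm h5 h6))
    rw [if_neg h2, if_neg h3]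
    simp
  · simp

theorem eq_of_exponents {ν : Fin N → ℤ} {m m' : PairIndex N s →₀ ℕ}
    (hν : ∀ c, ν c = ∑ u, (m u : ℤ) * ((if u.1.1 = c then 1 else 0) + if u.1.2 = c then 1 else 0))
    (hν' : ∀ c, ν c =
      ∑ u, (m' u : ℤ) * ((if u.1.1 = c then 1 else 0) + if u.1.2 = c then 1 else 0))
    (hm : ∀ u, m u ≠ 0 → partner s u.1.1 = u.1.2)
    (hm' : ∀ u, m' u ≠ 0 → partner s u.1.1 = u.1.2) : m = m' := by
  ext u
  by_cases hu : partner s u.1.1 = u.1.2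
  · have h1 := exponent_eq hν hm u hu
    have h2 := exponent_eq hν' hm' u hu
    split_ifs at h1 h2 <;> omega
  · have h1 : m u = 0 := by
      by_contra h
      exact hu (hm u h)
    have h2 : m' u = 0 := by
      by_contra h
      exact hu (hm' u h)
    rw [h1, h2]

/-- The highest weight vectors of a given weight are proportional: the coefficient of the only
monomial of that weight in the variables at the places `(i, partner s i)` determines them. -/
theorem exists_injective_hwSpace_sym (ν : Fin N → ℤ) :
    ∃ φ : hwSpace (glId N) (SymmetricAlgebra ℂ (FormSpace N s)) ν →ₗ[ℂ] ℂ,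
      Function.Injective φ := by
  by_cases hbot : hwSpace (glId N) (SymmetricAlgebra ℂ (FormSpace N s)) ν = ⊥
  · refine ⟨0, fun f g _ => ?_⟩
    have h : ∀ f : hwSpace (glId N) (SymmetricAlgebra ℂ (FormSpace N s)) ν, f = 0 := fun f =>
      Subtype.ext ((Submodule.eq_bot_iff _).mp hbot f.1 f.2)
    rw [h f, h g]
  obtain ⟨f, hf, hf0⟩ := Submodule.exists_mem_ne_zero_of_ne_bot hbot
  obtain ⟨m, hm, hmd⟩ := exists_monomial hf hf0
  refine ⟨(lcoeff ℂ m).comp ((symEquivPoly N s).toLinearMap.comp (Submodule.subtype _)), ?_⟩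
  rw [← LinearMap.ker_eq_bot, LinearMap.ker_eq_bot']
  rintro ⟨g, hg⟩ hg0
  by_contra hne
  have hg1 : g ≠ 0 := fun h => hne (Subtype.ext h)
  obtain ⟨m', hm', hmd'⟩ := exists_monomial hg hg1
  have : m = m' := eq_of_exponents (weight_eq_of_coeff_ne_zero hf hm)
    (weight_eq_of_coeff_ne_zero hg hm') hmd hmd'
  exact hm' (this ▸ hg0)

theorem lie_one_sym {k : ℕ} {f : SymmetricAlgebra ℂ (FormSpace N s)}
    (hf : f ∈ LinearMap.range (SymmetricAlgebra.ι ℂ (FormSpace N s)) ^ k) :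
    ⁅(1 : gl N), f⁆ = ((2 * k : ℕ) : ℂ) • f := by
  refine Submodule.pow_induction_on_left' (LinearMap.range (SymmetricAlgebra.ι ℂ (FormSpace N s)))
    (C := fun k f _ => ⁅(1 : gl N), f⁆ = ((2 * k : ℕ) : ℂ) • f) ?_ ?_ ?_ hf
  · intro r
    rw [lie_sym, Derivation.map_algebraMap]
    simp
  · intro f g i _ _ hf hg
    rw [lie_add, hf, hg, smul_add]
  · rintro _ ⟨A, rfl⟩ i g _ hg
    have hA : ⁅(1 : gl N), A⁆ = (2 : ℂ) • A := by
      apply formIncl_injective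
      rw [formIncl_lie, Matrix.transpose_one, one_mul, mul_one, map_smul, two_smul]
    rw [sym_leibniz, hg, lie_sym_ι, hA, map_smul, mul_smul_comm, mul_smul_comm, mul_comm g,
      ← add_smul]
    congr 1
    push_cast
    ring

/-- The highest weights of the `k`-th symmetric power of `FormSpace N s` have even rows (`s = 1`) or
even columns (`s = -1`), because they are weights of monomials in the variables at the places
`(i, partner s i)`. In the alternating case, `partner` exchanges rows of equal length and fixes no
nonzero row, so that each column has even length. -/
theorem exists_evenPartition {k : ℕ} {ν : Fin N → ℤ} {f : SymmetricAlgebra ℂ (FormSpace N s)}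
    (hk : f ∈ LinearMap.range (SymmetricAlgebra.ι ℂ (FormSpace N s)) ^ k)
    (hf : f ∈ hwSpace (glId N) (SymmetricAlgebra ℂ (FormSpace N s)) ν) (h0 : f ≠ 0) :
    ∃ ν' ∈ evenPartitions N s k, ν = fun i => (ν' i : ℤ) := by
  obtain ⟨m, hm, hmd⟩ := exists_monomial hf h0
  have hν := weight_eq_of_coeff_ne_zero hf hm
  have hnn : ∀ c, 0 ≤ ν c := fun c => by
    rw [hν]
    refine Finset.sum_nonneg fun u _ => mul_nonneg (Int.natCast_nonneg _) ?_
    split_ifs <;> norm_num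
  -- Positivity of the Fischer form on the root vectors gives dominance.
  have hanti : Antitone ν := by
    intro a b hab
    rcases hab.eq_or_lt with rfl | hab
    · exact le_rfl
    have hlie : ⁅Matrix.single a b (1 : ℂ), Matrix.single b a (1 : ℂ)⁆ =
        Matrix.single a a 1 - Matrix.single b b 1 := by
      rw [LieRing.of_associative_ring_bracket, Matrix.single_mul_single_same,
        Matrix.single_mul_single_same, mul_one]
    have hev : weightEval ν (Matrix.single a a (1 : ℂ) - Matrix.single b b 1) =
        (ν a : ℂ) - ν b := by
      rw [weightEval_self]
      simp [mul_sub, Finset.sum_sub_distrib, Matrix.single_apply]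
    have := (isUnitarizable_sym N s).re_weightEval_nonneg Function.injective_id hf h0
      (e := Matrix.single a b (1 : ℂ)) (e' := Matrix.single b a (1 : ℂ))
      (fun i j hji => by
        change Matrix.single a b (1 : ℂ) i j = 0
        rw [Matrix.single_apply, if_neg]
        rintro ⟨rfl, rfl⟩
        exact absurd hab (not_lt.mpr hji))
      (by
        change Matrix.single b a (1 : ℂ) = (Matrix.single a b (1 : ℂ)).conjTranspose
        simp [Matrix.conjTranspose_single])
      (by
        intro i j hij
        change ⁅Matrix.single a b (1 : ℂ), Matrix.single b a (1 : ℂ)⁆ i j = 0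
        rw [hlie, Matrix.sub_apply, Matrix.single_apply, Matrix.single_apply, if_neg, if_neg,
          sub_zero]
        · rintro ⟨rfl, rfl⟩; exact hij rfl
        · rintro ⟨rfl, rfl⟩; exact hij rfl)
    change 0 ≤ (weightEval ν ⁅Matrix.single a b (1 : ℂ), Matrix.single b a (1 : ℂ)⁆).re at this
    rw [hlie, hev] at this
    have h2 : (0 : ℝ) ≤ (ν a : ℝ) - ν b := by simpa using this
    exact_mod_cast sub_nonneg.mp h2
  have hsum : ∑ i, ν i = 2 * k := by
    have h1 := lie_one_sym hk
    have h2 := mem_weightSpace.mp hf.1 (1 : gl N) Matrix.isDiag_one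
    change ⁅(1 : gl N), f⁆ = weightEval ν (1 : gl N) • f at h2
    rw [h1, weightEval_self] at h2
    have h3 := smul_left_injective ℂ h0 h2
    simp only [Matrix.one_apply_eq, mul_one] at h3
    exact_mod_cast h3.symm
  lift ν to Fin N → ℕ using hnn with μ hμ
  refine ⟨μ, ?_, rfl⟩
  have hpart : μ ∈ partitions N (2 * k) := by
    unfold partitions
    simp only [Finset.mem_filter, Finset.mem_piAntidiag]
    refine ⟨⟨by exact_mod_cast hsum, fun i _ => Finset.mem_univ i⟩, fun a b hab => ?_⟩
    exact Int.ofNat_le.mp (hanti hab)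
  unfold evenPartitions
  split_ifs with hs
  · simp only [evenRows, Finset.mem_filter]
    refine ⟨hpart, fun c => ?_⟩
    have h1 := exponent_eq hν hmd ⟨(c, c), Or.inr ⟨hs, rfl⟩⟩ (by simp [partner, hs])
    rw [if_pos rfl] at h1
    refine ⟨m ⟨(c, c), Or.inr ⟨hs, rfl⟩⟩, ?_⟩
    have h2 : (μ c : ℤ) = m ⟨(c, c), Or.inr ⟨hs, rfl⟩⟩ * (1 + 1) := h1
    omega
  · simp only [evenColumns, Finset.mem_filter]
    refine ⟨hpart, fun j => ?_⟩
    have hne : ∀ u : PairIndex N s, u.1.1 ≠ u.1.2 := fun u =>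
      (u.2.resolve_right fun h => hs h.1).ne
    have hpart : ∀ c, μ (partner s c) = μ c := by
      intro c
      have h1 := hν c
      have h2 := hν (partner s c)
      have : (μ (partner s c) : ℤ) = μ c := by
        rw [h1, h2]
        refine Finset.sum_congr rfl fun u _ => ?_
        by_cases hmu : m u = 0
        · rw [hmu, Nat.cast_zero, zero_mul, zero_mul]
        have h3 := hmd u hmu
        have h4 : u.1.1 = partner s c ↔ u.1.2 = c := by
          rw [← h3]
          exact ⟨fun h => by rw [h, partner_partner], fun h => by rw [← h, partner_partner]⟩
        have h5 : u.1.2 = partner s c ↔ u.1.1 = c := by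
          rw [← h3]
          exact ⟨fun h => by rw [← partner_partner (s := s) u.1.1, h, partner_partner],
            fun h => by rw [h]⟩
        rw [if_congr h4 rfl rfl, if_congr h5 rfl rfl, add_comm]
      exact_mod_cast this
    have hfix : ∀ c, partner s c = c → μ c = 0 := by
      intro c hc
      have h1 := hν c
      have : (μ c : ℤ) = 0 := by
        rw [h1]
        refine Finset.sum_eq_zero fun u _ => ?_
        by_cases hmu : m u = 0
        · rw [hmu, Nat.cast_zero, zero_mul]
        have h3 := hmd u hmu
        have h4 : u.1.1 ≠ c := fun h => hne u (by rw [← h3, h, hc])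
        have h5 : u.1.2 ≠ c := fun h => hne u (by
          rw [← partner_partner (s := s) u.1.1, h3, h, hc])
        rw [if_neg h4, if_neg h5, add_zero, mul_zero]
      exact_mod_cast this
    rw [← ZMod.natCast_eq_zero_iff_even, Finset.card_eq_sum_ones, Nat.cast_sum]
    refine Finset.sum_involution (fun c _ => partner s c) ?_ ?_ ?_ ?_
    · intro c _
      decide
    · intro c hc _ h
      have := (Finset.mem_filter.mp hc).2
      rw [hfix c h] at this
      omega
    · intro c hc
      rw [Finset.mem_filter, hpart]
      exact ⟨Finset.mem_univ _, (Finset.mem_filter.mp hc).2⟩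
    · intro c _
      exact partner_partner c

end FormUniqueness

/-! ### The classical Lie algebras -/

section Classical

open scoped Matrix

variable {N n : ℕ}

/-- The matrix which is zero off the antidiagonal, with the signs `c` on the antidiagonal. -/
def signForm (c : Fin N → ℤˣ) : gl N :=
  Matrix.of fun i j => if j = i.rev then ((c i : ℤ) : ℂ) else 0

/-- The Lie algebra of the group that preserves the bilinear form with matrix `signForm c`. The form
is symmetric or alternating when `c i.rev = -s * c i` with `s = -1` or `s = 1` respectively; the
sign is chosen so that the adjoint representation is `FormSpace N s`. -/
def classical (c : Fin N → ℤˣ) : LieSubalgebra ℂ (gl N) :=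
  skewAdjointMatricesLieSubalgebra (signForm c)

theorem signForm_mul_apply (c : Fin N → ℤˣ) (A : gl N) (i j : Fin N) :
    (signForm c * A) i j = ((c i : ℤ) : ℂ) * A i.rev j := by
  rw [Matrix.mul_apply, Finset.sum_eq_single i.rev]
  · rw [signForm, Matrix.of_apply, if_pos rfl]
  · intro k _ hk
    rw [signForm, Matrix.of_apply, if_neg hk, zero_mul]
  · simp

theorem mul_signForm_apply (c : Fin N → ℤˣ) (A : gl N) (i j : Fin N) :
    (A * signForm c) i j = A i j.rev * ((c j.rev : ℤ) : ℂ) := by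
  rw [Matrix.mul_apply, Finset.sum_eq_single j.rev]
  · rw [signForm, Matrix.of_apply, if_pos (Fin.rev_rev j).symm]
  · intro k _ hk
    rw [signForm, Matrix.of_apply, if_neg fun h => hk (by rw [h, Fin.rev_rev]), mul_zero]
  · simp

variable {c : Fin N → ℤˣ} {s : ℤˣ}

theorem cast_rev (hc : ∀ i, c i.rev = -s * c i) (i : Fin N) :
    ((c i.rev : ℤ) : ℂ) = -((s : ℤ) : ℂ) * ((c i : ℤ) : ℂ) := by
  rw [hc]; push_cast; ring

theorem cast_rev_mul (hc : ∀ i, c i.rev = -s * c i) (i j : Fin N) :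
    ((c i.rev : ℤ) : ℂ) * ((c j.rev : ℤ) : ℂ) = ((c i : ℤ) : ℂ) * ((c j : ℤ) : ℂ) := by
  rw [cast_rev hc, cast_rev hc]
  linear_combination (((c i : ℤ) : ℂ) * ((c j : ℤ) : ℂ)) * units_mul_self s

/-- Membership in a classical Lie algebra is a sign rule under reflection in the antidiagonal. -/
theorem mem_classical (hc : ∀ i, c i.rev = -s * c i) {X : gl N} : X ∈ classical c ↔
    ∀ i j, X j.rev i.rev = -(((c i : ℤ) : ℂ) * ((c j : ℤ) : ℂ)) * X i j := by
  have h1 : X ∈ classical c ↔ Xᵀ * signForm c = signForm c * -X := by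
    rw [classical, mem_skewAdjointMatricesLieSubalgebra, mem_skewAdjointMatricesSubmodule]
    rfl
  have hentry : ∀ i j, (Xᵀ * signForm c) i.rev j = (signForm c * -X) i.rev j ↔
      X j.rev i.rev = -(((c i : ℤ) : ℂ) * ((c j : ℤ) : ℂ)) * X i j := by
    intro i j
    rw [mul_signForm_apply, signForm_mul_apply, Matrix.transpose_apply, Matrix.neg_apply,
      Fin.rev_rev, ← cast_rev_mul hc]
    have hj := units_mul_self (c j.rev)
    constructor
    · intro h
      linear_combination ((c j.rev : ℤ) : ℂ) * h - X j.rev i.rev * hj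
    · intro h
      linear_combination ((c j.rev : ℤ) : ℂ) * h - ((c i.rev : ℤ) : ℂ) * X i j * hj
  rw [h1]
  constructor
  · intro h i j
    exact (hentry i j).mp (congrFun (congrFun h _) _)
  · intro h
    ext i j
    have := (hentry i.rev j).mpr (h _ _)
    rwa [Fin.rev_rev] at this

theorem conjTranspose_mem_classical (hc : ∀ i, c i.rev = -s * c i) {X : gl N}
    (hX : X ∈ classical c) : Xᴴ ∈ classical c := by
  rw [mem_classical hc] at hX ⊢
  intro i j
  rw [Matrix.conjTranspose_apply, Matrix.conjTranspose_apply, hX, star_mul']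
  congr 1
  simp [mul_comm]

theorem diagonal_mem_classical (hc : ∀ i, c i.rev = -s * c i) {d : Fin N → ℂ}
    (hd : ∀ i, d i.rev = -d i) : Matrix.diagonal d ∈ classical c := by
  rw [mem_classical hc]
  intro i j
  by_cases hij : i = j
  · subst hij
    rw [Matrix.diagonal_apply_eq, Matrix.diagonal_apply_eq, hd, units_mul_self]
    ring
  · rw [Matrix.diagonal_apply_ne _ hij, Matrix.diagonal_apply_ne, mul_zero]
    exact fun h => hij (Fin.rev_injective h).symm

theorem apply_rev_of_mem_classical (hc : ∀ i, c i.rev = -s * c i) {X : gl N}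
    (hX : X ∈ classical c) (i : Fin N) : X i.rev i.rev = -X i i := by
  rw [(mem_classical hc).mp hX, units_mul_self]
  ring

/-- The root vectors of a classical Lie algebra. -/
def rootVector (c : Fin N → ℤˣ) (p q : Fin N) : gl N :=
  Matrix.single p q 1 - (((c p : ℤ) : ℂ) * ((c q : ℤ) : ℂ)) • Matrix.single q.rev p.rev 1

theorem rootVector_mem (hc : ∀ i, c i.rev = -s * c i) (p q : Fin N) :
    rootVector c p q ∈ classical c := by
  rw [mem_classical hc]
  intro i j
  have hp := units_mul_self (c p)
  have hq := units_mul_self (c q)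
  have h1 : (q.rev = j.rev ∧ p.rev = i.rev) ↔ (p = i ∧ q = j) := by
    rw [Fin.rev_inj, Fin.rev_inj, and_comm]
  have h2 : (p = j.rev ∧ q = i.rev) ↔ (q.rev = i ∧ p.rev = j) := by
    constructor
    · rintro ⟨rfl, rfl⟩; simp
    · rintro ⟨rfl, rfl⟩; simp
  simp only [rootVector, Matrix.sub_apply, Matrix.smul_apply, Matrix.single_apply, smul_eq_mul,
    if_congr h1 rfl rfl, if_congr h2 rfl rfl]
  by_cases h3 : q.rev = i ∧ p.rev = j
  · obtain ⟨rfl, rfl⟩ := h3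
    rw [cast_rev_mul hc]
    rw [if_pos ⟨rfl, rfl⟩]
    linear_combination (-1 : ℂ) * (((c q : ℤ) : ℂ) * ((c q : ℤ) : ℂ)) * hp - hq
  · rw [if_neg h3]
    by_cases h4 : p = i ∧ q = j
    · obtain ⟨rfl, rfl⟩ := h4
      rw [if_pos ⟨rfl, rfl⟩]
      ring
    · rw [if_neg h4]
      ring

theorem conjTranspose_rootVector (p q : Fin N) :
    (rootVector c p q)ᴴ = Matrix.single q p 1 -
      (((c p : ℤ) : ℂ) * ((c q : ℤ) : ℂ)) • Matrix.single p.rev q.rev 1 := by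
  simp [rootVector, Matrix.conjTranspose_sub, Matrix.conjTranspose_smul,
    Matrix.conjTranspose_single, mul_comm]

/-- The commutator of a root vector and its conjugate transpose is the coroot, up to a factor. -/
theorem lie_rootVector {p q : Fin N} (hpq : p ≠ q) (h : q ≠ p.rev) :
    ⁅rootVector c p q, (rootVector c p q)ᴴ⁆ = Matrix.single p p 1 - Matrix.single q q 1 +
      Matrix.single q.rev q.rev 1 - Matrix.single p.rev p.rev 1 := by
  have h1 : p ≠ q.rev := fun h' => h (by rw [h', Fin.rev_rev])
  have hp := units_mul_self (c p)
  have hq := units_mul_self (c q)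
  have hpq2 : (((c p : ℤ) : ℂ) * ((c q : ℤ) : ℂ)) * (((c p : ℤ) : ℂ) * ((c q : ℤ) : ℂ)) = 1 := by
    linear_combination (((c q : ℤ) : ℂ) * ((c q : ℤ) : ℂ)) * hp + hq
  rw [conjTranspose_rootVector, LieRing.of_associative_ring_bracket, rootVector]
  simp only [sub_mul, mul_sub, Matrix.smul_mul, Matrix.mul_smul, Matrix.single_mul_single_same,
    mul_one, Matrix.single_mul_single_of_ne _ _ _ _ h, Matrix.single_mul_single_of_ne _ _ _ _ h1,
    Matrix.single_mul_single_of_ne _ _ _ _ h.symm, Matrix.single_mul_single_of_ne _ _ _ _ h1.symm,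
    smul_zero, smul_smul, hpq2, one_smul]
  abel

/-! ### Weights of the classical Lie algebras -/

theorem weightEval_matrix_sub (lam : Fin n → ℤ) (X Y : gl N) :
    weightEval lam (X - Y) = weightEval lam X - weightEval lam Y := by
  unfold weightEval
  rw [← Finset.sum_sub_distrib]
  refine Finset.sum_congr rfl fun j _ => ?_
  split_ifs
  · rw [Matrix.sub_apply, mul_sub]
  · rw [sub_zero]

theorem weightEval_matrix_add (lam : Fin n → ℤ) (X Y : gl N) :
    weightEval lam (X + Y) = weightEval lam X + weightEval lam Y := by
  unfold weightEval
  rw [← Finset.sum_add_distrib]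
  refine Finset.sum_congr rfl fun j _ => ?_
  split_ifs
  · rw [Matrix.add_apply, mul_add]
  · rw [add_zero]

/-- A weight, extended by zero to all the indices of the matrices. -/
def extendWeight (lam : Fin n → ℤ) (q : Fin N) : ℤ :=
  if h : (q : ℕ) < n then lam ⟨q, h⟩ else 0

theorem weightEval_single (lam : Fin n → ℤ) (p : Fin N) :
    weightEval lam (Matrix.single p p (1 : ℂ)) =
      (extendWeight lam p : ℂ) := by
  unfold weightEval extendWeight
  rw [Finset.sum_eq_single p]
  · split_ifs <;> simp
  · intro j _ hj
    rw [Matrix.single_apply_of_row_ne hj.symm]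
    simp
  · simp

theorem weightEval_eq_sum (hn : n ≤ N) (lam : Fin n → ℤ) (X : gl N) :
    weightEval lam X = ∑ i, (lam i : ℂ) * X (Fin.castLE hn i) (Fin.castLE hn i) := by
  unfold weightEval
  symm
  apply Fintype.sum_of_injective (Fin.castLE hn) (Fin.castLE_injective hn)
  · intro j hj
    rw [dif_neg]
    exact fun h => hj ⟨⟨j, h⟩, rfl⟩
  · intro i
    rw [dif_pos (show ((Fin.castLE hn i : Fin N) : ℕ) < n from i.2)]
    rfl

/-- The triangular structure of a classical Lie algebra. Its separating element has the powers of
`separatingNumber` as its first `n` diagonal coefficients. -/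
def classicalTriangular (hc : ∀ i, c i.rev = -s * c i) (hn : 2 * n ≤ N) :
    TriangularData (classical c).incl n where
  injective := Subtype.val_injective
  exists_diagPart x d := by
    refine ⟨⟨Matrix.of fun i j : Fin N => if (j : ℤ) - i = d then (x : gl N) i j else 0, ?_⟩, rfl⟩
    rw [mem_classical hc]
    intro i j
    have h1 : ((i.rev : ℤ) - j.rev = d) ↔ ((j : ℤ) - i = d) := by
      rw [Fin.val_rev, Fin.val_rev]
      omega
    rw [Matrix.of_apply, Matrix.of_apply, if_congr h1 rfl rfl]
    split_ifs
    · exact (mem_classical hc).mp x.2 i j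
    · rw [mul_zero]
  h := ⟨Matrix.diagonal fun i : Fin N => (N : ℂ) - 1 - 2 * (i : ℕ), diagonal_mem_classical hc
    fun i => by
      have : ((i.rev : ℕ) : ℂ) = N - 1 - (i : ℕ) := by
        rw [Fin.val_rev, Nat.cast_sub (by omega)]
        push_cast
        ring
      rw [this]
      ring⟩
  map_h := rfl
  t := ⟨Matrix.diagonal fun i : Fin N =>
      (if (i : ℕ) < n then separatingNumber ^ (i : ℕ) else 0) -
        if (i.rev : ℕ) < n then separatingNumber ^ (i.rev : ℕ) else 0,
    diagonal_mem_classical hc fun i => by rw [Fin.rev_rev, neg_sub]⟩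
  isDiag_t := Matrix.isDiag_diagonal _
  weightEval_t_injective := by
    intro β γ h
    apply separatingNumber_spec n
    have key : ∀ i : Fin n, (Matrix.diagonal fun i : Fin N =>
        (if (i : ℕ) < n then separatingNumber ^ (i : ℕ) else 0) -
          if (i.rev : ℕ) < n then separatingNumber ^ (i.rev : ℕ) else 0)
        (Fin.castLE (by omega) i) (Fin.castLE (by omega) i) = separatingNumber ^ (i : ℕ) := by
      intro i
      rw [Matrix.diagonal_apply_eq, if_pos (by simp), if_neg, sub_zero, Fin.val_castLE]
      rw [Fin.val_rev, Fin.val_castLE]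
      omega
    change weightEval β (Matrix.diagonal _) = weightEval γ (Matrix.diagonal _) at h
    rw [weightEval_eq_sum (by omega), weightEval_eq_sum (by omega)] at h
    simp only [key] at h
    exact h

/-- The restriction to a classical Lie algebra of a weight of `𝔤𝔩_N`: on the diagonal matrices of
the classical Lie algebra, the diagonal coefficients at `i` and `i.rev` are opposite. -/
def foldWeight (hn : 2 * n ≤ N) (β : Fin N → ℤ) : Fin n → ℤ := fun j =>
  β (Fin.castLE (by omega) j) - β (Fin.castLE (by omega) j : Fin N).rev

theorem weightEval_foldWeight (hc : ∀ i, c i.rev = -s * c i) (hn : 2 * n ≤ N)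
    (hN : N ≤ 2 * n + 1) (β : Fin N → ℤ) {X : gl N} (hX : X ∈ classical c) :
    weightEval (foldWeight hn β) X = weightEval β X := by
  have hrev := apply_rev_of_mem_classical hc hX
  rw [weightEval_self]
  have h1 : weightEval (foldWeight hn β) X = ∑ j : Fin N,
      ((if (j : ℕ) < n then (β j : ℂ) * X j j else 0) +
        if (j : ℕ) < n then (β j.rev : ℂ) * X j.rev j.rev else 0) := by
    unfold weightEval
    refine Finset.sum_congr rfl fun j _ => ?_
    split_ifs with h
    · rw [hrev]
      change ((β j - β j.rev : ℤ) : ℂ) * _ = _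
      push_cast
      ring
    · rw [add_zero]
  rw [h1, Finset.sum_add_distrib]
  have h2 : ∑ j : Fin N, (if (j : ℕ) < n then (β j.rev : ℂ) * X j.rev j.rev else 0) =
      ∑ j : Fin N, if (j.rev : ℕ) < n then (β j : ℂ) * X j j else 0 :=
    Fintype.sum_equiv Fin.revPerm _ _ fun j => by
      rw [Fin.revPerm_apply, Fin.rev_rev]
  rw [h2, ← Finset.sum_add_distrib]
  refine Finset.sum_congr rfl fun j _ => ?_
  have hj := Fin.val_rev j
  by_cases h3 : (j : ℕ) < n
  · rw [if_pos h3, if_neg (by omega), add_zero]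
  · rw [if_neg h3]
    by_cases h4 : (j.rev : ℕ) < n
    · rw [if_pos h4, zero_add]
    · have h5 : j.rev = j := Fin.ext (by omega)
      have h6 := hrev j
      rw [h5] at h6
      have h7 : X j j = 0 := by linear_combination h6 / 2
      rw [if_neg h4, h7, mul_zero, add_zero]

section Dominance

variable {M : Type} [AddCommGroup M] [Module ℂ M] [LieRingModule (classical c) M]
  [LieModule ℂ (classical c) M]

/-- The weight of a highest weight vector is nonnegative on the coroots. The four terms cover the
roots `εᵢ - εⱼ`, `εᵢ + εⱼ` and `εᵢ`, according to the positions of `p` and `q`. -/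
theorem extendWeight_nonneg (hc : ∀ i, c i.rev = -s * c i)
    (hU : IsUnitarizable (classical c).incl M) {lam : Fin n → ℤ} {v : M}
    (hv : v ∈ hwSpace (classical c).incl M lam) (h0 : v ≠ 0) {p q : Fin N} (hpq : p < q)
    (h : q ≠ p.rev) : 0 ≤ extendWeight lam p - extendWeight lam q + extendWeight lam q.rev -
      extendWeight lam p.rev := by
  let e : classical c := ⟨rootVector c p q, rootVector_mem hc p q⟩
  let e' : classical c := ⟨(rootVector c p q)ᴴ, conjTranspose_mem_classical hc e.2⟩
  have hee : (classical c).incl ⁅e, e'⁆ = Matrix.single p p 1 - Matrix.single q q 1 +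
      Matrix.single q.rev q.rev 1 - Matrix.single p.rev p.rev 1 := lie_rootVector hpq.ne h
  have := hU.re_weightEval_nonneg Subtype.val_injective hv h0 (e := e) (e' := e') ?_ rfl ?_
  · rw [hee, weightEval_matrix_sub, weightEval_matrix_add, weightEval_matrix_sub,
      weightEval_single, weightEval_single, weightEval_single, weightEval_single] at this
    have h2 : (0 : ℝ) ≤ (extendWeight lam p : ℝ) - extendWeight lam q + extendWeight lam q.rev -
      extendWeight lam p.rev := by
      simpa only [Complex.sub_re, Complex.add_re, Complex.intCast_re] using this
    exact_mod_cast h2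
  · intro i j hji
    change rootVector c p q i j = 0
    rw [rootVector, Matrix.sub_apply, Matrix.smul_apply, Matrix.single_apply, Matrix.single_apply,
      if_neg, if_neg, smul_zero, sub_zero]
    · rintro ⟨rfl, rfl⟩
      exact absurd (Fin.rev_lt_rev.mpr hpq) (not_lt.mpr hji)
    · rintro ⟨rfl, rfl⟩
      exact absurd hpq (not_lt.mpr hji)
  · rw [hee]
    intro i j hij
    have hs : ∀ a : Fin N, Matrix.single a a (1 : ℂ) i j = 0 := fun a => by
      rw [Matrix.single_apply, if_neg]
      rintro ⟨rfl, rfl⟩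
      exact hij rfl
    rw [Matrix.sub_apply, Matrix.add_apply, Matrix.sub_apply, hs, hs, hs, hs]
    ring

theorem extendWeight_of_lt (lam : Fin n → ℤ) (i : Fin n) (hn : n ≤ N) :
    extendWeight lam (Fin.castLE hn i) = lam i := dif_pos i.2

theorem extendWeight_of_le (lam : Fin n → ℤ) {q : Fin N} (hq : n ≤ (q : ℕ)) :
    extendWeight lam q = 0 := dif_neg (not_lt.mpr hq)

theorem le_of_mem_hwSpace (hc : ∀ i, c i.rev = -s * c i) (hn : 2 * n ≤ N)
    (hU : IsUnitarizable (classical c).incl M) {lam : Fin n → ℤ} {v : M}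
    (hv : v ∈ hwSpace (classical c).incl M lam) (h0 : v ≠ 0) {i j : Fin n} (hij : i < j) :
    lam j ≤ lam i := by
  have hn' : n ≤ N := by omega
  have hlt : (i : ℕ) < j := hij
  have := extendWeight_nonneg hc hU hv h0 (p := Fin.castLE hn' i) (q := Fin.castLE hn' j) hij
    (fun h => by
      have := congrArg Fin.val h
      rw [Fin.val_rev, Fin.val_castLE, Fin.val_castLE] at this
      omega)
  rw [extendWeight_of_lt, extendWeight_of_lt, extendWeight_of_le, extendWeight_of_le] at this
  · omega
  · rw [Fin.val_rev, Fin.val_castLE]; omega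
  · rw [Fin.val_rev, Fin.val_castLE]; omega

theorem neg_le_of_mem_hwSpace (hc : ∀ i, c i.rev = -s * c i) (hn : 2 * n ≤ N)
    (hU : IsUnitarizable (classical c).incl M) {lam : Fin n → ℤ} {v : M}
    (hv : v ∈ hwSpace (classical c).incl M lam) (h0 : v ≠ 0) {i j : Fin n} (hij : i < j) :
    -lam j ≤ lam i := by
  have hn' : n ≤ N := by omega
  have hlt : (i : ℕ) < j := hij
  have := extendWeight_nonneg hc hU hv h0 (p := Fin.castLE hn' i)
    (q := (Fin.castLE hn' j : Fin N).rev)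
    (by rw [Fin.lt_def, Fin.val_rev, Fin.val_castLE, Fin.val_castLE]; omega)
    (fun h => by
      have := congrArg Fin.val (Fin.rev_injective h)
      rw [Fin.val_castLE, Fin.val_castLE] at this
      omega)
  rw [Fin.rev_rev, extendWeight_of_lt, extendWeight_of_lt, extendWeight_of_le,
    extendWeight_of_le] at this
  · omega
  · rw [Fin.val_rev, Fin.val_castLE]; omega
  · rw [Fin.val_rev, Fin.val_castLE]; omega

theorem antitone_of_mem_hwSpace (hc : ∀ i, c i.rev = -s * c i) (hn : 2 * n ≤ N)
    (hU : IsUnitarizable (classical c).incl M) {lam : Fin n → ℤ} {v : M}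
    (hv : v ∈ hwSpace (classical c).incl M lam) (h0 : v ≠ 0) : Antitone lam := by
  intro i j hij
  rcases hij.eq_or_lt with rfl | hij
  · exact le_rfl
  · exact le_of_mem_hwSpace hc hn hU hv h0 hij

theorem mem_dominantWeightsD (hc : ∀ i, c i.rev = -s * c i) (hn : 2 * n ≤ N)
    (hU : IsUnitarizable (classical c).incl M) {lam : Fin n → ℤ} {v : M}
    (hv : v ∈ hwSpace (classical c).incl M lam) (h0 : v ≠ 0) : lam ∈ dominantWeightsD n :=
  fun _ _ hij => abs_le'.mpr
    ⟨le_of_mem_hwSpace hc hn hU hv h0 hij, neg_le_of_mem_hwSpace hc hn hU hv h0 hij⟩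

/-- In odd dimension, the short roots make the dominant weights nonnegative. -/
theorem mem_partitionWeights_of_odd (hc : ∀ i, c i.rev = -s * c i) (hN : N = 2 * n + 1)
    (hU : IsUnitarizable (classical c).incl M) {lam : Fin n → ℤ} {v : M}
    (hv : v ∈ hwSpace (classical c).incl M lam) (h0 : v ≠ 0) : lam ∈ partitionWeights n := by
  refine ⟨antitone_of_mem_hwSpace hc (by omega) hU hv h0, fun i => ?_⟩
  have hn' : n ≤ N := by omega
  let q : Fin N := ⟨n, by omega⟩
  have hq : q.rev = q := Fin.ext (by rw [Fin.val_rev]; change N - (n + 1) = n; omega)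
  have := extendWeight_nonneg hc hU hv h0 (p := Fin.castLE hn' i) (q := q) i.2 (fun h => by
      have := congrArg Fin.val h
      rw [Fin.val_rev, Fin.val_castLE] at this
      change n = _ at this
      omega)
  rw [hq, extendWeight_of_lt, extendWeight_of_le (q := (Fin.castLE hn' i).rev)] at this
  · omega
  · rw [Fin.val_rev, Fin.val_castLE]; omega

/-- For an alternating form, the long roots make the dominant weights nonnegative. -/
theorem mem_partitionWeights_of_alternating (hc : ∀ i, c i.rev = -1 * c i) (hn : 2 * n ≤ N)
    (hU : IsUnitarizable (classical c).incl M) {lam : Fin n → ℤ} {v : M}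
    (hv : v ∈ hwSpace (classical c).incl M lam) (h0 : v ≠ 0) : lam ∈ partitionWeights n := by
  refine ⟨antitone_of_mem_hwSpace (s := 1) hc hn hU hv h0, fun i => ?_⟩
  have hn' : n ≤ N := by omega
  set p : Fin N := Fin.castLE hn' i with hp
  have hmem : Matrix.single p p.rev (1 : ℂ) ∈ classical c := by
    rw [mem_classical (s := 1) hc]
    intro a b
    rw [Matrix.single_apply, Matrix.single_apply]
    have h1 : (p = b.rev ∧ p.rev = a.rev) ↔ (p = a ∧ p.rev = b) := by
      rw [Fin.rev_inj, and_comm, ← Fin.rev_eq_iff]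
    rw [if_congr h1 rfl rfl]
    split_ifs with h
    · obtain ⟨rfl, rfl⟩ := h
      rw [cast_rev (s := 1) hc]
      have := units_mul_self (c p)
      push_cast
      linear_combination -this
    · rw [mul_zero]
  have hct : (Matrix.single p p.rev (1 : ℂ))ᴴ = Matrix.single p.rev p 1 := by
    simp [Matrix.conjTranspose_single]
  let e : classical c := ⟨_, hmem⟩
  let e' : classical c := ⟨_, conjTranspose_mem_classical (s := 1) hc hmem⟩
  have hee : (classical c).incl ⁅e, e'⁆ = Matrix.single p p 1 - Matrix.single p.rev p.rev 1 := by
    change ⁅Matrix.single p p.rev (1 : ℂ), (Matrix.single p p.rev (1 : ℂ))ᴴ⁆ = _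
    rw [hct, LieRing.of_associative_ring_bracket, Matrix.single_mul_single_same,
      Matrix.single_mul_single_same, mul_one]
  have hplt : p < p.rev := by
    rw [Fin.lt_def, Fin.val_rev, hp, Fin.val_castLE]
    omega
  have := hU.re_weightEval_nonneg Subtype.val_injective hv h0 (e := e) (e' := e') ?_ rfl ?_
  · rw [hee, weightEval_matrix_sub, weightEval_single, weightEval_single] at this
    have h2 : (0 : ℝ) ≤ (extendWeight lam p : ℝ) - extendWeight lam p.rev := by
      simpa only [Complex.sub_re, Complex.add_re, Complex.intCast_re] using this
    rw [hp, extendWeight_of_lt, extendWeight_of_le, Int.cast_zero, sub_zero] at h2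
    · exact_mod_cast h2
    · rw [Fin.val_rev, Fin.val_castLE]; omega
  · intro a b hba
    change Matrix.single p p.rev (1 : ℂ) a b = 0
    rw [Matrix.single_apply, if_neg]
    rintro ⟨rfl, rfl⟩
    exact absurd hplt (not_lt.mpr hba)
  · rw [hee]
    intro a b hab
    have hs : ∀ i : Fin N, Matrix.single i i (1 : ℂ) a b = 0 := fun i => by
      rw [Matrix.single_apply, if_neg]
      rintro ⟨rfl, rfl⟩
      exact hab rfl
    rw [Matrix.sub_apply, hs, hs, sub_zero]

end Dominance

end Classical

/-! ### Nonvanishing of the Verma modules with dominant highest weight -/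

section Nonvanishing

variable {N n : ℕ}

/-- The space of matrices, on which a Lie algebra of matrices acts by left multiplication: the sum
of `N` copies of the vector representation. -/
def ColumnSpace (_𝔤 : LieSubalgebra ℂ (gl N)) : Type := gl N

variable {𝔤 : LieSubalgebra ℂ (gl N)}

instance : AddCommGroup (ColumnSpace 𝔤) := inferInstanceAs (AddCommGroup (gl N))

instance : Module ℂ (ColumnSpace 𝔤) := inferInstanceAs (Module ℂ (gl N))

variable (𝔤) in
/-- A matrix as an element of the column space. -/
def toColumnSpace : gl N ≃ₗ[ℂ] ColumnSpace 𝔤 := LinearEquiv.refl ℂ (gl N)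

instance : LieRingModule 𝔤 (ColumnSpace 𝔤) where
  bracket x A := toColumnSpace 𝔤 ((x : gl N) * (toColumnSpace 𝔤).symm A)
  add_lie x y A := by
    change toColumnSpace 𝔤 (((x : gl N) + (y : gl N)) * _) = _
    rw [add_mul, map_add]
  lie_add x A B := by
    rw [map_add, mul_add, map_add]
  leibniz_lie x y A := by
    simp only [LinearEquiv.symm_apply_apply, ← map_add, LieSubalgebra.coe_bracket,
      LieRing.of_associative_ring_bracket]
    congr 1
    noncomm_ring

theorem lie_toColumnSpace (x : 𝔤) (A : gl N) :
    ⁅x, toColumnSpace 𝔤 A⁆ = toColumnSpace 𝔤 ((x : gl N) * A) := rfl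

instance : LieModule ℂ 𝔤 (ColumnSpace 𝔤) where
  smul_lie c x A := by
    change toColumnSpace 𝔤 ((c • (x : gl N)) * _) = c • toColumnSpace 𝔤 ((x : gl N) * _)
    rw [Matrix.smul_mul, map_smul]
  lie_smul c x A := by
    change toColumnSpace 𝔤 ((x : gl N) * (toColumnSpace 𝔤).symm (c • A)) =
      c • toColumnSpace 𝔤 ((x : gl N) * _)
    rw [map_smul, Matrix.mul_smul, map_smul]

variable (𝔤) in
/-- The variables of the symmetric algebra of the column space. -/
def columnVar (a b : Fin N) : SymmetricAlgebra ℂ (ColumnSpace 𝔤) :=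
  SymmetricAlgebra.ι ℂ _ (toColumnSpace 𝔤 (Matrix.single a b 1))

theorem lie_columnVar (x : 𝔤) (a b : Fin N) :
    ⁅x, columnVar 𝔤 a b⁆ = ∑ d, (x : gl N) d a • columnVar 𝔤 d b := by
  rw [columnVar, lie_sym_ι, lie_toColumnSpace]
  simp only [columnVar, ← map_smul, ← map_sum]
  congr 2
  ext i j
  rw [Matrix.sum_apply]
  by_cases hj : j = b
  · subst hj
    simp [Matrix.single_apply]
  · rw [Matrix.mul_single_apply_of_ne _ _ _ _ _ hj]
    refine (Finset.sum_eq_zero fun d _ => ?_).symm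
    change (x : gl N) d a * Matrix.single d b (1 : ℂ) i j = 0
    rw [Matrix.single_apply, if_neg fun h => hj h.2.symm, mul_zero]

variable (𝔤) in
/-- The weight `lam` occurs as a highest weight in the symmetric algebra of the column space. The
Verma module of such a weight does not vanish. -/
def HasHighestWeight (lam : Fin n → ℤ) : Prop :=
  ∃ f : SymmetricAlgebra ℂ (ColumnSpace 𝔤), f ≠ 0 ∧
    f ∈ hwSpace 𝔤.incl (SymmetricAlgebra ℂ (ColumnSpace 𝔤)) lam

theorem HasHighestWeight.vermaIdeal_ne_top {lam : Fin n → ℤ} (h : HasHighestWeight 𝔤 lam) :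
    vermaIdeal 𝔤.incl lam ≠ ⊤ := by
  obtain ⟨f, h0, hf⟩ := h
  exact ClassicalBranching.vermaIdeal_ne_top hf h0

theorem HasHighestWeight.zero : HasHighestWeight 𝔤 (0 : Fin n → ℤ) := by
  have : IsDomain (SymmetricAlgebra ℂ (ColumnSpace 𝔤)) := inferInstance
  exact ⟨1, one_ne_zero, one_mem_hwSpace⟩

theorem HasHighestWeight.add {lam mu : Fin n → ℤ} (h : HasHighestWeight 𝔤 lam)
    (h' : HasHighestWeight 𝔤 mu) : HasHighestWeight 𝔤 (lam + mu) := by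
  have : IsDomain (SymmetricAlgebra ℂ (ColumnSpace 𝔤)) := inferInstance
  obtain ⟨f, h0, hf⟩ := h
  obtain ⟨g, h0', hg⟩ := h'
  exact ⟨f * g, mul_ne_zero h0 h0', mul_mem_hwSpace hf hg⟩

/-- A minor with rows `κ` is a highest weight vector when the span of the corresponding basis
vectors is stable under the upper triangular elements. -/
theorem hasHighestWeight_of_minor {c : ℕ} {κ : Fin c → Fin N} (hκ : Function.Injective κ)
    {lam : Fin n → ℤ}
    (hX : ∀ X ∈ 𝔤, (∀ i j, j < i → X i j = 0) → ∀ i ∉ Set.range κ, ∀ a, X i (κ a) = 0)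
    (hlam : ∀ X ∈ 𝔤, X.IsDiag → weightEval lam X = ∑ a, X (κ a) (κ a)) :
    HasHighestWeight 𝔤 lam := by
  let A : Matrix (Fin c) (Fin c) (SymmetricAlgebra ℂ (ColumnSpace 𝔤)) :=
    Matrix.of fun a b => columnVar 𝔤 (κ a) (κ b)
  have hlie : ∀ x : 𝔤, (∀ i j, j < i → (x : gl N) i j = 0) →
      ⁅x, A.det⁆ = (∑ a, (x : gl N) (κ a) (κ a)) • A.det := by
    intro x hx
    refine lie_det_of_left (Y := (x : gl N).submatrix κ κ) fun a b => ?_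
    change ⁅x, columnVar 𝔤 (κ a) (κ b)⁆ = _
    rw [lie_columnVar]
    exact (Fintype.sum_of_injective κ hκ _ _
      (fun i hi => by rw [hX x x.2 hx i hi a, zero_smul]) fun _ => rfl).symm
  refine ⟨A.det, fun h0 => ?_, mem_weightSpace.mpr fun x hx => ?_, fun x hx => ?_⟩
  -- The minor takes the value `1` at the identity matrix.
  · let ev : SymmetricAlgebra ℂ (ColumnSpace 𝔤) →ₐ[ℂ] ℂ := SymmetricAlgebra.lift
      ((Matrix.traceLinearMap (Fin N) ℂ ℂ).comp (toColumnSpace 𝔤).symm.toLinearMap)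
    have hA : ev.mapMatrix A = 1 := by
      ext a b
      change ev (SymmetricAlgebra.ι ℂ _ _) = _
      rw [SymmetricAlgebra.lift_ι_apply]
      change Matrix.trace (Matrix.single (κ a) (κ b) (1 : ℂ)) = _
      by_cases hab : a = b
      · subst hab
        simp
      · rw [Matrix.trace_single_eq_of_ne _ _ _ fun h => hab (hκ h), Matrix.one_apply_ne hab]
    have h1 : ev A.det = 0 := by rw [h0, map_zero]
    rw [AlgHom.map_det, hA, Matrix.det_one] at h1
    exact one_ne_zero h1
  · rw [hlie x fun i j hij => hx hij.ne']
    congr 1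
    exact (hlam x x.2 hx).symm
  · rw [hlie x fun i j hij => hx i j hij.le, Finset.sum_eq_zero, zero_smul]
    exact fun a _ => hx _ _ le_rfl

variable (𝔤) in
/-- The fundamental weight `ε₁ + ⋯ + ε_c`. -/
theorem hasHighestWeight_step (hn : n ≤ N) {c : ℕ} (hc : c ≤ n) :
    HasHighestWeight 𝔤 (fun i : Fin n => if (i : ℕ) < c then (1 : ℤ) else 0) := by
  refine hasHighestWeight_of_minor (κ := Fin.castLE (hc.trans hn))
    (Fin.castLE_injective (hc.trans hn)) (fun X _ hX i hi a => hX _ _ ?_) fun X _ _ => ?_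
  · rw [Fin.lt_def, Fin.val_castLE]
    refine a.2.trans_le (not_lt.mp fun h => hi ⟨⟨i, h⟩, rfl⟩)
  · rw [weightEval_eq_sum hn]
    symm
    apply Fintype.sum_of_injective (Fin.castLE hc) (Fin.castLE_injective hc)
    · intro j hj
      rw [if_neg, Int.cast_zero, zero_mul]
      exact fun h => hj ⟨⟨j, h⟩, rfl⟩
    · intro i
      rw [if_pos (by simp), Int.cast_one, one_mul]
      rfl

variable (𝔤) in
theorem hasHighestWeight_of_antitone (hn : n ≤ N) {ν : Fin n → ℕ} (hν : Antitone ν) :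
    HasHighestWeight 𝔤 (fun i => (ν i : ℤ)) := by
  refine antitone_induction one_pos (ok := fun _ => True)
    (Q := fun ν => HasHighestWeight 𝔤 fun i => (ν i : ℤ)) ?_ ?_ ?_ ν hν (fun i => one_dvd _)
    fun _ => trivial
  · exact HasHighestWeight.zero
  · intro μ ν hμ hν
    have := hμ.add hν
    convert this using 1
    funext i
    simp
  · intro c _ hc _
    convert hasHighestWeight_step 𝔤 hn hc using 1
    funext i
    dsimp only
    split_ifs <;> rfl

variable (𝔤) in
theorem hasHighestWeight_of_mem_partitionWeights (hn : n ≤ N) {lam : Fin n → ℤ}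
    (h : lam ∈ partitionWeights n) : HasHighestWeight 𝔤 lam := by
  obtain ⟨h1, h2⟩ := h
  lift lam to Fin n → ℕ using h2
  exact hasHighestWeight_of_antitone 𝔤 hn fun i j hij => Int.ofNat_le.mp (h1 hij)

theorem HasHighestWeight.nsmul {lam : Fin n → ℤ} (h : HasHighestWeight 𝔤 lam) (k : ℕ) :
    HasHighestWeight 𝔤 (k • lam) := by
  induction k with
  | zero => rw [zero_smul]; exact .zero
  | succ k ih => rw [succ_nsmul]; exact ih.add h

/-- The weight `ε₁ + ⋯ + ε_{n-1} - εₙ` of `𝔰𝔬_{2n}`: the matrices of `𝔰𝔬_{2n}` vanish on the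
antidiagonal, so that the upper triangular ones stabilize the span of the basis vectors
`1, …, n - 1, n + 1`. -/
theorem hasHighestWeight_neg {c : Fin (2 * (n + 1)) → ℤˣ} (hc : ∀ i, c i.rev = - -1 * c i) :
    HasHighestWeight (classical c)
      (fun i : Fin (n + 1) => if i = Fin.last n then (-1 : ℤ) else 1) := by
  let p : Fin (2 * (n + 1)) := ⟨n, by omega⟩
  have hp : (p.rev : ℕ) = n + 1 := by rw [Fin.val_rev]; change 2 * (n + 1) - (n + 1) = n + 1; omega
  let κ : Fin (n + 1) → Fin (2 * (n + 1)) := fun a =>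
    if a = Fin.last n then p.rev else Fin.castLE (by omega) a
  have hκv : ∀ a, (κ a : ℕ) = if a = Fin.last n then n + 1 else a := by
    intro a
    simp only [κ]
    split_ifs
    · exact hp
    · rfl
  have hlast : ∀ a : Fin (n + 1), a = Fin.last n ↔ (a : ℕ) = n := fun a => by
    rw [Fin.ext_iff, Fin.val_last]
  refine hasHighestWeight_of_minor (κ := κ) ?_ (fun X hmem hX i hi a => ?_) fun X hmem hX => ?_
  · intro a b hab
    have h1 : (κ a : ℕ) = κ b := congrArg Fin.val hab
    rw [hκv, hκv] at h1
    simp only [hlast] at h1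
    refine Fin.ext ?_
    split_ifs at h1 <;> omega
  · by_cases hip : i = p ∧ a = Fin.last n
    · obtain ⟨rfl, rfl⟩ := hip
      have h1 := (mem_classical hc).mp hmem p p.rev
      rw [Fin.rev_rev, cast_rev hc] at h1
      have h2 := units_mul_self (c p)
      have h3 : X p p.rev = 0 := by
        push_cast at h1
        linear_combination (h1 - X p p.rev * h2) / 2
      simpa [κ] using h3
    · apply hX
      rw [Fin.lt_def, hκv]
      have h1 : (i : ℕ) = n → i = p := fun h => Fin.ext h
      have h2 : ¬((i : ℕ) < n) := fun h => hi ⟨⟨i, by omega⟩, Fin.ext (by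
        rw [hκv, if_neg]
        rw [hlast]
        exact h.ne)⟩
      have h3 : (i : ℕ) ≠ n + 1 := fun h => hi ⟨Fin.last n, Fin.ext (by
        rw [hκv, if_pos rfl, h])⟩
      by_cases ha : a = Fin.last n
      · have h4 : (i : ℕ) ≠ n := fun h => hip ⟨h1 h, ha⟩
        rw [if_pos ha]
        omega
      · rw [if_neg ha]
        have := (hlast a).not.mp ha
        omega
  · rw [weightEval_eq_sum (by omega)]
    refine Finset.sum_congr rfl fun a _ => ?_
    by_cases ha : a = Fin.last n
    · subst ha
      have h1 := apply_rev_of_mem_classical hc hmem p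
      simp only [κ, if_true]
      rw [h1]
      push_cast
      rw [neg_one_mul]
      rfl
    · simp only [κ, if_neg ha]
      push_cast
      rw [one_mul]

/-- If the last coordinate of `λ` is `-k < 0`, then `λ` is the sum of a partition with last part
zero and of `k (ε₁ + ⋯ + ε_{n-1} - εₙ)`. -/
theorem hasHighestWeight_of_mem_dominantWeightsD (hn : 2 ≤ n) {c : Fin (2 * n) → ℤˣ}
    (hc : ∀ i, c i.rev = - -1 * c i) {lam : Fin n → ℤ} (h : lam ∈ dominantWeightsD n) :
    HasHighestWeight (classical c) lam := by
  obtain ⟨n, rfl⟩ : ∃ m, n = m + 1 := ⟨n - 1, by omega⟩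
  have hlt : ∀ i : Fin (n + 1), i ≠ Fin.last n → |lam (Fin.last n)| ≤ lam i := fun i hi =>
    h i _ (Fin.lt_last_iff_ne_last.mpr hi)
  have hanti : Antitone lam := by
    intro i j hij
    rcases hij.eq_or_lt with rfl | hij
    · exact le_rfl
    · exact (le_abs_self _).trans (h i j hij)
  by_cases h0 : 0 ≤ lam (Fin.last n)
  · exact hasHighestWeight_of_mem_partitionWeights _ (by omega)
      ⟨hanti, fun i => h0.trans (hanti (Fin.le_last i))⟩
  · obtain ⟨k, hk⟩ : ∃ k : ℕ, lam (Fin.last n) = -k := ⟨(-lam (Fin.last n)).toNat, by omega⟩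
    have hsplit : lam = (fun i => if i = Fin.last n then 0 else lam i - k) +
        k • fun i : Fin (n + 1) => if i = Fin.last n then (-1 : ℤ) else 1 := by
      funext i
      rw [Pi.add_apply, Pi.smul_apply, nsmul_eq_mul]
      split_ifs with hi
      · rw [hi, hk]; ring
      · ring
    rw [hsplit]
    refine (hasHighestWeight_of_mem_partitionWeights _ (by omega) ⟨?_, ?_⟩).add
      ((hasHighestWeight_neg hc).nsmul k)
    · intro i j hij
      dsimp only
      split_ifs with h1 h2 h2
      · exact le_rfl
      · have := hlt i h2
        rw [hk, abs_neg, Nat.abs_cast] at this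
        omega
      · rw [h2] at hij
        exact absurd (Fin.last_le_iff.mp hij) h1
      · have := hanti hij
        omega
    · intro i
      split_ifs with h1
      · exact le_rfl
      · have := hlt i h1
        rw [hk, abs_neg, Nat.abs_cast] at this
        omega

end Nonvanishing

/-! ### The adjoint representation and its symmetric powers -/

section Adjoint

open scoped Matrix

variable {N : ℕ} {c : Fin N → ℤˣ} {s : ℤˣ}

theorem signForm_mul_self (hc : ∀ i, c i.rev = -s * c i) :
    signForm c * signForm c = -((s : ℤ) : ℂ) • (1 : gl N) := by
  ext i j
  rw [signForm_mul_apply, signForm, Matrix.of_apply, Fin.rev_rev, Matrix.smul_apply,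
    Matrix.one_apply, smul_eq_mul]
  by_cases h : i = j
  · subst h
    rw [if_pos rfl, if_pos rfl, cast_rev hc]
    linear_combination (-((s : ℤ) : ℂ)) * units_mul_self (c i)
  · rw [if_neg h, if_neg (Ne.symm h), mul_zero, mul_zero]

theorem transpose_signForm (hc : ∀ i, c i.rev = -s * c i) :
    (signForm c)ᵀ = -((s : ℤ) : ℂ) • signForm c := by
  ext i j
  rw [Matrix.transpose_apply, Matrix.smul_apply, signForm, Matrix.of_apply, Matrix.of_apply,
    smul_eq_mul]
  by_cases h : j = i.rev
  · subst h
    rw [if_pos rfl, Fin.rev_rev, if_pos rfl, cast_rev hc]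
  · rw [if_neg h, if_neg fun h' => h (by rw [h', Fin.rev_rev]), mul_zero]

theorem mem_classical_iff_mul (hc : ∀ i, c i.rev = -s * c i) {X : gl N} :
    X ∈ classical c ↔ X * signForm c = -(signForm c * Xᵀ) := by
  have hentry : ∀ i j, (X * signForm c) i j.rev = (-(signForm c * Xᵀ)) i j.rev ↔
      X j.rev i.rev = -(((c i : ℤ) : ℂ) * ((c j : ℤ) : ℂ)) * X i j := by
    intro i j
    rw [mul_signForm_apply, Matrix.neg_apply, signForm_mul_apply, Matrix.transpose_apply,
      Fin.rev_rev]
    have hi := units_mul_self (c i)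
    constructor
    · intro h
      linear_combination ((c i : ℤ) : ℂ) * h - X j.rev i.rev * hi
    · intro h
      linear_combination ((c i : ℤ) : ℂ) * h - ((c j : ℤ) : ℂ) * X i j * hi
  rw [mem_classical hc]
  constructor
  · intro h
    ext i j
    have := (hentry i j.rev).mpr (h _ _)
    rwa [Fin.rev_rev] at this
  · intro h i j
    exact (hentry i j).mp (congrFun (congrFun h _) _)

/-- Multiplication by the matrix of the form identifies the adjoint representation with the
exterior or symmetric square of the vector representation. -/
def adjointEquiv (hc : ∀ i, c i.rev = -s * c i) : classical c ≃ₗ[ℂ] FormSpace N s where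
  toFun Y := ⟨(Y : gl N) * signForm c, by
    change ((Y : gl N) * signForm c)ᵀ = ((s : ℤ) : ℂ) • ((Y : gl N) * signForm c)
    rw [Matrix.transpose_mul, transpose_signForm hc, (mem_classical_iff_mul hc).mp Y.2,
      Matrix.smul_mul, smul_neg, neg_smul]⟩
  map_add' Y Z := Subtype.ext (add_mul (Y : gl N) Z (signForm c))
  map_smul' a Y := Subtype.ext (Matrix.smul_mul a (Y : gl N) (signForm c))
  invFun A := ⟨-((s : ℤ) : ℂ) • (formIncl N s A * signForm c), by
    rw [mem_classical_iff_mul hc, Matrix.transpose_smul, Matrix.transpose_mul,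
      transpose_signForm hc, transpose_formIncl]
    simp only [Matrix.smul_mul, Matrix.mul_smul, Matrix.mul_assoc, signForm_mul_self hc,
      ← Matrix.mul_assoc (signForm c) (signForm c), smul_smul, Matrix.mul_one, Matrix.one_mul,
      ← neg_smul]
    congr 1
    linear_combination (-(((s : ℤ) : ℂ) * ((s : ℤ) : ℂ))) * units_mul_self s⟩
  left_inv Y := Subtype.ext (by
    change -((s : ℤ) : ℂ) • ((Y : gl N) * signForm c * signForm c) = Y
    rw [Matrix.mul_assoc, signForm_mul_self hc, Matrix.mul_smul, Matrix.mul_one, smul_smul,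
      neg_mul_neg, units_mul_self, one_smul])
  right_inv A := formIncl_injective (by
    change (-((s : ℤ) : ℂ) • (formIncl N s A * signForm c)) * signForm c = formIncl N s A
    rw [Matrix.smul_mul, Matrix.mul_assoc, signForm_mul_self hc, Matrix.mul_smul, Matrix.mul_one,
      smul_smul, neg_mul_neg, units_mul_self, one_smul])

theorem adjointEquiv_lie (hc : ∀ i, c i.rev = -s * c i) (X Y : classical c) :
    adjointEquiv hc ⁅X, Y⁆ = ⁅(X : gl N), adjointEquiv hc Y⁆ := by
  apply formIncl_injective
  change ((X : gl N) * Y - (Y : gl N) * X) * signForm c =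
    (X : gl N) * ((Y : gl N) * signForm c) + (Y : gl N) * signForm c * (X : gl N)ᵀ
  rw [sub_mul, Matrix.mul_assoc, Matrix.mul_assoc (Y : gl N), Matrix.mul_assoc (Y : gl N),
    (mem_classical_iff_mul hc).mp X.2, Matrix.mul_neg, sub_neg_eq_add]

end Adjoint

section SymCongr

variable {M M' : Type} [AddCommGroup M] [Module ℂ M] [AddCommGroup M'] [Module ℂ M']

/-- A linear isomorphism extends to the symmetric algebras. -/
def symCongr (φ : M ≃ₗ[ℂ] M') : SymmetricAlgebra ℂ M ≃ₐ[ℂ] SymmetricAlgebra ℂ M' :=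
  AlgEquiv.ofAlgHom (SymmetricAlgebra.lift (SymmetricAlgebra.ι ℂ M' ∘ₗ φ.toLinearMap))
    (SymmetricAlgebra.lift (SymmetricAlgebra.ι ℂ M ∘ₗ φ.symm.toLinearMap))
    (SymmetricAlgebra.algHom_ext (by ext m; simp))
    (SymmetricAlgebra.algHom_ext (by ext m; simp))

theorem symCongr_ι (φ : M ≃ₗ[ℂ] M') (m : M) :
    symCongr φ (SymmetricAlgebra.ι ℂ M m) = SymmetricAlgebra.ι ℂ M' (φ m) :=
  SymmetricAlgebra.lift_ι_apply _ m

theorem map_range_ι_pow (φ : M ≃ₗ[ℂ] M') (k : ℕ) :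
    (LinearMap.range (SymmetricAlgebra.ι ℂ M) ^ k).map (symCongr φ).toLinearMap =
      LinearMap.range (SymmetricAlgebra.ι ℂ M') ^ k := by
  have h1 : (LinearMap.range (SymmetricAlgebra.ι ℂ M)).map (symCongr φ).toAlgHom.toLinearMap =
      LinearMap.range (SymmetricAlgebra.ι ℂ M') := by
    ext f
    constructor
    · rintro ⟨_, ⟨m, rfl⟩, rfl⟩
      exact ⟨φ m, (symCongr_ι φ m).symm⟩
    · rintro ⟨m, rfl⟩
      exact ⟨_, ⟨φ.symm m, rfl⟩, (symCongr_ι φ _).trans (by rw [φ.apply_symm_apply])⟩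
  have h2 := Submodule.map_pow (LinearMap.range (SymmetricAlgebra.ι ℂ M)) (symCongr φ).toAlgHom k
  rw [h1] at h2
  exact h2

variable {L : Type} [LieRing L] [LieAlgebra ℂ L] {𝔤 : LieSubalgebra ℂ L} [LieRingModule 𝔤 M]
  [LieModule ℂ 𝔤 M] [LieRingModule L M'] [LieModule ℂ L M']

theorem symCongr_lie (φ : M ≃ₗ[ℂ] M')
    (hφ : ∀ (x : 𝔤) (m : M), φ ⁅x, m⁆ = ⁅(x : L), φ m⁆) (x : 𝔤)
    (f : SymmetricAlgebra ℂ M) : symCongr φ ⁅x, f⁆ = ⁅(x : L), symCongr φ f⁆ := by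
  induction f using SymmetricAlgebra.induction with
  | algebraMap r =>
    rw [AlgEquiv.commutes, lie_sym, lie_sym, Derivation.map_algebraMap, Derivation.map_algebraMap,
      map_zero]
  | ι m => rw [lie_sym_ι, symCongr_ι, symCongr_ι, lie_sym_ι, hφ]
  | mul f g hf hg => rw [sym_leibniz, map_add, map_mul, map_mul, map_mul, hf, hg, sym_leibniz]
  | add f g hf hg => rw [lie_add, map_add, map_add, hf, hg, lie_add]

/-- The symmetric powers of isomorphic modules are isomorphic; the second module is the restriction
of a module over a larger Lie algebra. -/
def symPowerCongr (φ : M ≃ₗ[ℂ] M') (hφ : ∀ (x : 𝔤) (m : M), φ ⁅x, m⁆ = ⁅(x : L), φ m⁆) (k : ℕ) :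
    symPower ℂ M 𝔤 k ≃ₗ⁅ℂ, 𝔤⁆ symPower ℂ M' L k :=
  { LinearEquiv.ofSubmodules (symCongr φ).toLinearEquiv
      (symPower ℂ M 𝔤 k : Submodule ℂ (SymmetricAlgebra ℂ M))
      (symPower ℂ M' L k : Submodule ℂ (SymmetricAlgebra ℂ M')) (map_range_ι_pow φ k) with
    map_lie' := fun {x f} => Subtype.ext (symCongr_lie φ hφ x f) }

instance [FiniteDimensional ℂ M'] (k : ℕ) : FiniteDimensional ℂ (symPower ℂ M' L k) := by
  have h : (LinearMap.range (SymmetricAlgebra.ι ℂ M')).FG :=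
    (Submodule.fg_iff_finiteDimensional _).mpr inferInstance
  exact (Submodule.fg_iff_finiteDimensional _).mp (h.pow k)

end SymCongr

/-! ### Restriction to a classical Lie algebra -/

section Restriction

open scoped Matrix

variable {N n : ℕ} {c : Fin N → ℤˣ} {s : ℤˣ}
variable {M : Type} [AddCommGroup M] [Module ℂ M] [LieRingModule (gl N) M] [LieModule ℂ (gl N) M]

theorem IsUnitarizable.restrict (hc : ∀ i, c i.rev = -s * c i) (h : IsUnitarizable (glId N) M) :
    IsUnitarizable (classical c).incl M := by
  obtain ⟨B, h1, h2, h3⟩ := h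
  refine ⟨B, h1, h2, fun x => ⟨⟨(x : gl N)ᴴ, conjTranspose_mem_classical hc x.2⟩, rfl, ?_⟩⟩
  obtain ⟨y, hy, hB⟩ := h3 (x : gl N)
  obtain rfl : y = (x : gl N)ᴴ := hy
  exact hB

/-- The weights of `𝔤𝔩_N` restrict to integral weights of a classical Lie algebra. -/
theorem isIntegral_restrict (hc : ∀ i, c i.rev = -s * c i) (hn : 2 * n ≤ N) (hN : N ≤ 2 * n + 1)
    (h : ⨆ β : Fin N → ℤ, weightSpace (glId N) M β = ⊤) :
    (classicalTriangular hc hn).IsIntegral M := by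
  apply TriangularData.isIntegral_of_iSup_eq_top
  rw [eq_top_iff, ← h]
  refine iSup_le fun β => le_trans (fun v hv => ?_) (le_iSup _ (foldWeight hn β))
  refine mem_weightSpace.mpr fun x hx => ?_
  rw [show (classical c).incl x = (x : gl N) from rfl, weightEval_foldWeight hc hn hN β x.2]
  exact mem_weightSpace.mp hv (x : gl N) hx

variable (c) in
/-- A submodule over `𝔤𝔩_N` as a submodule over a classical Lie algebra. -/
def restrictSubmodule (A : LieSubmodule ℂ (gl N) M) : LieSubmodule ℂ (classical c) M where
  __ := (A : Submodule ℂ M)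
  lie_mem {x _} hm := A.lie_mem (x := (x : gl N)) hm

theorem finrank_hwSpace_restrict_add [FiniteDimensional ℂ M] {A B : LieSubmodule ℂ (gl N) M}
    (h : IsCompl A B) (lam : Fin n → ℤ) :
    Module.finrank ℂ (hwSpace (classical c).incl M lam) =
      Module.finrank ℂ (hwSpace (classical c).incl A lam) +
        Module.finrank ℂ (hwSpace (classical c).incl B lam) := by
  have h' : IsCompl (restrictSubmodule c A) (restrictSubmodule c B) := by
    have h1 : IsCompl (A : Submodule ℂ M) (B : Submodule ℂ M) :=
      LieSubmodule.isCompl_toSubmodule.mpr h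
    exact LieSubmodule.isCompl_toSubmodule.mp h1
  -- `restrictSubmodule c A` and the restriction of the module `A` have the same space and action.
  have e : ∀ A : LieSubmodule ℂ (gl N) M, restrictSubmodule c A ≃ₗ⁅ℂ, classical c⁆ A := fun A =>
    { toFun := fun x => ⟨x.1, x.2⟩
      invFun := fun x => ⟨x.1, x.2⟩
      map_add' := fun _ _ => rfl
      map_smul' := fun _ _ => rfl
      map_lie' := rfl
      left_inv := fun _ => rfl
      right_inv := fun _ => rfl }
  rw [finrank_hwSpace_add h', finrank_hwSpace_congr (e A), finrank_hwSpace_congr (e B)]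

/-- An isomorphism over `𝔤𝔩_N` is an isomorphism over a classical Lie algebra. -/
def restrictEquiv {M' : Type} [AddCommGroup M'] [Module ℂ M'] [LieRingModule (gl N) M']
    [LieModule ℂ (gl N) M'] (e : M ≃ₗ⁅ℂ, gl N⁆ M') : M ≃ₗ⁅ℂ, classical c⁆ M' :=
  { e.toLinearEquiv with map_lie' := fun {x m} => e.map_lie' (x := (x : gl N)) (m := m) }

end Restriction

/-! ### The decomposition of the symmetric powers -/

section Decomposition

variable {N n : ℕ} {c : Fin N → ℤˣ} {s : ℤˣ}

variable (N s) in
theorem isUnitarizable_symPower (k : ℕ) :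
    IsUnitarizable (glId N) (symPower ℂ (FormSpace N s) (gl N) k) :=
  (isUnitarizable_sym N s).submodule _

theorem coe_mem_hwSpace {k : ℕ} {μ : Fin N → ℤ} (f : symPower ℂ (FormSpace N s) (gl N) k) :
    f ∈ hwSpace (glId N) (symPower ℂ (FormSpace N s) (gl N) k) μ ↔
      (f : SymmetricAlgebra ℂ (FormSpace N s)) ∈
        hwSpace (glId N) (SymmetricAlgebra ℂ (FormSpace N s)) μ := by
  refine ⟨fun h => map_mem_hwSpace (symPower ℂ (FormSpace N s) (gl N) k).incl h, fun h => ?_⟩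
  exact ⟨mem_weightSpace.mpr fun x hx => Subtype.ext (mem_weightSpace.mp h.1 x hx),
    fun x hx => Subtype.ext (h.2 x hx)⟩

/-- The `k`-th symmetric power of `FormSpace N s` is the multiplicity free sum of the irreducible
representations with highest weight in `evenPartitions N s k`. -/
theorem finrank_hwSpace_symPower (k : ℕ) (μ : Fin N → ℤ) :
    Module.finrank ℂ (hwSpace (glId N) (symPower ℂ (FormSpace N s) (gl N) k) μ) =
      if μ ∈ (evenPartitions N s k).image fun ν i => (ν i : ℤ) then 1 else 0 := by
  split_ifs with h
  · obtain ⟨ν, hν, rfl⟩ := Finset.mem_image.mp h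
    apply le_antisymm
    · obtain ⟨φ, hφ⟩ := exists_injective_hwSpace_sym (s := s) (fun i => (ν i : ℤ))
      let ψ : hwSpace (glId N) (symPower ℂ (FormSpace N s) (gl N) k) (fun i => (ν i : ℤ)) →ₗ[ℂ]
          hwSpace (glId N) (SymmetricAlgebra ℂ (FormSpace N s)) (fun i => (ν i : ℤ)) :=
        { toFun := fun f => ⟨f.1.1, (coe_mem_hwSpace f.1).mp f.2⟩
          map_add' := fun _ _ => rfl
          map_smul' := fun _ _ => rfl }
      have hψ : Function.Injective ψ := fun f g hfg =>
        Subtype.ext (Subtype.ext (congrArg (fun x => (x.1 : SymmetricAlgebra ℂ _)) hfg))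
      have := LinearMap.finrank_le_finrank_of_injective (f := φ.comp ψ) (hφ.comp hψ)
      rwa [Module.finrank_self] at this
    · obtain ⟨f, hf0, hfk, hf⟩ := exists_hwVector_of_mem_evenPartitions hν
      have : Nontrivial (hwSpace (glId N) (symPower ℂ (FormSpace N s) (gl N) k)
          (fun i => (ν i : ℤ))) :=
        ⟨⟨⟨⟨f, hfk⟩, (coe_mem_hwSpace _).mpr hf⟩, 0, fun h =>
          hf0 (congrArg (fun x => (x.1.1 : SymmetricAlgebra ℂ (FormSpace N s))) h)⟩⟩
      exact Module.finrank_pos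
  · have : hwSpace (glId N) (symPower ℂ (FormSpace N s) (gl N) k) μ = ⊥ := by
      rw [Submodule.eq_bot_iff]
      intro f hf
      by_contra h0
      obtain ⟨ν, hν, rfl⟩ := exists_evenPartition f.2 ((coe_mem_hwSpace f).mp hf)
        fun h => h0 (Subtype.ext h)
      exact h (Finset.mem_image_of_mem _ hν)
    rw [this, finrank_bot]

end Decomposition

/-! ### Symmetric powers of the adjoint representation and branching -/

section Branching

variable {N n : ℕ} {c : Fin N → ℤˣ} {s : ℤˣ} {k : ℕ}

/-- The irreducible representations of `𝔤𝔩_N` with highest weight in `evenPartitions N s k` embed in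
the symmetric power; in particular they are finite-dimensional and unitarizable. -/
theorem exists_glIrrepHom {ν : Fin N → ℕ} (hν : ν ∈ evenPartitions N s k) :
    ∃ f : glIrrep N ν →ₗ⁅ℂ, gl N⁆ symPower ℂ (FormSpace N s) (gl N) k, Function.Injective f := by
  obtain ⟨v, hv0, hvk, hv⟩ := exists_hwVector_of_mem_evenPartitions hν
  obtain ⟨f, hf, _⟩ := (glTriangular N).exists_irrepHom (isUnitarizable_symPower N s k)
    (v := ⟨v, hvk⟩) ((coe_mem_hwSpace _).mpr hv) fun h => hv0 (congrArg Subtype.val h)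
  exact ⟨f, hf⟩

/-- A branching coefficient counts highest weight vectors, because the restriction is completely
reducible. -/
theorem branching_eq_finrank (hc : ∀ i, c i.rev = -s * c i) (hn : 2 * n ≤ N) {ν : Fin N → ℕ}
    (hν : ν ∈ evenPartitions N s k) {lam : Fin n → ℤ}
    (hlam : vermaIdeal (classical c).incl lam ≠ ⊤) : branching (classical c) ν lam =
      Module.finrank ℂ (hwSpace (classical c).incl (glIrrep N ν) lam) := by
  obtain ⟨f, hf⟩ := exists_glIrrepHom hν
  have : FiniteDimensional ℂ (glIrrep N ν) :=
    FiniteDimensional.of_injective f.toLinearMap hf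
  exact (classicalTriangular hc hn).finrank_irrepHom
    (((isUnitarizable_symPower N s k).of_injective f hf).restrict hc) hlam

/-- The multiplicities of the symmetric powers over the classical Lie algebra are sums of branching
coefficients. -/
theorem finrank_hwSpace_eq_sum_branching (hc : ∀ i, c i.rev = -s * c i) (hn : 2 * n ≤ N)
    {lam : Fin n → ℤ} (hlam : vermaIdeal (classical c).incl lam ≠ ⊤) :
    Module.finrank ℂ
      (hwSpace (classical c).incl (symPower ℂ (FormSpace N s) (gl N) k) lam) =
      ∑ ν ∈ evenPartitions N s k, branching (classical c) ν lam := by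
  classical
  have hint : (glTriangular N).IsIntegral (symPower ℂ (FormSpace N s) (gl N) k) :=
    ((glTriangular N).isIntegral_of_iSup_eq_top iSup_weightSpace_sym).submodule _
  have h1 := (glTriangular N).additive_eq_finsum (G := ℤ)
    (fun M _ _ _ _ => (Module.finrank ℂ (hwSpace (classical c).incl M lam) : ℤ))
    (fun M M' _ _ _ _ _ _ _ _ e => by rw [finrank_hwSpace_congr (restrictEquiv e)])
    (fun M _ _ _ _ _ A B h => by rw [finrank_hwSpace_restrict_add h, Nat.cast_add])
    (symPower ℂ (FormSpace N s) (gl N) k) (isUnitarizable_symPower N s k) hint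
  have hsupp : (Function.support fun μ : Fin N → ℤ =>
      Module.finrank ℂ (hwSpace (glId N) (symPower ℂ (FormSpace N s) (gl N) k) μ) •
        (Module.finrank ℂ (hwSpace (classical c).incl (Irrep (glId N) μ) lam) : ℤ)) ⊆
      ((evenPartitions N s k).image fun ν i => (ν i : ℤ) : Finset (Fin N → ℤ)) := by
    intro μ hμ
    by_contra h
    refine hμ ?_
    dsimp only
    rw [finrank_hwSpace_symPower, if_neg fun h' => h (Finset.mem_coe.mpr h'), zero_smul]
  rw [finsum_eq_sum_of_support_subset _ hsupp, Finset.sum_image] at h1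
  · have h2 : ∀ ν ∈ evenPartitions N s k,
        Module.finrank ℂ (hwSpace (glId N) (symPower ℂ (FormSpace N s) (gl N) k)
          fun i => (ν i : ℤ)) •
        (Module.finrank ℂ (hwSpace (classical c).incl (Irrep (glId N) fun i => (ν i : ℤ)) lam) : ℤ)
        = (branching (classical c) ν lam : ℤ) := by
      intro ν hν
      rw [finrank_hwSpace_symPower, if_pos (Finset.mem_image_of_mem _ hν), one_smul,
        branching_eq_finrank hc hn hν hlam]
    rw [Finset.sum_congr rfl h2] at h1
    exact_mod_cast h1
  · intro ν _ ν' _ h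
    funext i
    exact Int.ofNat_injective (congrFun h i)

/-- The decomposition of the symmetric powers of the adjoint representation, for a set `P` of
weights that contains the highest weights that occur and whose Verma modules do not vanish. -/
theorem symPowerChar_classical (hc : ∀ i, c i.rev = -s * c i) (hn : 2 * n ≤ N)
    (hN : N ≤ 2 * n + 1) {P : Set (Fin n → ℤ)}
    (hP : ∀ (lam : Fin n → ℤ) (v : symPower ℂ (FormSpace N s) (gl N) k),
      v ∈ hwSpace (classical c).incl (symPower ℂ (FormSpace N s) (gl N) k) lam → v ≠ 0 → lam ∈ P)
    (hverma : ∀ lam ∈ P, vermaIdeal (classical c).incl lam ≠ ⊤) :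
    {lam ∈ P | ∃ ν ∈ evenPartitions N s k, branching (classical c) ν lam ≠ 0}.Finite ∧
      symPowerChar n (classical c) k = ∑ᶠ lam ∈ P, ∑ ν ∈ evenPartitions N s k,
        branching (classical c) ν lam • weylChar (classical c) lam := by
  let T := classicalTriangular hc hn
  constructor
  · refine (T.finite_highestWeights (M := symPower ℂ (FormSpace N s) (gl N) k)).subset ?_
    rintro lam ⟨hlam, ν, hν, hb⟩ hbot
    have h1 := finrank_hwSpace_eq_sum_branching (k := k) hc hn (hverma lam hlam)
    rw [hbot, finrank_bot] at h1
    exact hb (Finset.sum_eq_zero_iff.mp h1.symm ν hν)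
  · have h1 : symPowerChar n (classical c) k =
        formalChar (classical c).incl n (symPower ℂ (FormSpace N s) (gl N) k) :=
      formalChar_congr (symPowerCongr (adjointEquiv hc) (adjointEquiv_lie hc) k)
    have hint : T.IsIntegral (symPower ℂ (FormSpace N s) (gl N) k) :=
      (isIntegral_restrict hc hn hN iSup_weightSpace_sym).of_injective
        ((symPower ℂ (FormSpace N s) (gl N) k).incl.restrictLie (classical c)) Subtype.val_injective
    have h2 := T.additive_eq_finsum (fun M _ _ _ _ => formalChar (classical c).incl n M)
      (fun M M' _ _ _ _ _ _ _ _ e => formalChar_congr e)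
      (fun M _ _ _ _ _ A B h => T.formalChar_add h)
      (symPower ℂ (FormSpace N s) (gl N) k) ((isUnitarizable_symPower N s k).restrict hc) hint
    rw [h1, h2]
    refine finsum_congr fun lam => ?_
    by_cases hlam : lam ∈ P
    · rw [finrank_hwSpace_eq_sum_branching hc hn (hverma lam hlam), Finset.sum_smul]
      simp only [hlam, finsum_true]
      rfl
    · have hbot : hwSpace (classical c).incl (symPower ℂ (FormSpace N s) (gl N) k) lam = ⊥ := by
        rw [Submodule.eq_bot_iff]
        intro v hv
        by_contra h0
        exact hlam (hP lam v hv h0)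
      rw [hbot, finrank_bot, zero_smul]
      simp only [hlam, finsum_false]

theorem so_eq_classical (N : ℕ) : so N = classical (1 : Fin N → ℤˣ) := by
  unfold so classical signForm
  congr 2
  simp

theorem sp_eq_classical (n : ℕ) :
    sp n = classical fun i : Fin (2 * n) => if i < i.rev then (1 : ℤˣ) else -1 := by
  unfold sp classical signForm
  congr 1
  ext i j
  simp only [Matrix.of_apply]
  by_cases h : j = i.rev
  · subst h
    rw [if_pos rfl, if_pos rfl]
    split_ifs <;> simp
  · rw [if_neg h, if_neg h]

end Branching

end ClassicalBranching

end

open ClassicalBranching in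
theorem mainTheorem8 (k : ℕ) :
    (∀ n : ℕ, 2 ≤ n →
      {lam ∈ partitionWeights n |
        ∃ ν ∈ evenColumns (2 * n + 1) (2 * k), branching (so (2 * n + 1)) ν lam ≠ 0}.Finite ∧
      symPowerChar n (so (2 * n + 1)) k =
        ∑ᶠ lam ∈ partitionWeights n, ∑ ν ∈ evenColumns (2 * n + 1) (2 * k),
          branching (so (2 * n + 1)) ν lam • weylChar (so (2 * n + 1)) lam) ∧
    (∀ n : ℕ, 4 ≤ n →
      {lam ∈ dominantWeightsD n |
        ∃ ν ∈ evenColumns (2 * n) (2 * k), branching (so (2 * n)) ν lam ≠ 0}.Finite ∧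
      symPowerChar n (so (2 * n)) k =
        ∑ᶠ lam ∈ dominantWeightsD n, ∑ ν ∈ evenColumns (2 * n) (2 * k),
          branching (so (2 * n)) ν lam • weylChar (so (2 * n)) lam) ∧
    (∀ n : ℕ, 2 ≤ n →
      {lam ∈ partitionWeights n |
        ∃ ν ∈ evenRows (2 * n) (2 * k), branching (sp n) ν lam ≠ 0}.Finite ∧
      symPowerChar n (sp n) k =
        ∑ᶠ lam ∈ partitionWeights n, ∑ ν ∈ evenRows (2 * n) (2 * k),
          branching (sp n) ν lam • weylChar (sp n) lam) := by
  have hso : ∀ (N : ℕ) (i : Fin N), (1 : Fin N → ℤˣ) i.rev = - -1 * (1 : Fin N → ℤˣ) i := by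
    intro N i
    simp
  refine ⟨fun n _ => ?_, fun n hn => ?_, fun n _ => ?_⟩
  · rw [so_eq_classical]
    exact symPowerChar_classical (s := -1) (hso _) (by omega) le_rfl
      (fun lam v hv h0 => mem_partitionWeights_of_odd (hso _) rfl
        ((isUnitarizable_symPower _ _ k).restrict (hso _)) hv h0)
      fun lam h => (hasHighestWeight_of_mem_partitionWeights _ (by omega) h).vermaIdeal_ne_top
  · rw [so_eq_classical]
    exact symPowerChar_classical (s := -1) (hso _) le_rfl (by omega)
      (fun lam v hv h0 => mem_dominantWeightsD (hso _) le_rfl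
        ((isUnitarizable_symPower _ _ k).restrict (hso _)) hv h0)
      fun lam h => (hasHighestWeight_of_mem_dominantWeightsD (by omega) (hso _) h).vermaIdeal_ne_top
  · rw [sp_eq_classical]
    have hsp : ∀ i : Fin (2 * n), (if i.rev < i.rev.rev then (1 : ℤˣ) else -1) =
        -1 * if i < i.rev then (1 : ℤˣ) else -1 := by
      intro i
      have hi := Fin.val_rev i
      rw [Fin.rev_rev]
      by_cases h : i < i.rev
      · rw [if_pos h, if_neg h.asymm, mul_one]
      · rw [if_neg h, if_pos]
        · simp
        · rw [Fin.lt_def] at h ⊢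
          omega
    exact symPowerChar_classical (s := 1) hsp le_rfl (by omega)
      (fun lam v hv h0 => mem_partitionWeights_of_alternating hsp le_rfl
        ((isUnitarizable_symPower _ _ k).restrict (s := 1) hsp) hv h0)
      fun lam h => (hasHighestWeight_of_mem_partitionWeights _ (by omega) h).vermaIdeal_ne_top
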